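/- **Setting.** Let $\mathcal P$ be the set of probability densities $\rho$ on $\mathbb R^d$ with $\int|x|^2\rho(x)\,dx<\infty$ (identified with the measures $\rho\,dx$), with the Wasserstein-2 distance $W_2(\mu,\nu)=\big(\inf_{\pi}\iint|x-y|^2\,d\pi(x,y)\big)^{1/2}$, the infimum being over all couplings $\pi$ of $\mu$ and $\nu$. Let $\mathcal F:\mathcal P\to\mathbb R$ have at every $\rho\in\mathcal P$ a first variation $\frac{\delta\mathcal F}{\delta\rho}(\rho,\cdot)\in C^1(\mathbb R^d)$, meaning that for all $\chi\in\mathcal P$ this function is integrable against $\rho$ and $\chi$ and $$\frac{d}{d\varepsilon}\Big|_{\varepsilon=0^+}\mathcal F(\rho+\varepsilon(\chi-\rho))=\int\frac{\delta\mathcal F}{\delta\rho}(\rho,x)\,(\chi-\rho)(x)\,dx .$$ Let $\lambda$ be a probability measure on $\mathbb R^d$ that is absolutely continuous with respect to Lebesgue measure. Assume that there is a constant $C_{\mathcal F}>0$ such that for any two measurable maps $T,\widetilde T:\mathbb R^d\to\mathbb R^d$ with $T_\sharp\lambda,\widetilde T_\sharp\lambda\in\mathcal P$, $$\int\Big|\nabla\tfrac{\delta\mathcal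 F}{\delta\rho}(T_\sharp\lambda,T(z))-\nabla\tfrac{\delta\mathcal F}{\delta\rho}(\widetilde T_\sharp\lambda,\widetilde T(z))\Big|^2d\lambda(z)\le C_{\mathcal F}\int|T(z)-\widetilde T(z)|^2\,d\lambda(z).$$ Let $\Theta\subset\mathbb R^n$ be open and let $(T_\theta)_{\theta\in\Theta}$ be measurable maps $\mathbb R^d\to\mathbb R^d$ with $\rho_\theta:=T_{\theta\sharp}\lambda\in\mathcal P$, such that $\theta\mapsto T_\theta(z)$ is $C^1$ on $\Theta$ for each $z$, and $\partial_\theta T_\theta\in L^2(\lambda)$ depends continuously on $\theta\in\Theta$ in $L^2(\lambda)$. Put $F(\theta)=\mathcal F(\rho_\theta)$ and $\widehat G(\theta)=\int\partial_\theta T_\theta(z)^\top\partial_\theta T_\theta(z)\,d\lambda(z)$, let $\widehat G(\theta)^\dagger$ be its Moore–Penrose pseudo-inverse, and let $$\delta_0=\sup_{\theta\in\Theta}\ \inf_{\xi\in\mathbb R^n}\int\Big|\nabla\tfrac{\delta\mathcal F}{\delta\rho}(\rho_\theta,T_\theta(z))-\partial_\theta T_\theta(z)\,\xi\Big|^2d\lambda(z)\in[0,\infty],$$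 the worst-case squared $L^2(\lambda)$ distance of $\nabla\frac{\delta\mathcal F}{\delta\rho}(\rho_\theta,\cdot)\circ T_\theta$ from the span of the partial derivatives $\partial_{\theta_1}T_\theta,\dots,\partial_{\theta_n}T_\theta$ (that is, from its orthogonal projection onto this span). **Theorem.** Let $\theta:[0,\tau]\to\Theta$ be a differentiable solution of the parameterized Wasserstein gradient flow $$\dot\theta(t)=-\widehat G(\theta(t))^\dagger\,\nabla_\theta F(\theta(t)),$$ where $F$ is differentiable at each $\theta(t)$, and let $\rho:[0,\tau]\to\mathcal P$ be a $W_2$-continuous weak solution of the Wasserstein gradient flow $\partial_t\rho=\nabla\cdot\big(\rho\,\nabla\frac{\delta\mathcal F}{\delta\rho}(\rho)\big)$, that is, for every $\varphi\in C_c^\infty(\mathbb R^d)$ and $t\in[0,\tau]$ the function $s\mapsto\int\nabla\varphi(x)\cdot\nabla\frac{\delta\mathcal F}{\delta\rho}(\rho(s),x)\,\rho(s,x)\,dx$ is integrable on $[0,t]$ and $$\int\varphi(x)\,\rho(t,x)\,dx=\int\varphi(x)\,\rho(0,x)\,dx-\int_0^t\!\int\nabla\varphi(x)\cdot\nabla\tfrac{\delta\mathcal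 F}{\delta\rho}(\rho(s),x)\,\rho(s,x)\,dx\,ds .$$ Then for every $t\in[0,\tau]$ $$W_2^2(\rho_{\theta(t)},\rho(t))\le e^{(1+2C_{\mathcal F})t}\,W_2^2(\rho_{\theta(0)},\rho(0))+\frac{2\delta_0}{1+2C_{\mathcal F}}\Big(e^{(1+2C_{\mathcal F})t}-1\Big),$$ where for $t=0$ the last term is $0$ even if $\delta_0=\infty$. -/

import Mathlib

open MeasureTheory Set Filter Topology
open scoped ENNReal ContDiff Matrix

noncomputable section

namespace PWGF

/-- Euclidean space with its Euclidean norm and inner product. -/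
abbrev Euc (d : ℕ) : Type := EuclideanSpace ℝ (Fin d)

/-- The density space: a probability density with finite second moment is identified with the
absolutely continuous probability measure that it defines. -/
structure IsDensity {d : ℕ} (μ : Measure (Euc d)) : Prop where
  isProb : IsProbabilityMeasure μ
  absCont : μ ≪ (volume : Measure (Euc d))
  secondMoment : ∫⁻ x, ‖x‖ₑ ^ 2 ∂μ < ⊤

/-- `π` is a coupling of `μ` and `ν`, that is, it has them as its marginals. -/
def IsCoupling {d : ℕ} (μ ν : Measure (Euc d)) (π : Measure (Euc d × Euc d)) : Prop :=
  π.map Prod.fst = μ ∧ π.map Prod.snd = ν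

/-- The Wasserstein-2 distance. -/
def W2 {d : ℕ} (μ ν : Measure (Euc d)) : ℝ≥0∞ :=
  (⨅ (π : Measure (Euc d × Euc d)) (_ : IsCoupling μ ν π),
    ∫⁻ p, ‖p.1 - p.2‖ₑ ^ 2 ∂π) ^ (1 / 2 : ℝ)

/-- The convex combination `(1 - ε) ρ + ε χ = ρ + ε (χ - ρ)`, for `0 ≤ ε ≤ 1`. -/
def mix {d : ℕ} (ρ χ : Measure (Euc d)) (ε : ℝ) : Measure (Euc d) :=
  ENNReal.ofReal (1 - ε) • ρ + ENNReal.ofReal ε • χ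

/-- `g` is the `L²` first variation of `F` at the density `ρ`: the derivative of `F` at `ρ` in
every admissible direction `σ = χ - ρ` exists and is `∫ g σ`. Only the values of `F` on densities
are used. -/
def IsFirstVariation {d : ℕ} (F : Measure (Euc d) → ℝ) (ρ : Measure (Euc d))
    (g : Euc d → ℝ) : Prop :=
  ∀ χ : Measure (Euc d), IsDensity χ →
    Integrable g χ ∧ Integrable g ρ ∧
      HasDerivWithinAt (fun ε : ℝ => F (mix ρ χ ε)) (∫ x, g x ∂χ - ∫ x, g x ∂ρ) (Icc 0 1) 0

/-- `δF` gives the first variation of `F` at every density `ρ`, as a function `δF ρ` of the space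
variable that is continuously differentiable. -/
def HasFirstVariation {d : ℕ} (F : Measure (Euc d) → ℝ)
    (δF : Measure (Euc d) → Euc d → ℝ) : Prop :=
  ∀ ρ : Measure (Euc d), IsDensity ρ → IsFirstVariation F ρ (δF ρ) ∧ ContDiff ℝ 1 (δF ρ)

/-- The Lipschitz-type condition with constant `C`: for any two push-forward maps `T`, `S`,
`∫ |∇(δF(T♯lam)) ∘ T - ∇(δF(S♯lam)) ∘ S|² dlam ≤ C ∫ |T - S|² dlam`. -/
def LipCondition {d : ℕ} (lam : Measure (Euc d)) (δF : Measure (Euc d) → Euc d → ℝ)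
    (C : ℝ) : Prop :=
  ∀ T S : Euc d → Euc d, Measurable T → Measurable S →
    IsDensity (lam.map T) → IsDensity (lam.map S) →
      ∫⁻ z, ‖gradient (δF (lam.map T)) (T z) - gradient (δF (lam.map S)) (S z)‖ₑ ^ 2 ∂lam
        ≤ ENNReal.ofReal C * ∫⁻ z, ‖T z - S z‖ₑ ^ 2 ∂lam

/-- Weak solutions on `[0, τ]` of the Wasserstein gradient flow `∂ₜρ = ∇ · (ρ ∇ δF(ρ))`:
`W2`-continuous curves of densities that satisfy the equation against smooth compactly supported
test functions of the space variable, integrated in time. -/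
structure IsWGFSolution {d : ℕ} (δF : Measure (Euc d) → Euc d → ℝ) (τ : ℝ)
    (ρ : ℝ → Measure (Euc d)) : Prop where
  isDensity : ∀ t ∈ Icc 0 τ, IsDensity (ρ t)
  continuous : ∀ t ∈ Icc 0 τ, Tendsto (fun s => W2 (ρ s) (ρ t)) (𝓝[Icc 0 τ] t) (𝓝 0)
  weak : ∀ φ : Euc d → ℝ, ContDiff ℝ ∞ φ → HasCompactSupport φ → ∀ t ∈ Icc 0 τ,
    IntervalIntegrable
      (fun s => ∫ x, inner ℝ (gradient φ x) (gradient (δF (ρ s)) x) ∂(ρ s)) volume 0 t ∧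
    ∫ x, φ x ∂(ρ t) = ∫ x, φ x ∂(ρ 0)
      - ∫ s in (0 : ℝ)..t, ∫ x, inner ℝ (gradient φ x) (gradient (δF (ρ s)) x) ∂(ρ s)

/-- The derivative `∂_θ T_θ(z)` of the parameterized map in the parameter (the `d × n` Jacobian
matrix, as a linear map). -/
def dParam {n d : ℕ} (T : Euc n → Euc d → Euc d) (θ : Euc n) (z : Euc d) : Euc n →L[ℝ] Euc d :=
  fderiv ℝ (fun θ' => T θ' z) θ

/-- A parameterized family of push-forward maps over the parameter space `Θ`: `T_θ` pushes the
reference measure to a density, is continuously differentiable in `θ`, and `∂_θ T_θ` is square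
integrable and depends continuously on `θ` in the `L²` sense. -/
structure IsParamFamily {n d : ℕ} (lam : Measure (Euc d)) (Θ : Set (Euc n))
    (T : Euc n → Euc d → Euc d) : Prop where
  isOpen : IsOpen Θ
  measurable : ∀ θ ∈ Θ, Measurable (T θ)
  isDensity : ∀ θ ∈ Θ, IsDensity (lam.map (T θ))
  contDiffOn : ∀ z, ContDiffOn ℝ 1 (fun θ => T θ z) Θ
  memLp : ∀ θ ∈ Θ, MemLp (dParam T θ) 2 lam
  continuousL2 : ∀ θ ∈ Θ,
    Tendsto (fun θ' => ∫⁻ z, ‖dParam T θ' z - dParam T θ z‖ₑ ^ 2 ∂lam) (𝓝 θ) (𝓝 0)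

/-- The metric tensor `Ĝ(θ) = ∫ ∂_θ T_θ(z)ᵀ ∂_θ T_θ(z) dlam(z)`, entry by entry. -/
def metricTensor {n d : ℕ} (lam : Measure (Euc d)) (T : Euc n → Euc d → Euc d) (θ : Euc n) :
    Matrix (Fin n) (Fin n) ℝ :=
  Matrix.of fun i j => ∫ z, inner ℝ (dParam T θ z (EuclideanSpace.single i 1))
    (dParam T θ z (EuclideanSpace.single j 1)) ∂lam

/-- `B` is the Moore-Penrose pseudo-inverse of the real matrix `A` (the Penrose equations). -/
structure IsPseudoInverse {n : ℕ} (A B : Matrix (Fin n) (Fin n) ℝ) : Prop where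
  mul_mul_left : A * B * A = A
  mul_mul_right : B * A * B = B
  symm_left : (A * B)ᵀ = A * B
  symm_right : (B * A)ᵀ = B * A

theorem IsPseudoInverse.unique {n : ℕ} {A B C : Matrix (Fin n) (Fin n) ℝ}
    (hB : IsPseudoInverse A B) (hC : IsPseudoInverse A C) : B = C := by
  have h1 : A * B = A * C := by
    calc A * B = (A * B)ᵀ := hB.symm_left.symm
      _ = ((A * C) * (A * B))ᵀ := by rw [← Matrix.mul_assoc, hC.mul_mul_left]
      _ = (A * B) * (A * C) := by rw [Matrix.transpose_mul, hB.symm_left, hC.symm_left]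
      _ = A * C := by rw [← Matrix.mul_assoc, hB.mul_mul_left]
  have h2 : B * A = C * A := by
    calc B * A = (B * A)ᵀ := hB.symm_right.symm
      _ = ((B * A) * (C * A))ᵀ := by
        rw [Matrix.mul_assoc, ← Matrix.mul_assoc A, hC.mul_mul_left]
      _ = (C * A) * (B * A) := by rw [Matrix.transpose_mul, hB.symm_right, hC.symm_right]
      _ = C * A := by rw [Matrix.mul_assoc, ← Matrix.mul_assoc A, hB.mul_mul_left]
  calc B = B * A * B := hB.mul_mul_right.symm
    _ = C * (A * B) := by rw [h2, Matrix.mul_assoc]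
    _ = C * A * C := by rw [h1, Matrix.mul_assoc]
    _ = C := hC.mul_mul_right

/-- The energy as a function of the parameter, `F(θ) = F(T_θ♯lam)`. -/
def paramEnergy {n d : ℕ} (F : Measure (Euc d) → ℝ) (lam : Measure (Euc d))
    (T : Euc n → Euc d → Euc d) (θ : Euc n) : ℝ :=
  F (lam.map (T θ))

/-- Solutions on `[0, τ]` of the parameterized Wasserstein gradient flow
`θ' = - Ĝ(θ)† ∇_θ F(θ)`. -/
structure IsPWGFSolution {n d : ℕ} (F : Measure (Euc d) → ℝ) (lam : Measure (Euc d))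
    (Θ : Set (Euc n)) (T : Euc n → Euc d → Euc d) (τ : ℝ) (θ : ℝ → Euc n) : Prop where
  mem : ∀ t ∈ Icc 0 τ, θ t ∈ Θ
  differentiable : ∀ t ∈ Icc 0 τ, DifferentiableAt ℝ (paramEnergy F lam T) (θ t)
  hasDeriv : ∀ t ∈ Icc 0 τ, ∃ P : Matrix (Fin n) (Fin n) ℝ,
    IsPseudoInverse (metricTensor lam T (θ t)) P ∧
    HasDerivWithinAt θ
      (-(Matrix.toEuclideanLin P (gradient (paramEnergy F lam T) (θ t)))) (Icc 0 τ) t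

/-- The projection error: the supremum over `θ ∈ Θ` of the squared `L²` distance between
`∇(δF(T_θ♯lam)) ∘ T_θ` and the span of the partial derivatives of `T_θ` in the parameter. It may
be infinite. -/
def projError {n d : ℕ} (δF : Measure (Euc d) → Euc d → ℝ) (lam : Measure (Euc d))
    (Θ : Set (Euc n)) (T : Euc n → Euc d → Euc d) : ℝ≥0∞ :=
  ⨆ θ ∈ Θ, ⨅ ξ : Euc n,
    ∫⁻ z, ‖gradient (δF (lam.map (T θ))) (T θ z) - dParam T θ z ξ‖ₑ ^ 2 ∂lam

end PWGF

end

noncomputable section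

namespace PWGF

open ProbabilityTheory

/-! ### Couplings, gluing and the Wasserstein distance. -/

section Wasserstein

variable {d : ℕ} {Ω : Type*} [MeasurableSpace Ω]

/-! Write $g_\mu=\nabla\frac{\delta\mathcal F}{\delta\rho}(\mu,\cdot)$ and $L=\sqrt{C_{\mathcal
F}}$. The squared distance between the two flows has right slope at most $(1+2C_{\mathcal
F})W_2^2+2\delta_0$, and Grönwall's inequality finishes. For the slope, take a nearly optimal
coupling at time $s$ and move both marginals by one explicit Euler step of length $h$, with
velocities $-\partial_\theta T\,\xi$ and $-g_{\rho(s)}$. The difference of the velocities is a sum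
of two parts: the projection error $g_\mu\circ T-\partial_\theta T\,\xi$, of squared norm at most
$\delta_0$, and $g_\mu-g_{\rho(s)}$ along the coupling, of squared norm at most $C_{\mathcal F}$
times the transport cost. Young's inequality gives the constants (`IsLipField.W2_sq_step_le`). It
remains to see that both flows stay within $o(h)$ in $W_2$ of their Euler steps, and that the
pseudo-inverse does produce the projection.

The weak solution is the hard side (`IsWGFSolution.W2_euler_step_le`), since neither spatial
regularity of $g_\mu$ beyond continuity nor uniqueness is assumed. First, an absolutely continuous
$\lambda$ in positive dimension represents every coupling, so the hypothesis on maps is one on all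
couplings. Coupling a density of full support with itself so as to exchange mass then forces its
field to be globally $L$-Lipschitz (`IsLipField.norm_sub_le`). Mixing in a little full support and
mollifying approximates any $g_\mu$ in $L^2(\mu)$ by smooth $L$-Lipschitz fields. Next, split
$[s,s+h]$ into many substeps and compose Euler substeps with these fields. Pulling a test function
back through the substeps keeps its derivatives under control, so the weak equation shows that the
law of the composed map is arbitrarily close to $\rho(s+h)$ against test functions, while the map
stays $L^2$-close to $x-hg_{\rho(s)}(x)$ with a bound independent of the substep. Lower
semicontinuity of $W_2$ turns this into the $o(h)$ bound.

On the parameter side, $\theta\mapsto T_\theta$ is differentiable into $L^2(\lambda)$, and a second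
order expansion of the energy along couplings (`HasFirstVariation.energy_taylor`) gives the chain
rule for $\nabla_\theta F$. The vector $\widehat G^\dagger\nabla_\theta F$ then solves the normal
equations, so it is the coefficient vector of an orthogonal projection
(`IsParamFamily.eLpNorm_sq_le_projError`). -/

theorem eLpNorm_two_eq {E : Type*} [NormedAddCommGroup E] (f : Ω → E) (μ : Measure Ω) :
    eLpNorm f 2 μ = (∫⁻ x, ‖f x‖ₑ ^ 2 ∂μ) ^ (1 / 2 : ℝ) := by
  rw [eLpNorm_eq_lintegral_rpow_enorm_toReal (by norm_num) (by norm_num)]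
  simp

theorem eLpNorm_two_sq {E : Type*} [NormedAddCommGroup E] (f : Ω → E) (μ : Measure Ω) :
    eLpNorm f 2 μ ^ 2 = ∫⁻ x, ‖f x‖ₑ ^ 2 ∂μ := by
  rw [eLpNorm_two_eq, ← ENNReal.rpow_natCast, ← ENNReal.rpow_mul]
  norm_num

theorem eLpNorm_two_map {E : Type*} [NormedAddCommGroup E] [MeasurableSpace E] [BorelSpace E]
    [SecondCountableTopology E] {Ω' : Type*} [MeasurableSpace Ω'] {μ : Measure Ω} {X : Ω → Ω'}
    (hX : Measurable X) {f : Ω' → E} (hf : Measurable f) :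
    eLpNorm f 2 (μ.map X) = eLpNorm (f ∘ X) 2 μ :=
  eLpNorm_map_measure hf.aestronglyMeasurable hX.aemeasurable

theorem W2_map_le {γ : Measure Ω} {X Y : Ω → Euc d} (hX : Measurable X) (hY : Measurable Y) :
    W2 (γ.map X) (γ.map Y) ≤ eLpNorm (fun x => X x - Y x) 2 γ := by
  rw [W2, eLpNorm_two_eq]
  gcongr
  refine iInf₂_le_of_le (γ.map fun x => (X x, Y x)) ⟨?_, ?_⟩ ?_
  · rw [Measure.map_map measurable_fst (hX.prodMk hY)]; rfl
  · rw [Measure.map_map measurable_snd (hX.prodMk hY)]; rfl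
  · rw [lintegral_map (by fun_prop) (hX.prodMk hY)]

/-- Nearly optimal couplings suffice throughout, so existence of an optimal one is never needed. -/
theorem exists_coupling_lt {μ ν : Measure (Euc d)} {c : ℝ≥0∞} (h : W2 μ ν < c) :
    ∃ π : Measure (Euc d × Euc d), IsCoupling μ ν π ∧
      eLpNorm (fun p => p.1 - p.2) 2 π < c := by
  have h2 : (⨅ (π : Measure (Euc d × Euc d)) (_ : IsCoupling μ ν π),
      ∫⁻ p, ‖p.1 - p.2‖ₑ ^ 2 ∂π) < c ^ (2 : ℝ) := by
    have := ENNReal.rpow_lt_rpow h (z := 2) (by norm_num)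
    rwa [W2, ← ENNReal.rpow_mul, one_div, inv_mul_cancel₀ (by norm_num), ENNReal.rpow_one] at this
  obtain ⟨π, hπ⟩ := iInf_lt_iff.1 h2
  obtain ⟨hc, hlt⟩ := iInf_lt_iff.1 hπ
  refine ⟨π, hc, ?_⟩
  rw [eLpNorm_two_eq]
  have := ENNReal.rpow_lt_rpow hlt (z := 1 / 2) (by norm_num)
  rwa [← ENNReal.rpow_mul, mul_one_div_cancel (by norm_num), ENNReal.rpow_one] at this

theorem W2_le_of_isCoupling {μ ν : Measure (Euc d)} {π : Measure (Euc d × Euc d)}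
    (h : IsCoupling μ ν π) : W2 μ ν ≤ eLpNorm (fun p => p.1 - p.2) 2 π := by
  rw [← h.1, ← h.2]
  exact W2_map_le measurable_fst measurable_snd

theorem IsCoupling.isProbabilityMeasure {μ ν : Measure (Euc d)} {π : Measure (Euc d × Euc d)}
    (h : IsCoupling μ ν π) [IsProbabilityMeasure μ] : IsProbabilityMeasure π := by
  have : IsProbabilityMeasure (π.map Prod.fst) := by rw [h.1]; infer_instance
  exact Measure.isProbabilityMeasure_of_map Prod.fst

theorem le_mul_W2 {μ ν : Measure (Euc d)} [IsProbabilityMeasure μ] [IsProbabilityMeasure ν]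
    {a N : ℝ≥0∞} (ha : a ≠ ⊤)
    (h : ∀ π, IsCoupling μ ν π → N ≤ a * eLpNorm (fun p => p.1 - p.2) 2 π) : N ≤ a * W2 μ ν := by
  rcases eq_or_ne a 0 with rfl | ha0
  -- Division by `a` is impossible here, but one coupling is enough, and the product is always
  -- available.
  · simpa using h (μ.prod ν) ⟨by simp, by simp⟩
  rw [mul_comm, ← ENNReal.div_le_iff_le_mul (Or.inl ha0) (Or.inl ha)]
  refine le_of_forall_gt_imp_ge_of_dense fun c hc => ?_
  obtain ⟨π, hπ, hlt⟩ := exists_coupling_lt hc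
  refine ENNReal.div_le_of_le_mul ((h π hπ).trans ?_)
  rw [mul_comm]
  gcongr

theorem IsCoupling.symm {μ ν : Measure (Euc d)} {π : Measure (Euc d × Euc d)}
    (h : IsCoupling μ ν π) : IsCoupling ν μ (π.map Prod.swap) := by
  constructor
  · rw [Measure.map_map measurable_fst measurable_swap]; exact h.2
  · rw [Measure.map_map measurable_snd measurable_swap]; exact h.1

theorem eLpNorm_two_sub_comm {E : Type*} [NormedAddCommGroup E] (f g : Ω → E) (μ : Measure Ω) :
    eLpNorm (fun x => f x - g x) 2 μ = eLpNorm (fun x => g x - f x) 2 μ := by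
  apply eLpNorm_congr_norm_ae
  exact Eventually.of_forall fun x => norm_sub_rev _ _

theorem W2_comm (μ ν : Measure (Euc d)) : W2 μ ν = W2 ν μ := by
  have key : ∀ μ ν : Measure (Euc d), W2 μ ν ≤ W2 ν μ := by
    intro μ ν
    refine le_of_forall_gt fun c hc => ?_
    obtain ⟨π, hπ, hlt⟩ := exists_coupling_lt hc
    refine lt_of_le_of_lt (W2_le_of_isCoupling hπ.symm) ?_
    rw [eLpNorm_two_map measurable_swap (by fun_prop)]
    refine lt_of_le_of_lt (le_of_eq ?_) hlt
    exact eLpNorm_two_sub_comm _ _ _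
  exact le_antisymm (key _ _) (key _ _)

/-- Gluing: a coupling of the law of `f` with another measure extends to the space on which `f`
is defined. -/
theorem exists_gluing {E F : Type*} [MeasurableSpace E] [MeasurableSpace F]
    [StandardBorelSpace F] [Nonempty F] (γ : Measure Ω) [IsProbabilityMeasure γ] {f : Ω → E}
    (hf : Measurable f) (π : Measure (E × F)) (hπ : π.map Prod.fst = γ.map f) :
    ∃ γ' : Measure (Ω × F), γ'.map Prod.fst = γ ∧ γ'.map (fun p => (f p.1, p.2)) = π := by
  have h1 : IsProbabilityMeasure (γ.map f) := Measure.isProbabilityMeasure_map hf.aemeasurable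
  have h2 : IsProbabilityMeasure (π.map Prod.fst) := by rw [hπ]; exact h1
  have h3 : IsProbabilityMeasure π := Measure.isProbabilityMeasure_of_map Prod.fst
  -- Disintegrate `π` over its first marginal and draw the second coordinate from the conditional
  -- law at `f ω`.
  refine ⟨γ ⊗ₘ (π.condKernel.comap f hf), Measure.fst_compProd _ _, ?_⟩
  conv_rhs => rw [← π.disintegrate π.condKernel]
  have : π.fst = γ.map f := hπ
  rw [this]
  ext s hs
  rw [Measure.map_apply (by fun_prop) hs, Measure.compProd_apply (by measurability),
    Measure.compProd_apply hs, lintegral_map (Kernel.measurable_kernel_prodMk_left hs) hf]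
  rfl

/-- Two nearly optimal couplings are glued along their common marginal `ν`; Minkowski's inequality
in $L^2$ of the glued measure does the rest. -/
theorem W2_triangle (μ ν σ : Measure (Euc d)) [IsProbabilityMeasure μ] :
    W2 μ σ ≤ W2 μ ν + W2 ν σ := by
  refine ENNReal.le_of_forall_pos_le_add fun ε hε hfin => ?_
  have hε2 : (0 : ℝ≥0∞) < ε / 2 := by simpa using hε.ne'
  obtain ⟨h1, h2⟩ := ENNReal.add_lt_top.1 hfin
  obtain ⟨π, hπ, hlt⟩ := exists_coupling_lt (ENNReal.lt_add_right h1.ne hε2.ne')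
  obtain ⟨π', hπ', hlt'⟩ := exists_coupling_lt (ENNReal.lt_add_right h2.ne hε2.ne')
  have := hπ.isProbabilityMeasure
  obtain ⟨γ, hγ1, hγ2⟩ := exists_gluing π measurable_snd π' (hπ'.1.trans hπ.2.symm)
  have e1 : μ = γ.map (fun p => p.1.1) := by
    rw [← hπ.1, ← hγ1, Measure.map_map measurable_fst measurable_fst]; rfl
  have e2 : σ = γ.map (fun p => p.2) := by
    rw [← hπ'.2, ← hγ2, Measure.map_map measurable_snd (by fun_prop)]; rfl
  have l1 : eLpNorm (fun p : (Euc d × Euc d) × Euc d => p.1.1 - p.1.2) 2 γ < W2 μ ν + ε / 2 := by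
    rw [← hγ1, eLpNorm_two_map measurable_fst (by fun_prop)] at hlt
    exact hlt
  have l2 : eLpNorm (fun p : (Euc d × Euc d) × Euc d => p.1.2 - p.2) 2 γ < W2 ν σ + ε / 2 := by
    rw [← hγ2, eLpNorm_two_map (by fun_prop) (by fun_prop)] at hlt'
    exact hlt'
  calc W2 μ σ = W2 (γ.map (fun p => p.1.1)) (γ.map (fun p => p.2)) := by rw [← e1, ← e2]
    _ ≤ eLpNorm (fun p : (Euc d × Euc d) × Euc d => p.1.1 - p.2) 2 γ :=
      W2_map_le (by fun_prop) (by fun_prop)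
    _ = eLpNorm ((fun p : (Euc d × Euc d) × Euc d => p.1.1 - p.1.2) +
        (fun p => p.1.2 - p.2)) 2 γ := by congr 1; ext1 p; simp
    _ ≤ _ := eLpNorm_add_le (by fun_prop) (by fun_prop) (by norm_num)
    _ ≤ (W2 μ ν + ε / 2) + (W2 ν σ + ε / 2) := add_le_add l1.le l2.le
    _ = W2 μ ν + W2 ν σ + ε := by
      rw [add_add_add_comm, ENNReal.add_halves]

end Wasserstein

/-! ### Realizing arbitrary laws as push-forwards of the reference measure. -/

section Representation

/-- An atomless probability measure on the line is mapped to the uniform measure by its cumulative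
distribution function. -/
theorem map_cdf_eq_volume (μ : Measure ℝ) [IsProbabilityMeasure μ] [NullSingletonClass μ] :
    μ.map (fun x => (⟨cdf μ x, cdf_nonneg μ x, cdf_le_one μ x⟩ : unitInterval)) = volume := by
  -- The jump of the distribution function at a point is the mass of that point.
  have hcont : Continuous (cdf μ) := by
    rw [continuous_iff_continuousAt]
    intro x
    rw [(monotone_cdf μ).continuousAt_iff_leftLim_eq_rightLim, StieltjesFunction.rightLim_eq]
    have := (cdf μ).measure_singleton x
    rw [measure_cdf, measure_singleton, eq_comm, ENNReal.ofReal_eq_zero] at this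
    exact le_antisymm ((monotone_cdf μ).leftLim_le le_rfl) (by linarith)
  have hmeas : Measurable
      (fun x => (⟨cdf μ x, cdf_nonneg μ x, cdf_le_one μ x⟩ : unitInterval)) :=
    (hcont.subtype_mk _).measurable
  have := Measure.isProbabilityMeasure_map (μ := μ) hmeas.aemeasurable
  refine Measure.ext_of_Iic _ _ fun u => ?_
  rw [Measure.map_apply hmeas measurableSet_Iic, unitInterval.volume_Iic]
  rcases eq_or_lt_of_le u.2.2 with hu | hu
  · have : (fun x => (⟨cdf μ x, cdf_nonneg μ x, cdf_le_one μ x⟩ : unitInterval)) ⁻¹' Iic u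
        = univ := by
      ext x
      simp only [mem_preimage, mem_Iic, mem_univ, iff_true]
      exact Subtype.coe_le_coe.1 (by rw [hu]; exact cdf_le_one μ x)
    rw [this, hu]; simp
  -- The value 0 need not be attained by the distribution function, so the intermediate value
  -- argument used for `0 < u` does not apply at `u = 0`.
  rcases eq_or_lt_of_le u.2.1 with hu0 | hu0
  · have hsub : ∀ x ∈ (fun x => (⟨cdf μ x, cdf_nonneg μ x, cdf_le_one μ x⟩ : unitInterval)) ⁻¹'
        Iic u, cdf μ x ≤ 0 := by
      intro x hx
      have : cdf μ x ≤ u.1 := hx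
      rwa [← hu0] at this
    rw [← hu0, ENNReal.ofReal_zero]
    set S := (fun x => (⟨cdf μ x, cdf_nonneg μ x, cdf_le_one μ x⟩ : unitInterval)) ⁻¹' Iic u
    have hz : ∀ x ∈ S, μ (Iic x) = 0 := fun x hx => by
      rw [← ofReal_cdf]; simpa using hsub x hx
    by_contra hne
    -- Either `S` has a largest element or its rational points are cofinal in it; in both cases
    -- countably many null half-lines cover `S`.
    obtain ⟨s, hs, hsc, hcov⟩ : ∃ s : Set ℝ, s ⊆ S ∧ s.Countable ∧ ∀ x ∈ S, ∃ y ∈ s, x ≤ y := by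
      by_cases hbd : ∃ y ∈ S, ∀ x ∈ S, x ≤ y
      · obtain ⟨y, hy, h⟩ := hbd
        exact ⟨{y}, by simpa using hy, countable_singleton y, fun x hx => ⟨y, rfl, h x hx⟩⟩
      · push Not at hbd
        refine ⟨S ∩ range ((↑) : ℚ → ℝ), inter_subset_left,
          (countable_range _).mono inter_subset_right, fun x hx => ?_⟩
        obtain ⟨y, hy, hxy⟩ := hbd x hx
        obtain ⟨q, hq1, hq2⟩ := exists_rat_btwn hxy
        refine ⟨q, ⟨?_, q, rfl⟩, hq1.le⟩
        have : cdf μ q ≤ cdf μ y := monotone_cdf μ hq2.le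
        exact this.trans hy
    refine hne (measure_mono_null (t := ⋃ y ∈ s, Iic y) (fun x hx => ?_) ?_)
    · obtain ⟨y, hy, h⟩ := hcov x hx
      exact mem_biUnion hy h
    · exact (measure_biUnion_null_iff hsc).2 fun y hy => hz y (hs hy)
  · obtain ⟨a, ha⟩ := (tendsto_cdf_atBot μ).eventually_lt_const hu0 |>.exists
    obtain ⟨b, hb⟩ := (tendsto_cdf_atTop μ).eventually_const_lt hu |>.exists
    obtain ⟨x, hx⟩ := mem_range_of_exists_le_of_exists_ge hcont ⟨a, ha.le⟩ ⟨b, hb.le⟩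
    have hsub : Iic x ⊆ (fun x => (⟨cdf μ x, cdf_nonneg μ x, cdf_le_one μ x⟩ : unitInterval)) ⁻¹'
        Iic u := fun y hy => by
      have h1 : cdf μ y ≤ cdf μ x := monotone_cdf μ hy
      exact h1.trans hx.le
    -- The distribution function may be constant past `x`, so the sublevel set can exceed `Iic x`.
    -- It lies in every `Iic y` with `cdf μ y = v > u`; let `v` decrease to `u`.
    have hdiff : μ ((fun x => (⟨cdf μ x, cdf_nonneg μ x, cdf_le_one μ x⟩ : unitInterval)) ⁻¹'
        Iic u) ≤ ENNReal.ofReal u := by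
      refine ge_of_tendsto (f := fun v => ENNReal.ofReal v) (x := 𝓝[>] (u : ℝ))
        (ENNReal.continuous_ofReal.continuousAt.mono_left nhdsWithin_le_nhds) ?_
      filter_upwards [Ioo_mem_nhdsGT hu] with v hv
      obtain ⟨a, ha⟩ := (tendsto_cdf_atBot μ).eventually_lt_const (hu0.trans hv.1) |>.exists
      obtain ⟨b, hb⟩ := (tendsto_cdf_atTop μ).eventually_const_lt hv.2 |>.exists
      obtain ⟨y, hy⟩ := mem_range_of_exists_le_of_exists_ge hcont ⟨a, ha.le⟩ ⟨b, hb.le⟩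
      rw [← hy, ofReal_cdf]
      refine measure_mono fun z hz => ?_
      by_contra hcon
      have h1 : cdf μ y ≤ cdf μ z := monotone_cdf μ (le_of_not_ge hcon)
      have h2 : cdf μ z ≤ u := hz
      linarith [hv.1]
    refine le_antisymm hdiff ?_
    rw [← hx, ofReal_cdf]
    exact measure_mono hsub

/-- Every probability measure on a standard Borel space is the law of a measurable map on
an absolutely continuous probability space over a Euclidean space of positive dimension. -/
theorem exists_map_eq {d : ℕ} [NeZero d] {lam : Measure (Euc d)} [IsProbabilityMeasure lam]
    (hac : lam ≪ volume) {Y : Type*} [MeasurableSpace Y] [StandardBorelSpace Y] [Nonempty Y]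
    (π : Measure Y) [IsProbabilityMeasure π] :
    ∃ f : Euc d → Y, Measurable f ∧ lam.map f = π := by
  obtain ⟨f, hf, hfπ⟩ := Measure.exists_measurable_map_eq π
  -- Coordinate hyperplanes are Lebesgue null, so the law of one coordinate is atomless. This is
  -- where positive dimension is needed.
  have hm : Measurable (fun x : Euc d => x 0) := by fun_prop
  have hp : IsProbabilityMeasure (lam.map fun x : Euc d => x 0) :=
    Measure.isProbabilityMeasure_map hm.aemeasurable
  have hna : NullSingletonClass (lam.map fun x : Euc d => x 0) := by
    refine ⟨fun a => ?_⟩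
    rw [Measure.map_apply hm (measurableSet_singleton a)]
    refine hac ?_
    rw [show ((fun x : Euc d => x 0) ⁻¹' {a}) = (WithLp.ofLp : Euc d → (Fin d → ℝ)) ⁻¹'
      ((fun y : Fin d → ℝ => y 0) ⁻¹' {a}) from rfl,
      (PiLp.volume_preserving_ofLp (Fin d)).measure_preimage
        ((measurable_pi_apply 0) (measurableSet_singleton a)).nullMeasurableSet]
    exact Measure.pi_hyperplane (fun _ : Fin d => (volume : Measure ℝ)) 0 a
  have hF := map_cdf_eq_volume (lam.map fun x : Euc d => x 0)
  have hmeas : Measurable fun x : ℝ =>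
      (⟨cdf (lam.map fun x : Euc d => x 0) x, cdf_nonneg _ x, cdf_le_one _ x⟩ : unitInterval) :=
    (monotone_cdf _).measurable.subtype_mk
  refine ⟨_, (hf.comp hmeas).comp hm, ?_⟩
  rw [← Measure.map_map (hf.comp hmeas) hm, ← Measure.map_map hf hmeas, hF, hfπ]

end Representation

/-! ### Densities, mixtures and a density of full support. -/

section Density

variable {d : ℕ}

theorem IsDensity.memLp_id {μ : Measure (Euc d)} (h : IsDensity μ) :
    MemLp (fun x : Euc d => x) 2 μ := by
  refine ⟨by fun_prop, ?_⟩
  rw [eLpNorm_two_eq]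
  exact ENNReal.rpow_lt_top_of_nonneg (by norm_num) h.secondMoment.ne

theorem memLp_two_of_dist_le {Ω : Type*} [MeasurableSpace Ω] {γ : Measure Ω} {X Y : Ω → Euc d}
    (hX : MemLp X 2 γ) (hYm : AEStronglyMeasurable Y γ)
    (h : eLpNorm (fun x => Y x - X x) 2 γ < ⊤) : MemLp Y 2 γ := by
  have : MemLp (fun x => Y x - X x) 2 γ := ⟨hYm.sub hX.1, h⟩
  exact (this.add hX).congr_norm hYm (Eventually.of_forall fun x => by simp)

theorem IsDensity.W2_lt_top {μ ν : Measure (Euc d)} (hμ : IsDensity μ) (hν : IsDensity ν) :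
    W2 μ ν < ⊤ := by
  have := hμ.isProb
  have := hν.isProb
  have hc : IsCoupling μ ν (μ.prod ν) := ⟨by simp, by simp⟩
  refine (W2_le_of_isCoupling hc).trans_lt ?_
  have h1 : MemLp (fun p : Euc d × Euc d => p.1) 2 (μ.prod ν) := hμ.memLp_id.comp_fst ν
  have h2 : MemLp (fun p : Euc d × Euc d => p.2) 2 (μ.prod ν) := hν.memLp_id.comp_snd μ
  exact (h1.sub h2).2

theorem IsDensity.mix {ρ χ : Measure (Euc d)} (hρ : IsDensity ρ) (hχ : IsDensity χ) {ε : ℝ}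
    (h0 : 0 ≤ ε) (h1 : ε ≤ 1) : IsDensity (mix ρ χ ε) := by
  have := hρ.isProb
  have := hχ.isProb
  refine ⟨⟨?_⟩, ?_, ?_⟩
  · simp only [PWGF.mix, Measure.add_apply, Measure.smul_apply, measure_univ, smul_eq_mul, mul_one]
    rw [← ENNReal.ofReal_add (by linarith) h0]; simp
  · exact Measure.AbsolutelyContinuous.add_left (hρ.absCont.smul_left _) (hχ.absCont.smul_left _)
  · simp only [PWGF.mix, lintegral_add_measure, lintegral_smul_measure]
    exact ENNReal.add_lt_top.2 ⟨ENNReal.mul_lt_top (by simp) hρ.secondMoment,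
      ENNReal.mul_lt_top (by simp) hχ.secondMoment⟩

theorem isOpenPosMeasure_mix {ρ χ : Measure (Euc d)} [χ.IsOpenPosMeasure] {ε : ℝ} (h0 : 0 < ε) :
    (mix ρ χ ε).IsOpenPosMeasure := by
  refine Measure.AbsolutelyContinuous.isOpenPosMeasure (μ := χ) ?_
  intro s hs
  simp only [mix, Measure.add_apply, Measure.smul_apply, smul_eq_mul, add_eq_zero, mul_eq_zero] at hs
  rcases hs.2 with h | h
  · simp [h0.not_ge] at h
  · exact h

/-- Leave the fraction `1 - ε` of the mass in place and transport only the fraction `ε`: the squared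
cost is multiplied by `ε`. -/
theorem W2_mix_le {ρ χ : Measure (Euc d)} [IsProbabilityMeasure ρ] [IsProbabilityMeasure χ]
    {ε : ℝ} (h0 : 0 ≤ ε) (h1 : ε ≤ 1) :
    W2 ρ (mix ρ χ ε) ≤ ENNReal.ofReal √ε * W2 ρ χ := by
  refine le_mul_W2 ENNReal.ofReal_ne_top fun π hπ => ?_
  have hcp : IsCoupling ρ (mix ρ χ ε) (ENNReal.ofReal (1 - ε) • ρ.map (fun x => (x, x))
      + ENNReal.ofReal ε • π) := by
    constructor
    · rw [Measure.map_add _ _ measurable_fst, Measure.map_smul, Measure.map_smul, hπ.1,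
        Measure.map_map measurable_fst (by fun_prop)]
      have : (Prod.fst ∘ fun x : Euc d => (x, x)) = id := rfl
      rw [this, Measure.map_id, ← add_smul, ← ENNReal.ofReal_add (by linarith) h0]
      simp
    · rw [Measure.map_add _ _ measurable_snd, Measure.map_smul, Measure.map_smul, hπ.2,
        Measure.map_map measurable_snd (by fun_prop)]
      have : (Prod.snd ∘ fun x : Euc d => (x, x)) = id := rfl
      rw [this, Measure.map_id, mix]
  refine (W2_le_of_isCoupling hcp).trans_eq ?_
  rw [eLpNorm_two_eq, eLpNorm_two_eq, lintegral_add_measure, lintegral_smul_measure,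
    lintegral_smul_measure, lintegral_map (by fun_prop) (by fun_prop)]
  simp only [sub_self, enorm_zero, smul_eq_mul, ne_eq, OfNat.ofNat_ne_zero, not_false_eq_true,
    zero_pow, lintegral_zero, mul_zero, zero_add]
  rw [ENNReal.mul_rpow_of_nonneg _ _ (by norm_num), ENNReal.ofReal_rpow_of_nonneg h0 (by norm_num),
    Real.sqrt_eq_rpow]

/-- A tiny admixture of such a density gives any density full support, which is what makes the field
globally Lipschitz. -/
theorem exists_isDensity_isOpenPosMeasure (d : ℕ) :
    ∃ κ : Measure (Euc d), IsDensity κ ∧ κ.IsOpenPosMeasure := by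
  have hd : (Module.finrank ℝ (Euc d) : ℝ) = d := by simp
  -- With exponent `d + 4`, the weight still decays with integrable exponent `d + 2` after
  -- multiplication by $|x|^2$.
  set f : Euc d → ℝ≥0∞ := fun x => ENNReal.ofReal ((1 + ‖x‖) ^ (-(d + 4 : ℝ))) with hf
  have hfm : Measurable f := by fun_prop
  have hpos : ∀ x, f x ≠ 0 := fun x => by
    have : 0 < (1 + ‖x‖) ^ (-(d + 4 : ℝ)) := Real.rpow_pos_of_pos (by positivity) _
    simpa [hf] using this
  have hint : ∫⁻ x, f x < ⊤ := by
    exact finite_integral_one_add_norm (by rw [hd]; linarith)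
  have hne : ∫⁻ x, f x ≠ 0 := by
    rw [Ne, lintegral_eq_zero_iff hfm]
    intro h0
    have : (volume : Measure (Euc d)) univ = 0 := by
      refine measure_mono_null (fun x _ => ?_) (ae_iff.1 h0)
      exact hpos x
    exact (isOpen_univ.measure_ne_zero volume univ_nonempty) this
  set κ := (∫⁻ x, f x)⁻¹ • (volume : Measure (Euc d)).withDensity f with hκ
  refine ⟨κ, ⟨⟨?_⟩, ?_, ?_⟩, ?_⟩
  · rw [hκ, Measure.smul_apply, withDensity_apply _ MeasurableSet.univ, Measure.restrict_univ,
      smul_eq_mul, ENNReal.inv_mul_cancel hne hint.ne]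
  · exact (withDensity_absolutelyContinuous _ _).smul_left _
  · rw [hκ, lintegral_smul_measure, lintegral_withDensity_eq_lintegral_mul _ hfm (by fun_prop)]
    refine ENNReal.mul_lt_top (by simpa [pos_iff_ne_zero] using hne)
      (lt_of_le_of_lt (lintegral_mono fun x => ?_)
      (finite_integral_one_add_norm (E := Euc d) (μ := volume) (r := d + 2)
        (by rw [hd]; linarith)))
    have h1 : (0 : ℝ) < 1 + ‖x‖ := by positivity
    simp only [Pi.mul_apply, hf]
    rw [← ofReal_norm, ← ENNReal.ofReal_pow (norm_nonneg _), ← ENNReal.ofReal_mul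
      (by positivity)]
    refine ENNReal.ofReal_le_ofReal ?_
    rw [show (-(d + 4 : ℝ)) = -(d + 2 : ℝ) + (-2) by ring, Real.rpow_add h1, mul_assoc]
    refine mul_le_of_le_one_right (by positivity) ?_
    rw [Real.rpow_neg h1.le, Real.rpow_two, inv_mul_le_one₀ (by positivity)]
    gcongr
    linarith
  · refine Measure.AbsolutelyContinuous.isOpenPosMeasure (μ := (volume : Measure (Euc d))) ?_
    refine (withDensity_absolutelyContinuous' hfm.aemeasurable
      (Eventually.of_forall hpos)).trans ?_
    exact Measure.absolutelyContinuous_smul (by simpa using hint.ne)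

end Density

/-- A continuous vector field attached to every density that depends on the density in a
Lipschitz way along couplings. -/
structure IsLipField {d : ℕ} (g : Measure (Euc d) → Euc d → Euc d) (L : ℝ) : Prop where
  nonneg : 0 ≤ L
  cont : ∀ μ, IsDensity μ → Continuous (g μ)
  lip : ∀ π : Measure (Euc d × Euc d), IsDensity (π.map Prod.fst) → IsDensity (π.map Prod.snd) →
    eLpNorm (fun p => g (π.map Prod.fst) p.1 - g (π.map Prod.snd) p.2) 2 π
      ≤ ENNReal.ofReal L * eLpNorm (fun p => p.1 - p.2) 2 π

/-! ### Lipschitz regularity of the field, derived from its behaviour along couplings. -/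

section LipField

variable {d : ℕ}

theorem continuous_gradient {f : Euc d → ℝ} (hf : ContDiff ℝ 1 f) : Continuous (gradient f) :=
  (InnerProductSpace.toDual ℝ (Euc d)).symm.continuous.comp (hf.continuous_fderiv one_ne_zero)

/-- Every coupling is the law under `lam` of a pair of maps, so a bound for all pairs of maps is a
bound for all couplings. -/
theorem LipCondition.isLipField [NeZero d] {lam : Measure (Euc d)} [IsProbabilityMeasure lam]
    (hac : lam ≪ volume) {F : Measure (Euc d) → ℝ} {δF : Measure (Euc d) → Euc d → ℝ}
    (hδF : HasFirstVariation F δF) {C : ℝ} (hLip : LipCondition lam δF C) :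
    IsLipField (fun μ => gradient (δF μ)) √C := by
  have hcont : ∀ μ, IsDensity μ → Continuous (gradient (δF μ)) :=
    fun μ hμ => continuous_gradient (hδF μ hμ).2
  refine ⟨Real.sqrt_nonneg _, hcont, fun π h1 h2 => ?_⟩
  have := h1.isProb
  have hπ : IsProbabilityMeasure π := Measure.isProbabilityMeasure_of_map Prod.fst
  obtain ⟨f, hf, rfl⟩ := exists_map_eq hac π
  rw [Measure.map_map measurable_fst hf] at h1 ⊢
  rw [Measure.map_map measurable_snd hf] at h2 ⊢
  have key := hLip _ _ (measurable_fst.comp hf) (measurable_snd.comp hf) h1 h2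
  have c1 := (hcont _ h1).measurable
  have c2 := (hcont _ h2).measurable
  rw [eLpNorm_two_map hf (by fun_prop), eLpNorm_two_map hf (by fun_prop), eLpNorm_two_eq,
    eLpNorm_two_eq]
  refine (ENNReal.rpow_le_rpow key (by norm_num)).trans ?_
  rw [ENNReal.mul_rpow_of_nonneg _ _ (by norm_num)]
  refine mul_le_mul_left (le_of_eq ?_) _
  rcases le_total C 0 with h | h
  · rw [Real.sqrt_eq_zero_of_nonpos h, ENNReal.ofReal_of_nonpos h]; simp
  · rw [Real.sqrt_eq_rpow, ENNReal.ofReal_rpow_of_nonneg h (by norm_num)]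

variable {g : Measure (Euc d) → Euc d → Euc d} {L : ℝ}

theorem IsLipField.eLpNorm_le (hg : IsLipField g L) {Ω : Type*} [MeasurableSpace Ω]
    {γ : Measure Ω} {X Y : Ω → Euc d} (hX : Measurable X) (hY : Measurable Y)
    {μ ν : Measure (Euc d)} (hXμ : γ.map X = μ) (hYν : γ.map Y = ν) (hμ : IsDensity μ)
    (hν : IsDensity ν) :
    eLpNorm (fun x => g μ (X x) - g ν (Y x)) 2 γ
      ≤ ENNReal.ofReal L * eLpNorm (fun x => X x - Y x) 2 γ := by
  have hXY : Measurable fun x => (X x, Y x) := hX.prodMk hY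
  have e1 : (γ.map fun x => (X x, Y x)).map Prod.fst = μ := by
    rw [Measure.map_map measurable_fst hXY, ← hXμ]; rfl
  have e2 : (γ.map fun x => (X x, Y x)).map Prod.snd = ν := by
    rw [Measure.map_map measurable_snd hXY, ← hYν]; rfl
  have := hg.lip (γ.map fun x => (X x, Y x)) (e1 ▸ hμ) (e2 ▸ hν)
  have c1 := (hg.cont _ hμ).measurable
  have c2 := (hg.cont _ hν).measurable
  rw [e1, e2, eLpNorm_two_map hXY (by fun_prop), eLpNorm_two_map hXY (by fun_prop)] at this
  exact this

theorem eLpNorm_sq_lt_top_of_density {μ ν : Measure (Euc d)} (hμ : IsDensity μ)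
    (hν : IsDensity ν) : ∫⁻ p, ‖p.1 - p.2‖ₑ ^ 2 ∂(μ.prod ν) < ⊤ := by
  have := hμ.isProb
  have := hν.isProb
  have h1 : MemLp (fun p : Euc d × Euc d => p.1) 2 (μ.prod ν) := hμ.memLp_id.comp_fst ν
  have h2 : MemLp (fun p : Euc d × Euc d => p.2) 2 (μ.prod ν) := hν.memLp_id.comp_snd μ
  have h3 := (h1.sub h2).2
  have h4 := eLpNorm_two_sq (fun p : Euc d × Euc d => p.1 - p.2) (μ.prod ν)
  rw [← h4]
  exact ENNReal.pow_lt_top h3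

/-- At a density of full support the field is globally Lipschitz: test the coupling of the density
with itself that exchanges mass where the Lipschitz bound fails. -/
theorem IsLipField.norm_sub_le (hg : IsLipField g L) {m : Measure (Euc d)} (hm : IsDensity m)
    [m.IsOpenPosMeasure] (x y : Euc d) : ‖g m x - g m y‖ ≤ L * ‖x - y‖ := by
  have := hm.isProb
  have hc := hg.cont m hm
  -- The pairs violating the claimed inequality: an open set, symmetric under exchange of
  -- coordinates.
  set A : Set (Euc d × Euc d) := {p | L * ‖p.1 - p.2‖ < ‖g m p.1 - g m p.2‖} with hA
  have hAo : IsOpen A := isOpen_lt (by fun_prop) (by fun_prop)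
  have hAm : MeasurableSet A := hAo.measurableSet
  have hsymm : Prod.swap ⁻¹' A = A := by
    ext p
    simp [hA, norm_sub_rev]
  set w : Euc d → ℝ≥0∞ := fun x => m (Prod.mk x ⁻¹' A) with hw
  have hwm : Measurable w := measurable_measure_prodMk_left hAm
  have hw1 : ∀ x, w x ≤ 1 := fun x => prob_le_one
  have hfst : ((m.prod m).restrict A).map Prod.fst = m.withDensity w := by
    ext s hs
    rw [Measure.map_apply measurable_fst hs, Measure.restrict_apply (measurable_fst hs),
      Measure.prod_apply ((measurable_fst hs).inter hAm), withDensity_apply _ hs,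
      ← lintegral_indicator hs]
    refine lintegral_congr fun x => ?_
    by_cases hx : x ∈ s <;> simp [hx, hw, preimage_inter, ← preimage_comp, Function.comp_def]
  have hsnd : ((m.prod m).restrict A).map Prod.snd = m.withDensity w := by
    rw [← hfst]
    conv_lhs => rw [← hsymm, ← Measure.prod_swap (μ := m) (ν := m),
      Measure.restrict_map measurable_swap (by rwa [hsymm]), ← preimage_comp,
      Measure.map_map measurable_snd measurable_swap]
    rfl
  -- Product measure on `A`, with the leftover mass on the diagonal. Symmetry of `A` makes both
  -- marginals equal to `m`, and the diagonal contributes to neither side of the Lipschitz bound.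
  set π : Measure (Euc d × Euc d) := (m.prod m).restrict A
    + (m.withDensity (fun x => 1 - w x)).map (fun x => (x, x)) with hπ
  have hsum : m.withDensity w + m.withDensity (fun x => 1 - w x) = m := by
    rw [← withDensity_add_left hwm]
    have : w + (fun x => 1 - w x) = 1 := by
      ext x
      simp [add_tsub_cancel_of_le (hw1 x)]
    rw [this, withDensity_one]
  have h1 : π.map Prod.fst = m := by
    rw [hπ, Measure.map_add _ _ measurable_fst, hfst, Measure.map_map measurable_fst (by fun_prop)]
    have : (Prod.fst ∘ fun x : Euc d => (x, x)) = id := rfl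
    rw [this, Measure.map_id, hsum]
  have h2 : π.map Prod.snd = m := by
    rw [hπ, Measure.map_add _ _ measurable_snd, hsnd, Measure.map_map measurable_snd (by fun_prop)]
    have : (Prod.snd ∘ fun x : Euc d => (x, x)) = id := rfl
    rw [this, Measure.map_id, hsum]
  have key := hg.lip π (by rwa [h1]) (by rwa [h2])
  rw [h1, h2] at key
  have key2 := pow_le_pow_left' key 2
  rw [mul_pow, eLpNorm_two_sq, eLpNorm_two_sq, hπ, lintegral_add_measure, lintegral_add_measure,
    lintegral_map (by fun_prop) (by fun_prop), lintegral_map (by fun_prop) (by fun_prop)] at key2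
  simp only [sub_self, enorm_zero, ne_eq, OfNat.ofNat_ne_zero, not_false_eq_true, zero_pow,
    lintegral_zero, add_zero] at key2
  rw [← lintegral_const_mul _ (by fun_prop)] at key2
  by_contra! hcon
  -- Full support turns one violating pair into a violating set of positive measure, on which the
  -- integrands are strictly ordered against `key2`.
  have hpos : (m.prod m) A ≠ 0 := (hAo.measure_pos _ ⟨(x, y), hcon⟩).ne'
  refine absurd key2 (not_le.2 ?_)
  refine setLIntegral_strict_mono hAm hpos (by fun_prop) ?_ (Eventually.of_forall fun p hp => ?_)
  · rw [lintegral_const_mul _ (by fun_prop)]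
    exact (ENNReal.mul_lt_top (by simp) ((setLIntegral_le_lintegral _ _).trans_lt
      (eLpNorm_sq_lt_top_of_density hm hm))).ne
  · have hp' : L * ‖p.1 - p.2‖ < ‖g m p.1 - g m p.2‖ := hp
    rw [← mul_pow, ← ofReal_norm, ← ofReal_norm, ← ENNReal.ofReal_mul hg.nonneg]
    exact ENNReal.pow_lt_pow_left two_ne_zero
      ((ENNReal.ofReal_lt_ofReal_iff_of_nonneg (mul_nonneg hg.nonneg (norm_nonneg _))).2 hp')

theorem eLpNorm_le_of_norm_sub_le {E : Type*} [NormedAddCommGroup E] {Ω : Type*}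
    [MeasurableSpace Ω] {γ : Measure Ω} {V : Euc d → E} (hV : ∀ x y, ‖V x - V y‖ ≤ L * ‖x - y‖)
    (X Y : Ω → Euc d) :
    eLpNorm (fun x => V (X x) - V (Y x)) 2 γ
      ≤ ENNReal.ofReal L * eLpNorm (fun x => X x - Y x) 2 γ :=
  eLpNorm_le_mul_eLpNorm_of_ae_le_mul (Eventually.of_forall fun x => hV (X x) (Y x)) 2

/-- Insert `g m` at the partner point of a coupling: moving the point costs `L` because `g m` is
Lipschitz, and changing the measure along the coupling costs another `L`. -/
theorem IsLipField.eLpNorm_sub_le (hg : IsLipField g L) {μ m : Measure (Euc d)}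
    (hμ : IsDensity μ) (hm : IsDensity m) [m.IsOpenPosMeasure] :
    eLpNorm (fun x => g m x - g μ x) 2 μ ≤ ENNReal.ofReal (2 * L) * W2 μ m := by
  have := hμ.isProb
  have := hm.isProb
  refine le_mul_W2 ENNReal.ofReal_ne_top fun π hπ => ?_
  have c1 := (hg.cont μ hμ).measurable
  have c2 := (hg.cont m hm).measurable
  have h1 := hg.eLpNorm_le measurable_fst measurable_snd hπ.1 hπ.2 hμ hm
  have h2 := eLpNorm_le_of_norm_sub_le (γ := π) (hg.norm_sub_le hm) Prod.fst Prod.snd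
  have e1 : eLpNorm (fun x => g m x - g μ x) 2 μ
      = eLpNorm (fun p : Euc d × Euc d => g m p.1 - g μ p.1) 2 π := by
    have := eLpNorm_two_map (μ := π) measurable_fst (f := fun x => g m x - g μ x) (by fun_prop)
    rw [hπ.1] at this
    exact this
  have e2 : (fun p : Euc d × Euc d => g m p.1 - g μ p.1)
      = (fun p : Euc d × Euc d => g m p.1 - g m p.2) - fun p => g μ p.1 - g m p.2 := by
    ext1 p; simp
  rw [e1, e2, ENNReal.ofReal_mul (by norm_num), ENNReal.ofReal_ofNat, mul_assoc, two_mul]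
  exact (MeasureTheory.eLpNorm_sub_le (by fun_prop) (by fun_prop) (by norm_num)).trans
    (add_le_add h2 h1)

/-- The field of a full-support density grows at most linearly, and `g μ` is at finite $L^2(\mu)$
distance from it. -/
theorem IsLipField.memLp (hg : IsLipField g L) {μ : Measure (Euc d)} (hμ : IsDensity μ) :
    MemLp (g μ) 2 μ := by
  have := hμ.isProb
  obtain ⟨κ, hκ, hκo⟩ := exists_isDensity_isOpenPosMeasure d
  have hc := (hg.cont μ hμ).aestronglyMeasurable (μ := μ)
  have hc' := (hg.cont κ hκ).aestronglyMeasurable (μ := μ)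
  have h1 : MemLp (fun x => g κ x) 2 μ := by
    have h2 : MemLp (fun x => g κ x - g κ 0) 2 μ := by
      refine MemLp.of_le_mul hμ.memLp_id (by fun_prop) (c := L) (Eventually.of_forall fun x => ?_)
      simpa using hg.norm_sub_le hκ x 0
    exact (h2.add (memLp_const (g κ 0))).congr_norm hc' (Eventually.of_forall fun x => by simp)
  refine memLp_two_of_dist_le h1 hc ?_
  rw [eLpNorm_two_sub_comm]
  exact (hg.eLpNorm_sub_le hμ hκ).trans_lt
    (ENNReal.mul_lt_top ENNReal.ofReal_lt_top (hμ.W2_lt_top hκ))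

/-- Globally Lipschitz approximation of the field in `L²`. -/
theorem IsLipField.exists_approx (hg : IsLipField g L) {μ : Measure (Euc d)} (hμ : IsDensity μ)
    {ε : ℝ} (hε : 0 < ε) : ∃ V : Euc d → Euc d, (∀ x y, ‖V x - V y‖ ≤ L * ‖x - y‖) ∧
      eLpNorm (fun x => V x - g μ x) 2 μ ≤ ENNReal.ofReal ε := by
  obtain ⟨κ, hκ, hκo⟩ := exists_isDensity_isOpenPosMeasure d
  have hlim : Tendsto (fun e : ℝ => ENNReal.ofReal (2 * L) * (ENNReal.ofReal √e * W2 μ κ))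
      (𝓝[>] 0) (𝓝 0) := by
    have h1 : Tendsto (fun e : ℝ => ENNReal.ofReal √e) (𝓝[>] 0) (𝓝 0) := by
      have : Continuous fun e : ℝ => ENNReal.ofReal √e :=
        ENNReal.continuous_ofReal.comp Real.continuous_sqrt
      have := (this.tendsto 0).mono_left (nhdsWithin_le_nhds (s := Ioi (0 : ℝ)))
      simpa using this
    have h2 := ENNReal.Tendsto.mul_const h1 (b := W2 μ κ) (Or.inr (hμ.W2_lt_top hκ).ne)
    have h3 := ENNReal.Tendsto.const_mul h2 (a := ENNReal.ofReal (2 * L))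
      (Or.inr ENNReal.ofReal_ne_top)
    simpa using h3
  obtain ⟨e, he, he1⟩ := ((hlim.eventually_lt_const (ENNReal.ofReal_pos.2 hε)).and
    (Ioo_mem_nhdsGT one_pos)).exists
  have hm := hμ.mix hκ he1.1.le he1.2.le
  have := hμ.isProb
  have := hκ.isProb
  have := isOpenPosMeasure_mix (ρ := μ) (χ := κ) he1.1
  -- The approximation is the field of the mixture itself: Lipschitz by full support, and close
  -- because mixing moves `μ` by at most `√e * W2 μ κ`.
  refine ⟨g (mix μ κ e), fun x y => hg.norm_sub_le hm x y, (hg.eLpNorm_sub_le hμ hm).trans ?_⟩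
  refine le_trans ?_ he.le
  gcongr
  exact W2_mix_le he1.1.le he1.2.le

end LipField

/-! ### Taylor estimates, mollification and quantitative test functions. -/

section Analysis

variable {d : ℕ}

theorem inner_gradient_eq (φ : Euc d → ℝ) (x v : Euc d) :
    inner ℝ (gradient φ x) v = fderiv ℝ φ x v := by
  simp [gradient]

theorem norm_fderiv_eq_norm_gradient (φ : Euc d → ℝ) (x : Euc d) :
    ‖fderiv ℝ φ x‖ = ‖gradient φ x‖ := by
  simp [gradient]

theorem norm_fderiv_sub_eq (φ : Euc d → ℝ) (x y : Euc d) :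
    ‖fderiv ℝ φ x - fderiv ℝ φ y‖ = ‖gradient φ x - gradient φ y‖ := by
  rw [gradient, gradient, ← map_sub, LinearIsometryEquiv.norm_map]

/-- First order Taylor estimate for a function with Lipschitz derivative. -/
theorem norm_taylor_le {E F : Type*} [NormedAddCommGroup E] [NormedSpace ℝ E]
    [NormedAddCommGroup F] [NormedSpace ℝ F] {f : E → F} {M : ℝ} (hM : 0 ≤ M)
    (hf : Differentiable ℝ f)
    (h : ∀ x y, ‖fderiv ℝ f x - fderiv ℝ f y‖ ≤ M * ‖x - y‖) (x y : E) :
    ‖f y - f x - fderiv ℝ f x (y - x)‖ ≤ M * ‖y - x‖ ^ 2 := by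
  have := (convex_segment x y).norm_image_sub_le_of_norm_hasFDerivWithin_le'
    (f := f) (f' := fderiv ℝ f) (φ := fderiv ℝ f x) (C := M * ‖y - x‖)
    (fun z _ => (hf z).hasFDerivAt.hasFDerivWithinAt) (fun z hz => ?_)
    (left_mem_segment ℝ x y) (right_mem_segment ℝ x y)
  · rwa [mul_assoc, ← sq] at this
  · refine (h z x).trans ?_
    gcongr
    exact norm_sub_le_of_mem_segment hz

theorem norm_fderiv_le_of_norm_sub_le {E F : Type*} [NormedAddCommGroup E] [NormedSpace ℝ E]
    [NormedAddCommGroup F] [NormedSpace ℝ F] {f : E → F} {L : ℝ} (hL : 0 ≤ L)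
    (h : ∀ x y, ‖f x - f y‖ ≤ L * ‖x - y‖) (x : E) : ‖fderiv ℝ f x‖ ≤ L := by
  have : LipschitzWith L.toNNReal f := LipschitzWith.of_dist_le_mul fun x y => by
    rw [dist_eq_norm, dist_eq_norm, Real.coe_toNNReal _ hL]
    exact h x y
  simpa [Real.coe_toNNReal _ hL] using norm_fderiv_le_of_lipschitz ℝ this (x₀ := x)

open scoped Convolution in
/-- Mollification of Lipschitz fields: the approximation and the bound of the second derivative are
uniform over all fields with the same Lipschitz constant. -/
theorem exists_mollification {L : ℝ} (hL : 0 ≤ L) {ε : ℝ} (hε : 0 < ε) :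
    ∃ B : ℝ, 0 ≤ B ∧ ∀ V : Euc d → Euc d, (∀ x y, ‖V x - V y‖ ≤ L * ‖x - y‖) →
      ∃ W : Euc d → Euc d, ContDiff ℝ ∞ W ∧ (∀ x y, ‖W x - W y‖ ≤ L * ‖x - y‖) ∧
        (∀ x y, ‖fderiv ℝ W x - fderiv ℝ W y‖ ≤ B * ‖x - y‖) ∧ ∀ x, ‖W x - V x‖ ≤ ε := by
  -- Averaging over radius `r` changes an `L`-Lipschitz field by at most `L * r ≤ ε`; the `+ 1`
  -- covers `L = 0`.
  set r : ℝ := ε / (L + 1) with hr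
  have hr0 : 0 < r := by positivity
  let b : ContDiffBump (0 : Euc d) := ⟨r / 2, r, by positivity, by linarith⟩
  set η : Euc d → ℝ := b.normed volume with hη
  have hηs : ContDiff ℝ ∞ η := b.contDiff_normed
  have hηc : HasCompactSupport η := b.hasCompactSupport_normed
  have hη0 : ∀ x, 0 ≤ η x := fun x => b.nonneg_normed x
  have hη1 : ∫ x, η x = 1 := b.integral_normed
  have hDc : HasCompactSupport (fderiv ℝ η) := hηc.fderiv ℝ
  have hDcont : Continuous (fderiv ℝ η) := hηs.continuous_fderiv (by simp)
  set T := (ContinuousLinearMap.lsmul ℝ ℝ : ℝ →L[ℝ] Euc d →L[ℝ] Euc d) with hT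
  have hDint : Integrable (fun x => ‖fderiv ℝ η x‖) volume :=
    (hDcont.integrable_of_hasCompactSupport hDc).norm
  -- The derivative is put on the bump function, so increments of the derivative only involve
  -- increments of `V`. The constant therefore depends on `V` only through `L`.
  refine ⟨‖T.precompL (Euc d)‖ * L * ∫ x, ‖fderiv ℝ η x‖, by positivity, fun V hV => ?_⟩
  have hVc : Continuous V := by
    have : LipschitzWith L.toNNReal V := LipschitzWith.of_dist_le_mul fun x y => by
      rw [dist_eq_norm, dist_eq_norm, Real.coe_toNNReal _ hL]
      exact hV x y
    exact this.continuous
  have hex : ConvolutionExists η V T volume :=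
    hηc.convolutionExists_left T hηs.continuous hVc.locallyIntegrable
  have hexD : ConvolutionExists (fderiv ℝ η) V (T.precompL (Euc d)) volume :=
    hDc.convolutionExists_left _ hDcont hVc.locallyIntegrable
  refine ⟨η ⋆[T, volume] V, hηc.contDiff_convolution_left T hηs hVc.locallyIntegrable, ?_, ?_, ?_⟩
  · intro x y
    rw [convolution_def, convolution_def, ← integral_sub (hex x) (hex y)]
    calc ‖∫ t, (T (η t) (V (x - t)) - T (η t) (V (y - t)))‖
        ≤ ∫ t, η t * (L * ‖x - y‖) := by
          refine norm_integral_le_of_norm_le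
            ((hηs.continuous.integrable_of_hasCompactSupport hηc).mul_const _)
            (Eventually.of_forall fun t => ?_)
          simp only [hT, ContinuousLinearMap.lsmul_apply]
          rw [← smul_sub, norm_smul, Real.norm_of_nonneg (hη0 t)]
          refine mul_le_mul_of_nonneg_left ((hV _ _).trans_eq ?_) (hη0 t)
          congr 2; abel
      _ = L * ‖x - y‖ := by rw [integral_mul_const, hη1, one_mul]
  · intro x y
    rw [(hηc.hasFDerivAt_convolution_left T (hηs.of_le (by simp)) hVc.locallyIntegrable x).fderiv,
      (hηc.hasFDerivAt_convolution_left T (hηs.of_le (by simp)) hVc.locallyIntegrable y).fderiv,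
      convolution_def, convolution_def, ← integral_sub (hexD x) (hexD y)]
    calc ‖∫ t, (T.precompL (Euc d) (fderiv ℝ η t) (V (x - t))
          - T.precompL (Euc d) (fderiv ℝ η t) (V (y - t)))‖
        ≤ ∫ t, ‖T.precompL (Euc d)‖ * ‖fderiv ℝ η t‖ * (L * ‖x - y‖) := by
          refine norm_integral_le_of_norm_le ((hDint.const_mul _).mul_const _)
            (Eventually.of_forall fun t => ?_)
          rw [← map_sub]
          refine (ContinuousLinearMap.le_opNorm₂ _ _ _).trans ?_
          refine mul_le_mul_of_nonneg_left ((hV _ _).trans_eq ?_) (by positivity)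
          congr 2; abel
      _ = _ := by rw [integral_mul_const, integral_const_mul]; ring
  · intro x
    rw [← dist_eq_norm]
    refine b.dist_normed_convolution_le (μ := volume) hVc.aestronglyMeasurable fun y hy => ?_
    rw [dist_eq_norm]
    refine (hV y x).trans ?_
    have hy' : ‖y - x‖ ≤ r := by
      rw [← dist_eq_norm]; exact (Metric.mem_ball.1 hy).le
    calc L * ‖y - x‖ ≤ (L + 1) * r := by gcongr; linarith
      _ = ε := by rw [hr]; field_simp

/-- Uniformly smooth Lipschitz approximations of a Lipschitz field. -/
theorem IsLipField.exists_smooth_approx {g : Measure (Euc d) → Euc d → Euc d} {L : ℝ}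
    (hg : IsLipField g L) {ε : ℝ} (hε : 0 < ε) :
    ∃ B : ℝ, 0 ≤ B ∧ ∀ μ, IsDensity μ →
      ∃ W : Euc d → Euc d, ContDiff ℝ ∞ W ∧ (∀ x y, ‖W x - W y‖ ≤ L * ‖x - y‖) ∧
        (∀ x y, ‖fderiv ℝ W x - fderiv ℝ W y‖ ≤ B * ‖x - y‖) ∧
        eLpNorm (fun x => W x - g μ x) 2 μ ≤ ENNReal.ofReal ε := by
  obtain ⟨B, hB, h⟩ := exists_mollification (d := d) hg.nonneg (half_pos hε)
  refine ⟨B, hB, fun μ hμ => ?_⟩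
  have := hμ.isProb
  obtain ⟨V, hV, hVμ⟩ := hg.exists_approx hμ (half_pos hε)
  obtain ⟨W, hW, hWL, hWB, hWV⟩ := h V hV
  refine ⟨W, hW, hWL, hWB, ?_⟩
  have hVc : Continuous V := by
    have : LipschitzWith L.toNNReal V := LipschitzWith.of_dist_le_mul fun x y => by
      rw [dist_eq_norm, dist_eq_norm, Real.coe_toNNReal _ hg.nonneg]
      exact hV x y
    exact this.continuous
  have hgc := hg.cont μ hμ
  have hWc := hW.continuous
  have e : (fun x => W x - g μ x) = (fun x => W x - V x) + fun x => V x - g μ x := by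
    ext1 x; simp
  rw [e]
  refine (eLpNorm_add_le (by fun_prop) (by fun_prop) (by norm_num)).trans ?_
  rw [show ENNReal.ofReal ε = ENNReal.ofReal (ε / 2) + ENNReal.ofReal (ε / 2) by
    rw [← ENNReal.ofReal_add (by positivity) (by positivity), add_halves]]
  refine add_le_add ?_ hVμ
  refine (eLpNorm_le_of_ae_bound (Eventually.of_forall hWV)).trans_eq ?_
  simp

/-- Test functions with explicit bounds of the derivative and of its Lipschitz constant. -/
structure IsTest (φ : Euc d → ℝ) (A M : ℝ) : Prop where
  smooth : ContDiff ℝ ∞ φ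
  compact : HasCompactSupport φ
  bound : ∀ x, ‖fderiv ℝ φ x‖ ≤ A
  lip : ∀ x y, ‖fderiv ℝ φ x - fderiv ℝ φ y‖ ≤ M * ‖x - y‖

theorem exists_isTest {φ : Euc d → ℝ} (hφ : ContDiff ℝ ∞ φ) (hc : HasCompactSupport φ) :
    ∃ A M : ℝ, 0 ≤ A ∧ 0 ≤ M ∧ IsTest φ A M := by
  have h1 : ContDiff ℝ 1 (fderiv ℝ φ) := hφ.fderiv_right (by norm_cast)
  obtain ⟨A, hA⟩ := (hc.fderiv ℝ).exists_bound_of_continuous h1.continuous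
  obtain ⟨M, hM⟩ := ContDiff.lipschitzWith_of_hasCompactSupport (hc.fderiv ℝ) h1 one_ne_zero
  refine ⟨A, M, (norm_nonneg _).trans (hA 0), M.2, hφ, hc, hA, fun x y => ?_⟩
  simpa [dist_eq_norm] using hM.dist_le_mul x y

/-- Chain rule for the pull-back by one Euler substep. The summand `A * (k * B)` comes from the
variation of the derivative of `W`. -/
theorem IsTest.comp {φ : Euc d → ℝ} {A M L B k : ℝ} (hφ : IsTest φ A M) {W : Euc d → Euc d}
    (hL : 0 ≤ L) (hk : 0 ≤ k) (hkL : k * L < 1) (hA : 0 ≤ A) (hM : 0 ≤ M)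
    (hW : ContDiff ℝ ∞ W) (hWL : ∀ x y, ‖W x - W y‖ ≤ L * ‖x - y‖)
    (hWB : ∀ x y, ‖fderiv ℝ W x - fderiv ℝ W y‖ ≤ B * ‖x - y‖) :
    IsTest (fun x => φ (x - k • W x)) (A * (1 + k * L)) (M * (1 + k * L) ^ 2 + A * (k * B)) := by
  have hWd : Differentiable ℝ W := hW.differentiable (by simp)
  have hφd : Differentiable ℝ φ := hφ.smooth.differentiable (by simp)
  have hD : ∀ x, fderiv ℝ (fun x => φ (x - k • W x)) x
      = (fderiv ℝ φ (x - k • W x)).comp (ContinuousLinearMap.id ℝ (Euc d) - k • fderiv ℝ W x) := by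
    intro x
    have h1 : HasFDerivAt (fun x => x - k • W x)
        (ContinuousLinearMap.id ℝ (Euc d) - k • fderiv ℝ W x) x :=
      (hasFDerivAt_id x).sub ((hWd x).hasFDerivAt.const_smul k)
    exact ((hφd _).hasFDerivAt.comp x h1).fderiv
  have hS : ∀ x, ‖ContinuousLinearMap.id ℝ (Euc d) - k • fderiv ℝ W x‖ ≤ 1 + k * L := by
    intro x
    refine (norm_sub_le _ _).trans (add_le_add ContinuousLinearMap.norm_id_le ?_)
    rw [norm_smul, Real.norm_of_nonneg hk]
    gcongr
    exact norm_fderiv_le_of_norm_sub_le hL hWL x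
  have hSl : ∀ x y, ‖(x - k • W x) - (y - k • W y)‖ ≤ (1 + k * L) * ‖x - y‖ := by
    intro x y
    calc ‖(x - k • W x) - (y - k • W y)‖ = ‖(x - y) - k • (W x - W y)‖ := by
          rw [smul_sub]; congr 1; abel
      _ ≤ ‖x - y‖ + k * (L * ‖x - y‖) := by
          refine (norm_sub_le _ _).trans ?_
          rw [norm_smul, Real.norm_of_nonneg hk]
          gcongr
          exact hWL x y
      _ = _ := by ring
  refine ⟨hφ.smooth.comp (contDiff_id.sub (hW.const_smul k)), ?_, fun x => ?_, fun x y => ?_⟩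
  -- The condition `k * L < 1` makes the substep map coercive, so preimages of bounded sets are
  -- bounded.
  · obtain ⟨R, hR⟩ := hφ.compact.isBounded.subset_closedBall (0 : Euc d)
    refine HasCompactSupport.of_support_subset_isCompact
      (isCompact_closedBall (0 : Euc d) ((R + k * ‖W 0‖) / (1 - k * L))) fun x hx => ?_
    have h1 : ‖x - k • W x‖ ≤ R := by
      simpa using hR (subset_tsupport φ hx)
    have h2 : ‖W x‖ ≤ ‖W 0‖ + L * ‖x‖ := by
      have := hWL x 0
      rw [sub_zero] at this
      linarith [norm_sub_norm_le (W x) (W 0)]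
    have h3 : ‖x‖ ≤ ‖x - k • W x‖ + k * ‖W x‖ := by
      have := norm_add_le (x - k • W x) (k • W x)
      rwa [sub_add_cancel, norm_smul, Real.norm_of_nonneg hk] at this
    rw [mem_closedBall_zero_iff, le_div_iff₀ (by linarith)]
    nlinarith [mul_le_mul_of_nonneg_left h2 hk]
  · rw [hD]
    refine (ContinuousLinearMap.opNorm_comp_le _ _).trans ?_
    gcongr
    · exact hφ.bound _
    · exact hS x
  · rw [hD, hD]
    have e : (fderiv ℝ φ (x - k • W x)).comp
          (ContinuousLinearMap.id ℝ (Euc d) - k • fderiv ℝ W x)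
        - (fderiv ℝ φ (y - k • W y)).comp (ContinuousLinearMap.id ℝ (Euc d) - k • fderiv ℝ W y)
        = (fderiv ℝ φ (x - k • W x) - fderiv ℝ φ (y - k • W y)).comp
          (ContinuousLinearMap.id ℝ (Euc d) - k • fderiv ℝ W x)
        - (fderiv ℝ φ (y - k • W y)).comp (k • (fderiv ℝ W x - fderiv ℝ W y)) := by
      ext v; simp; ring
    rw [e]
    calc _ ≤ (M * ((1 + k * L) * ‖x - y‖)) * (1 + k * L) + A * (k * (B * ‖x - y‖)) := by
          refine (norm_sub_le _ _).trans (add_le_add ?_ ?_)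
          · refine (ContinuousLinearMap.opNorm_comp_le _ _).trans ?_
            gcongr
            · exact (hφ.lip _ _).trans (mul_le_mul_of_nonneg_left (hSl x y) hM)
            · exact hS x
          · refine (ContinuousLinearMap.opNorm_comp_le _ _).trans ?_
            rw [norm_smul, Real.norm_of_nonneg hk]
            gcongr
            · exact hφ.bound _
            · exact hWB x y
      _ = _ := by ring

end Analysis

/-! ### Square integrals and the Cauchy–Schwarz inequality. -/

section LTwo

variable {Ω : Type*} [MeasurableSpace Ω] {γ : Measure Ω} {E F : Type*} [NormedAddCommGroup E]
  [NormedAddCommGroup F]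

theorem toReal_eLpNorm_two {f : Ω → E} (hf : MemLp f 2 γ) :
    (eLpNorm f 2 γ).toReal = (∫ x, ‖f x‖ ^ (2 : ℝ) ∂γ) ^ (1 / 2 : ℝ) := by
  rw [hf.eLpNorm_eq_integral_rpow_norm two_ne_zero ENNReal.ofNat_ne_top, ENNReal.toReal_ofReal]
  · simp
  · exact Real.rpow_nonneg (integral_nonneg fun x => by positivity) _

theorem toReal_eLpNorm_two_sq {f : Ω → E} (hf : MemLp f 2 γ) :
    (eLpNorm f 2 γ).toReal ^ 2 = ∫ x, ‖f x‖ ^ 2 ∂γ := by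
  rw [toReal_eLpNorm_two hf, ← Real.sqrt_eq_rpow, Real.sq_sqrt]
  · simp
  · exact integral_nonneg fun x => by positivity

theorem ofReal_integral_norm_sq {f : Ω → E} (hf : MemLp f 2 γ) :
    ENNReal.ofReal (∫ x, ‖f x‖ ^ 2 ∂γ) = eLpNorm f 2 γ ^ 2 := by
  rw [← toReal_eLpNorm_two_sq hf, ENNReal.ofReal_pow ENNReal.toReal_nonneg,
    ENNReal.ofReal_toReal hf.2.ne]

theorem integral_norm_sq_le {f : Ω → E} (hf : MemLp f 2 γ) {a : ℝ} (ha : 0 ≤ a)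
    (hfa : eLpNorm f 2 γ ≤ ENNReal.ofReal a) : ∫ x, ‖f x‖ ^ 2 ∂γ ≤ a ^ 2 := by
  rw [← toReal_eLpNorm_two_sq hf]
  exact pow_le_pow_left₀ ENNReal.toReal_nonneg (ENNReal.toReal_le_of_le_ofReal ha hfa) 2

/-- Cauchy-Schwarz inequality. -/
theorem integral_norm_mul_norm_le {f : Ω → E} {h : Ω → F} (hf : MemLp f 2 γ) (hh : MemLp h 2 γ)
    {a b : ℝ} (ha : 0 ≤ a) (hb : 0 ≤ b) (hfa : eLpNorm f 2 γ ≤ ENNReal.ofReal a)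
    (hhb : eLpNorm h 2 γ ≤ ENNReal.ofReal b) : ∫ x, ‖f x‖ * ‖h x‖ ∂γ ≤ a * b := by
  have h1 := integral_mul_norm_le_Lp_mul_Lq (μ := γ) (f := fun x => ‖f x‖) (g := fun x => ‖h x‖)
    (p := 2) (q := 2) ⟨by norm_num, by norm_num, by norm_num⟩ (by simpa using hf.norm)
    (by simpa using hh.norm)
  simp only [norm_norm] at h1
  rw [← toReal_eLpNorm_two hf, ← toReal_eLpNorm_two hh] at h1
  refine h1.trans ?_
  gcongr
  · exact ENNReal.toReal_le_of_le_ofReal ha hfa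
  · exact ENNReal.toReal_le_of_le_ofReal hb hhb

theorem integral_norm_le [IsProbabilityMeasure γ] {f : Ω → E} (hf : MemLp f 2 γ) {a : ℝ}
    (ha : 0 ≤ a) (hfa : eLpNorm f 2 γ ≤ ENNReal.ofReal a) : ∫ x, ‖f x‖ ∂γ ≤ a := by
  have h1 : eLpNorm (fun _ : Ω => (1 : ℝ)) 2 γ ≤ ENNReal.ofReal 1 := by
    rw [eLpNorm_const _ two_ne_zero (IsProbabilityMeasure.ne_zero γ)]; simp
  have := integral_norm_mul_norm_le hf (memLp_const (1 : ℝ)) ha zero_le_one hfa h1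
  simpa using this

end LTwo

/-! ### Euler substeps tested against smooth functions. -/

section Step

variable {d : ℕ} {g : Measure (Euc d) → Euc d → Euc d} {L : ℝ}

theorem IsTest.continuous_gradient {φ : Euc d → ℝ} {A M : ℝ} (hφ : IsTest φ A M) :
    Continuous (gradient φ) :=
  PWGF.continuous_gradient (hφ.smooth.of_le (by simp))

theorem IsTest.integrable_inner {φ : Euc d → ℝ} {A M : ℝ} (hφ : IsTest φ A M)
    {Ω : Type*} [MeasurableSpace Ω] {γ : Measure Ω} [IsProbabilityMeasure γ] {X V : Ω → Euc d}
    (hX : Measurable X) (hV : MemLp V 2 γ) :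
    Integrable (fun x => inner ℝ (gradient φ (X x)) (V x)) γ := by
  have hc := hφ.continuous_gradient.measurable
  have h1 : Integrable V γ := hV.integrable (by norm_num)
  refine (h1.norm.const_mul A).mono'
    ((hc.comp hX).aestronglyMeasurable.inner hV.1) (Eventually.of_forall fun x => ?_)
  refine (norm_inner_le_norm _ _).trans ?_
  gcongr
  rw [← norm_fderiv_eq_norm_gradient]
  exact hφ.bound _

theorem IsTest.integrable {φ : Euc d → ℝ} {A M : ℝ} (hφ : IsTest φ A M) {Ω : Type*}
    [MeasurableSpace Ω] {γ : Measure Ω} [IsProbabilityMeasure γ] {X : Ω → Euc d}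
    (hX : Measurable X) : Integrable (fun x => φ (X x)) γ := by
  obtain ⟨b, hb⟩ := hφ.compact.exists_bound_of_continuous hφ.smooth.continuous
  exact Integrable.of_bound (hφ.smooth.continuous.measurable.comp hX).aestronglyMeasurable b
    (Eventually.of_forall fun x => hb _)

theorem memLp_comp_of_map_eq {E Ω Ω' : Type*} [NormedAddCommGroup E] [MeasurableSpace Ω]
    [MeasurableSpace Ω'] {γ : Measure Ω} {μ : Measure Ω'} {X : Ω → Ω'} (hX : Measurable X)
    (h : γ.map X = μ) {f : Ω' → E} (hf : MemLp f 2 μ) : MemLp (fun x => f (X x)) 2 γ := by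
  subst h
  exact hf.comp_of_map hX.aemeasurable

/-- Along a coupling the change of flux splits into a change of velocity, costing `A * L`, and a
change of the gradient of `φ`, costing `M * K`. This allows the flux to be frozen during a substep.
-/
theorem IsLipField.flux_sub_le (hg : IsLipField g L) {μ ν : Measure (Euc d)} (hμ : IsDensity μ)
    (hν : IsDensity ν) {φ : Euc d → ℝ} {A M K w : ℝ} (hA : 0 ≤ A) (hM : 0 ≤ M) (hK : 0 ≤ K)
    (hw : 0 ≤ w) (hφ : IsTest φ A M) (hgK : eLpNorm (g ν) 2 ν ≤ ENNReal.ofReal K)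
    (hW : W2 μ ν ≤ ENNReal.ofReal w) :
    |∫ x, inner ℝ (gradient φ x) (g μ x) ∂μ - ∫ x, inner ℝ (gradient φ x) (g ν x) ∂ν|
      ≤ (A * L + M * K) * w := by
  have := hμ.isProb
  have := hν.isProb
  have hL := hg.nonneg
  have hcφ := hφ.continuous_gradient
  have hcμ := hg.cont μ hμ
  have hcν := hg.cont ν hν
  suffices h : ENNReal.ofReal |∫ x, inner ℝ (gradient φ x) (g μ x) ∂μ
      - ∫ x, inner ℝ (gradient φ x) (g ν x) ∂ν| ≤ ENNReal.ofReal (A * L + M * K) * W2 μ ν by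
    have h2 := h.trans (mul_le_mul_right hW _)
    rw [← ENNReal.ofReal_mul (by positivity)] at h2
    exact (ENNReal.ofReal_le_ofReal_iff (by positivity)).1 h2
  refine le_mul_W2 ENNReal.ofReal_ne_top fun π hπ => ?_
  have := hπ.isProbabilityMeasure
  have m1 : MemLp (fun p : Euc d × Euc d => p.1) 2 π :=
    memLp_comp_of_map_eq measurable_fst hπ.1 hμ.memLp_id
  have m2 : MemLp (fun p : Euc d × Euc d => p.2) 2 π :=
    memLp_comp_of_map_eq measurable_snd hπ.2 hν.memLp_id
  have mg1 : MemLp (fun p : Euc d × Euc d => g μ p.1) 2 π :=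
    memLp_comp_of_map_eq measurable_fst hπ.1 (hg.memLp hμ)
  have mg2 : MemLp (fun p : Euc d × Euc d => g ν p.2) 2 π :=
    memLp_comp_of_map_eq measurable_snd hπ.2 (hg.memLp hν)
  have eK : eLpNorm (fun p : Euc d × Euc d => g ν p.2) 2 π ≤ ENNReal.ofReal K := by
    have h1 := eLpNorm_two_map (μ := π) measurable_snd (f := g ν) (by fun_prop)
    rw [hπ.2] at h1
    exact h1 ▸ hgK
  set c := (eLpNorm (fun p : Euc d × Euc d => p.1 - p.2) 2 π).toReal with hc
  have hcn : eLpNorm (fun p : Euc d × Euc d => p.1 - p.2) 2 π = ENNReal.ofReal c :=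
    (ENNReal.ofReal_toReal (m1.sub m2).2.ne).symm
  have hc0 : 0 ≤ c := ENNReal.toReal_nonneg
  have e1 : ∫ x, inner ℝ (gradient φ x) (g μ x) ∂μ
      = ∫ p, inner ℝ (gradient φ p.1) (g μ p.1) ∂π := by
    conv_lhs => rw [← hπ.1, integral_map (by fun_prop)
      (by rw [hπ.1]; exact (by fun_prop : Continuous _).aestronglyMeasurable), hπ.1]
  have e2 : ∫ x, inner ℝ (gradient φ x) (g ν x) ∂ν
      = ∫ p, inner ℝ (gradient φ p.2) (g ν p.2) ∂π := by
    conv_lhs => rw [← hπ.2, integral_map (by fun_prop)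
      (by rw [hπ.2]; exact (by fun_prop : Continuous _).aestronglyMeasurable), hπ.2]
  rw [e1, e2, ← integral_sub (hφ.integrable_inner measurable_fst mg1)
    (hφ.integrable_inner measurable_snd mg2), hcn, ← ENNReal.ofReal_mul (by positivity)]
  refine ENNReal.ofReal_le_ofReal ?_
  have hi1 := integral_norm_le (mg1.sub mg2) (a := L * c) (by positivity) (by
    rw [ENNReal.ofReal_mul hL, ← hcn]
    exact hg.eLpNorm_le measurable_fst measurable_snd hπ.1 hπ.2 hμ hν)
  have hi2 := integral_norm_mul_norm_le (m1.sub m2) mg2 hc0 hK hcn.le eK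
  have hI1 : Integrable (fun p : Euc d × Euc d => ‖g μ p.1 - g ν p.2‖) π :=
    ((mg1.sub mg2).integrable (by norm_num)).norm
  have hI2 : Integrable (fun p : Euc d × Euc d => ‖p.1 - p.2‖ * ‖g ν p.2‖) π :=
    (m1.sub m2).norm.integrable_mul mg2.norm
  rw [← Real.norm_eq_abs]
  calc ‖∫ p, (inner ℝ (gradient φ p.1) (g μ p.1) - inner ℝ (gradient φ p.2) (g ν p.2)) ∂π‖
      ≤ ∫ p, (A * ‖g μ p.1 - g ν p.2‖ + M * (‖p.1 - p.2‖ * ‖g ν p.2‖)) ∂π := by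
        refine norm_integral_le_of_norm_le ((hI1.const_mul A).add (hI2.const_mul M))
          (Eventually.of_forall fun p => ?_)
        have e : inner ℝ (gradient φ p.1) (g μ p.1) - inner ℝ (gradient φ p.2) (g ν p.2)
            = inner ℝ (gradient φ p.1) (g μ p.1 - g ν p.2)
              + inner ℝ (gradient φ p.1 - gradient φ p.2) (g ν p.2) := by
          rw [inner_sub_right, inner_sub_left]; ring
        rw [e]
        refine (norm_add_le _ _).trans (add_le_add ?_ ?_)
        · refine (norm_inner_le_norm _ _).trans ?_
          gcongr
          rw [← norm_fderiv_eq_norm_gradient]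
          exact hφ.bound _
        · refine (norm_inner_le_norm _ _).trans ?_
          rw [← mul_assoc]
          gcongr
          rw [← norm_fderiv_sub_eq]
          exact hφ.lip _ _
    _ = A * ∫ p, ‖g μ p.1 - g ν p.2‖ ∂π + M * ∫ p, ‖p.1 - p.2‖ * ‖g ν p.2‖ ∂π := by
        rw [integral_add (hI1.const_mul A) (hI2.const_mul M), integral_const_mul,
          integral_const_mul]
    _ ≤ A * (L * c) + M * (c * K) := by gcongr <;> assumption
    _ = (A * L + M * K) * c := by ring

theorem IsTest.taylor_integral {φ : Euc d → ℝ} {A M : ℝ} (hφ : IsTest φ A M) (hM : 0 ≤ M)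
    {μ : Measure (Euc d)} [IsProbabilityMeasure μ] {W : Euc d → Euc d} (hWm : Measurable W)
    (hW : MemLp W 2 μ) {K : ℝ} (hK : 0 ≤ K) (hWK : eLpNorm W 2 μ ≤ ENNReal.ofReal K) (k : ℝ) :
    |∫ x, φ (x - k • W x) ∂μ - ∫ x, φ x ∂μ + k * ∫ x, inner ℝ (gradient φ x) (W x) ∂μ|
      ≤ M * (k ^ 2 * K ^ 2) := by
  have i1 := hφ.integrable (γ := μ) (X := fun x => x - k • W x) (by fun_prop)
  have i2 := hφ.integrable (γ := μ) (X := fun x => x) (by fun_prop)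
  have i3 := (hφ.integrable_inner (γ := μ) (X := fun x => x) (by fun_prop) hW).const_mul k
  rw [← integral_const_mul, ← integral_sub i1 i2, ← integral_add (by exact i1.sub i2) i3,
    ← Real.norm_eq_abs]
  have i4 : Integrable (fun x => ‖W x‖ ^ 2) μ := hW.integrable_norm_pow two_ne_zero
  calc _ ≤ ∫ x, M * (k ^ 2 * ‖W x‖ ^ 2) ∂μ := by
        refine norm_integral_le_of_norm_le ((i4.const_mul _).const_mul M)
          (Eventually.of_forall fun x => ?_)
        have h := norm_taylor_le hM (hφ.smooth.differentiable (by simp)) hφ.lip x (x - k • W x)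
        have e : x - k • W x - x = -(k • W x) := by abel
        rw [e, map_neg, map_smul, norm_neg, norm_smul, mul_pow, Real.norm_eq_abs k, sq_abs,
          ← inner_gradient_eq, sub_neg_eq_add] at h
        exact h
    _ = M * (k ^ 2 * ∫ x, ‖W x‖ ^ 2 ∂μ) := by rw [integral_const_mul, integral_const_mul]
    _ ≤ _ := by
        gcongr
        exact integral_norm_sq_le hW hK hWK

variable {δF : Measure (Euc d) → Euc d → ℝ} {τ : ℝ} {ρ : ℝ → Measure (Euc d)}

theorem IsWGFSolution.weak_interval (hρ : IsWGFSolution δF τ ρ) {φ : Euc d → ℝ}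
    (hφ : ContDiff ℝ ∞ φ) (hc : HasCompactSupport φ) {r q : ℝ} (hr : r ∈ Icc 0 τ)
    (hq : q ∈ Icc 0 τ) :
    IntervalIntegrable
      (fun s => ∫ x, inner ℝ (gradient φ x) (gradient (δF (ρ s)) x) ∂(ρ s)) volume r q ∧
    ∫ x, φ x ∂(ρ q) = ∫ x, φ x ∂(ρ r)
      - ∫ s in r..q, ∫ x, inner ℝ (gradient φ x) (gradient (δF (ρ s)) x) ∂(ρ s) := by
  obtain ⟨i1, h1⟩ := hρ.weak φ hφ hc r hr
  obtain ⟨i2, h2⟩ := hρ.weak φ hφ hc q hq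
  refine ⟨i1.symm.trans i2, ?_⟩
  rw [h2, h1, ← intervalIntegral.integral_interval_sub_left i2 i1]
  ring

/-- One explicit Euler step with a smooth approximation of the velocity, tested against a smooth
function. -/
theorem IsWGFSolution.step_le (hg : IsLipField (fun μ => gradient (δF μ)) L)
    (hρ : IsWGFSolution δF τ ρ) {r k : ℝ} (hk : 0 ≤ k) (hr : 0 ≤ r) (hrk : r + k ≤ τ)
    {φ : Euc d → ℝ} {A M K w ε : ℝ} (hA : 0 ≤ A) (hM : 0 ≤ M) (hK : 0 ≤ K)
    (hw : 0 ≤ w) (hε : 0 ≤ ε) (hφ : IsTest φ A M)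
    (hgK : eLpNorm (gradient (δF (ρ r))) 2 (ρ r) ≤ ENNReal.ofReal K)
    (hWw : ∀ p ∈ Icc r (r + k), W2 (ρ p) (ρ r) ≤ ENNReal.ofReal w)
    {W : Euc d → Euc d} (hWm : Measurable W)
    (hWε : eLpNorm (fun x => W x - gradient (δF (ρ r)) x) 2 (ρ r) ≤ ENNReal.ofReal ε) :
    |∫ x, φ x ∂(ρ (r + k)) - ∫ x, φ (x - k • W x) ∂(ρ r)|
      ≤ k * ((A * L + M * K) * w + M * (k * (K + ε) ^ 2) + A * ε) := by
  have hr' : r ∈ Icc 0 τ := ⟨hr, by linarith⟩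
  have hq' : r + k ∈ Icc 0 τ := ⟨by linarith, hrk⟩
  have hd := hρ.isDensity r hr'
  have := hd.isProb
  have hgm := hg.memLp hd
  have hgc := hg.cont _ hd
  obtain ⟨ii, he⟩ := hρ.weak_interval hφ.smooth hφ.compact hr' hq'
  set h : ℝ → ℝ := fun s => ∫ x, inner ℝ (gradient φ x) (gradient (δF (ρ s)) x) ∂(ρ s) with hh
  -- Three errors are added: `b1` freezes the flux at time `r`, `b2` linearizes `φ` along the
  -- substep, `b3` replaces the true velocity by `W`.
  have b1 : |(∫ s in r..(r + k), h s) - k * h r| ≤ k * ((A * L + M * K) * w) := by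
    have e : (∫ s in r..(r + k), h s) - k * h r = ∫ s in r..(r + k), (h s - h r) := by
      rw [intervalIntegral.integral_sub ii intervalIntegrable_const]
      simp
    rw [e, ← Real.norm_eq_abs]
    have := intervalIntegral.norm_integral_le_of_norm_le_const (a := r) (b := r + k)
      (f := fun s => h s - h r) (C := (A * L + M * K) * w) fun p hp => ?_
    · rw [add_sub_cancel_left, abs_of_nonneg hk] at this
      rw [mul_comm]; exact this
    · rw [uIoc_of_le (by linarith)] at hp
      exact hg.flux_sub_le (hρ.isDensity p ⟨by linarith [hp.1], by linarith [hp.2]⟩) hd hA hM hK hw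
        hφ hgK (hWw p ⟨hp.1.le, hp.2⟩)
  have hWg : MemLp (fun x => W x - gradient (δF (ρ r)) x) 2 (ρ r) :=
    ⟨by fun_prop, hWε.trans_lt ENNReal.ofReal_lt_top⟩
  have hWmem : MemLp W 2 (ρ r) := memLp_two_of_dist_le hgm hWm.aestronglyMeasurable hWg.2
  have hWK : eLpNorm W 2 (ρ r) ≤ ENNReal.ofReal (K + ε) := by
    have e : W = gradient (δF (ρ r)) + fun x => W x - gradient (δF (ρ r)) x := by
      ext1 x; simp
    rw [e, ENNReal.ofReal_add hK hε]
    exact (eLpNorm_add_le hgm.1 hWg.1 (by norm_num)).trans (add_le_add hgK hWε)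
  have b2 := hφ.taylor_integral hM hWm hWmem (by positivity) hWK k
  have b3 : |∫ x, inner ℝ (gradient φ x) (W x) ∂(ρ r) - h r| ≤ A * ε := by
    have i1 := hφ.integrable_inner (γ := ρ r) (X := fun x => x) (by fun_prop) hWmem
    have i2 := hφ.integrable_inner (γ := ρ r) (X := fun x => x) (by fun_prop) hgm
    simp only [hh]
    rw [← integral_sub i1 i2, ← Real.norm_eq_abs]
    calc _ ≤ ∫ x, A * ‖W x - gradient (δF (ρ r)) x‖ ∂(ρ r) := by
          refine norm_integral_le_of_norm_le ((hWg.integrable (by norm_num)).norm.const_mul A)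
            (Eventually.of_forall fun x => ?_)
          rw [← inner_sub_right]
          refine (norm_inner_le_norm _ _).trans ?_
          gcongr
          rw [← norm_fderiv_eq_norm_gradient]
          exact hφ.bound _
      _ ≤ A * ε := by
          rw [integral_const_mul]
          gcongr
          exact integral_norm_le hWg hε hWε
  rw [he]
  have b3' : |k * (∫ x, inner ℝ (gradient φ x) (W x) ∂(ρ r) - h r)| ≤ k * (A * ε) := by
    rw [abs_mul, abs_of_nonneg hk]; gcongr
  rw [abs_le] at b1 b2 b3' ⊢
  constructor <;> nlinarith [b1.1, b1.2, b2.1, b2.2, b3'.1, b3'.2]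

/-- Explicit Euler iterates with step size `k` for the fields `-W 0, -W 1, …`. -/
def eulerMap (k : ℝ) (W : ℕ → Euc d → Euc d) : ℕ → Euc d → Euc d
  | 0 => fun x => x
  | n + 1 => fun x => eulerMap k W n x - k • W n (eulerMap k W n x)

theorem measurable_eulerMap {k : ℝ} {W : ℕ → Euc d → Euc d} (hW : ∀ n, Measurable (W n)) (n : ℕ) :
    Measurable (eulerMap k W n) := by
  induction n with
  | zero => exact measurable_id
  | succ n ih => exact ih.sub (((hW n).comp ih).const_smul k)

/-- Weak consistency of the Euler scheme: the law of the iterates is close to the solution when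
tested against smooth functions. -/
theorem IsWGFSolution.euler_weak (hg : IsLipField (fun μ => gradient (δF μ)) L)
    (hρ : IsWGFSolution δF τ ρ) {s k : ℝ} (hk : 0 ≤ k) (hs : 0 ≤ s) (hkL : k * L < 1) {N : ℕ}
    (hN : s + N * k ≤ τ) {K w ε B : ℝ} (hK : 0 ≤ K) (hw : 0 ≤ w) (hε : 0 ≤ ε) (hB : 0 ≤ B)
    (hgK : ∀ p ∈ Icc s (s + N * k), eLpNorm (gradient (δF (ρ p))) 2 (ρ p) ≤ ENNReal.ofReal K)
    (hWw : ∀ p ∈ Icc s (s + N * k), ∀ q ∈ Icc s (s + N * k), |p - q| ≤ k →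
      W2 (ρ p) (ρ q) ≤ ENNReal.ofReal w)
    {W : ℕ → Euc d → Euc d} (hW : ∀ n, ContDiff ℝ ∞ (W n))
    (hWL : ∀ n x y, ‖W n x - W n y‖ ≤ L * ‖x - y‖)
    (hWB : ∀ n x y, ‖fderiv ℝ (W n) x - fderiv ℝ (W n) y‖ ≤ B * ‖x - y‖)
    (hWε : ∀ n < N, eLpNorm (fun x => W n x - gradient (δF (ρ (s + n * k))) x) 2 (ρ (s + n * k))
      ≤ ENNReal.ofReal ε) {n : ℕ} (hn : n ≤ N) :
    ∀ (φ : Euc d → ℝ) (A M : ℝ), 0 ≤ A → 0 ≤ M → IsTest φ A M →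
      |∫ x, φ x ∂(ρ (s + n * k)) - ∫ x, φ (eulerMap k W n x) ∂(ρ s)|
        ≤ n * k * ((1 + k * L) ^ 2) ^ n * ((L * w + ε) * A
          + (K * w + k * (K + ε) ^ 2) * (M + n * k * B * A)) := by
  have hL := hg.nonneg
  induction n with
  | zero => intro φ A M _ _ _; simp [eulerMap]
  | succ n ih =>
    intro φ A M hA hM hφ
    have hnN : (n : ℝ) + 1 ≤ N := by exact_mod_cast hn
    have hnk : (0 : ℝ) ≤ n * k := by positivity
    have hle : (n + 1 : ℝ) * k ≤ N * k := by gcongr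
    have h1 := hρ.step_le hg (r := s + n * k) hk (by positivity) (by linarith) hA hM hK hw hε hφ
      (hgK _ ⟨by linarith, by linarith⟩)
      (fun p hp => hWw p ⟨by linarith [hp.1], by linarith [hp.2]⟩ _ ⟨by linarith, by linarith⟩
        (by rw [abs_of_nonneg (by linarith [hp.1])]; linarith [hp.2]))
      (hW n).continuous.measurable (hWε n (by omega))
    -- The induction hypothesis is applied to the pull-back of `φ` by the last substep, which is why
    -- the claim ranges over all test functions. Repeated pull-backs produce the power of `(1 + k *
    -- L) ^ 2` and the growth `n * k * B * A` of the second constant.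
    have h2 := ih (by omega) _ _ _ (by positivity) (by positivity)
      (hφ.comp hL hk hkL hA hM (hW n) (hWL n) (hWB n))
    have e : s + n * k + k = s + ((n + 1 : ℕ) : ℝ) * k := by push_cast; ring
    rw [e] at h1
    have h3 := (abs_sub_le _ _ _).trans (add_le_add h1 h2)
    refine h3.trans ?_
    set q := (1 + k * L) ^ 2 with hq
    have hkL0 : 0 ≤ k * L := by positivity
    have hq1 : 1 ≤ q := one_le_pow₀ (by linarith)
    have hq2 : 1 + k * L ≤ q := by rw [hq]; nlinarith
    have hqn : 1 ≤ q ^ n := one_le_pow₀ hq1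
    have hqn1 : 1 ≤ q ^ (n + 1) := one_le_pow₀ hq1
    set β := K * w + k * (K + ε) ^ 2 with hβ
    have hβ0 : 0 ≤ β := by positivity
    set α := L * w + ε with hα
    have hα0 : 0 ≤ α := by positivity
    have e1 : k * ((A * L + M * K) * w + M * (k * (K + ε) ^ 2) + A * ε)
        = k * (α * A + β * M) := by rw [hα, hβ]; ring
    rw [e1]
    push_cast
    have s1 : k * (α * A + β * M)
        ≤ k * q ^ (n + 1) * (α * A + β * (M + (n + 1) * k * B * A)) := by
      calc k * (α * A + β * M) ≤ k * 1 * (α * A + β * (M + (n + 1) * k * B * A)) := by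
            rw [mul_one]; gcongr; exact le_add_of_nonneg_right (by positivity)
        _ ≤ _ := by gcongr
    have s2 : n * k * q ^ n * (α * (A * (1 + k * L))
          + β * (M * q + A * (k * B) + n * k * B * (A * (1 + k * L))))
        ≤ n * k * q ^ (n + 1) * (α * A + β * (M + (n + 1) * k * B * A)) := by
      rw [show n * k * q ^ (n + 1) * (α * A + β * (M + (n + 1) * k * B * A))
        = n * k * q ^ n * (q * (α * A + β * (M + (n + 1) * k * B * A))) by rw [pow_succ]; ring]
      refine mul_le_mul_of_nonneg_left ?_ (by positivity)
      have t1 : A * (1 + k * L) ≤ A * q := by gcongr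
      have t2 : A * (k * B) ≤ A * (k * B) * q := le_mul_of_one_le_right (by positivity) hq1
      calc α * (A * (1 + k * L)) + β * (M * q + A * (k * B) + n * k * B * (A * (1 + k * L)))
          ≤ α * (A * q) + β * (M * q + A * (k * B) * q + n * k * B * (A * q)) := by gcongr
        _ = _ := by ring
    calc _ ≤ k * q ^ (n + 1) * (α * A + β * (M + (n + 1) * k * B * A))
        + n * k * q ^ (n + 1) * (α * A + β * (M + (n + 1) * k * B * A)) := add_le_add s1 s2
      _ = _ := by ring

end Step

/-! ### Measures determined by test functions, and lower semicontinuity of the distance. -/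

section LowerSemicontinuity

variable {d : ℕ}

open scoped Manifold NNReal in
/-- Finite measures with the same integrals of smooth compactly supported functions are ordered on
compact sets, hence equal. -/
theorem measure_le_of_forall_integral_eq {μ ν : Measure (Euc d)} [IsFiniteMeasure μ]
    [IsFiniteMeasure ν]
    (h : ∀ φ : Euc d → ℝ, ContDiff ℝ ∞ φ → HasCompactSupport φ → ∫ x, φ x ∂μ = ∫ x, φ x ∂ν)
    {K : Set (Euc d)} (hK : IsCompact K) : μ K ≤ ν K := by
  rw [K.measure_eq_iInf_isOpen ν]
  refine le_iInf fun U => le_iInf fun hKU => le_iInf fun hU => ?_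
  -- Intersecting `U` with a thickening of `K` keeps the support of the cutoff bounded.
  obtain ⟨φ, hφ, hr, hs, h1⟩ := exists_contMDiff_support_eq_eq_one_iff (n := ⊤) 𝓘(ℝ, Euc d)
    (hU.inter (Metric.isOpen_thickening (δ := 1) (E := K))) hK.isClosed
    (subset_inter hKU (Metric.self_subset_thickening one_pos K))
  have hφ' : ContDiff ℝ ∞ φ := contMDiff_iff_contDiff.1 hφ
  have hb : Bornology.IsBounded (U ∩ Metric.thickening 1 K) :=
    hK.isBounded.thickening.subset inter_subset_right
  have hc : HasCompactSupport φ := by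
    refine HasCompactSupport.of_support_subset_isCompact hb.isCompact_closure ?_
    rw [hs]; exact subset_closure
  have hφ0 : ∀ x, 0 ≤ φ x := fun x => (hr ⟨x, rfl⟩).1
  have hφ1 : ∀ x, φ x ≤ 1 := fun x => (hr ⟨x, rfl⟩).2
  have i1 : Integrable φ μ := hφ'.continuous.integrable_of_hasCompactSupport hc
  have i2 : Integrable φ ν := hφ'.continuous.integrable_of_hasCompactSupport hc
  calc μ K = ∫⁻ x, K.indicator 1 x ∂μ := (lintegral_indicator_one hK.measurableSet).symm
    _ ≤ ∫⁻ x, ENNReal.ofReal (φ x) ∂μ := by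
        refine lintegral_mono fun x => ?_
        by_cases hx : x ∈ K
        · simp [hx, (h1 x).1 hx]
        · simp [hx]
    _ = ENNReal.ofReal (∫ x, φ x ∂μ) :=
        (ofReal_integral_eq_lintegral_ofReal i1 (Eventually.of_forall hφ0)).symm
    _ = ENNReal.ofReal (∫ x, φ x ∂ν) := by rw [h φ hφ' hc]
    _ = ∫⁻ x, ENNReal.ofReal (φ x) ∂ν :=
        ofReal_integral_eq_lintegral_ofReal i2 (Eventually.of_forall hφ0)
    _ ≤ ∫⁻ x, U.indicator 1 x ∂ν := by
        refine lintegral_mono fun x => ?_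
        by_cases hx : x ∈ U
        · simpa [hx] using hφ1 x
        · have : x ∉ Function.support φ := by rw [hs]; exact fun h => hx h.1
          simp [hx, Function.notMem_support.1 this]
    _ = ν U := lintegral_indicator_one hU.measurableSet

theorem measure_eq_of_forall_integral_eq {μ ν : Measure (Euc d)} [IsFiniteMeasure μ]
    [IsFiniteMeasure ν]
    (h : ∀ φ : Euc d → ℝ, ContDiff ℝ ∞ φ → HasCompactSupport φ → ∫ x, φ x ∂μ = ∫ x, φ x ∂ν) :
    μ = ν := by
  ext s hs
  rw [hs.measure_eq_iSup_isCompact_of_ne_top (measure_ne_top _ _),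
    hs.measure_eq_iSup_isCompact_of_ne_top (measure_ne_top _ _)]
  refine iSup_congr fun K => iSup_congr fun _ => iSup_congr fun hK => ?_
  exact le_antisymm (measure_le_of_forall_integral_eq h hK)
    (measure_le_of_forall_integral_eq (fun φ h1 h2 => (h φ h1 h2).symm) hK)

open scoped NNReal BoundedContinuousFunction in
/-- Lower semicontinuity of the Wasserstein distance along maps whose laws converge when tested
against smooth compactly supported functions. -/
theorem W2_le_of_tendsto {Ω : Type*} [MeasurableSpace Ω] {μ : Measure Ω} [IsProbabilityMeasure μ]
    {Y : Ω → Euc d} (hY : Measurable Y) (hY2 : MemLp Y 2 μ) {Z : ℕ → Ω → Euc d}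
    (hZ : ∀ m, Measurable (Z m)) {c : ℝ≥0∞} (hc : c ≠ ⊤)
    (hZc : ∀ m, eLpNorm (fun x => Y x - Z m x) 2 μ ≤ c) {ν : Measure (Euc d)}
    [IsProbabilityMeasure ν]
    (hν : ∀ φ : Euc d → ℝ, ContDiff ℝ ∞ φ → HasCompactSupport φ →
      Tendsto (fun m => ∫ x, φ (Z m x) ∂μ) atTop (𝓝 (∫ x, φ x ∂ν))) :
    W2 (μ.map Y) ν ≤ c := by
  have hYZ : ∀ m, Measurable fun x => (Y x, Z m x) := fun m => hY.prodMk (hZ m)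
  let P : ℕ → ProbabilityMeasure (Euc d × Euc d) := fun m =>
    ⟨μ.map fun x => (Y x, Z m x), Measure.isProbabilityMeasure_map (hYZ m).aemeasurable⟩
  have hP : ∀ m, (P m : Measure (Euc d × Euc d)) = μ.map fun x => (Y x, Z m x) := fun m => rfl
  set D : ℝ≥0∞ := eLpNorm Y 2 μ + c with hD
  have hDt : D ≠ ⊤ := ENNReal.add_ne_top.2 ⟨hY2.2.ne, hc⟩
  have hbound : ∀ m, eLpNorm (fun p : Euc d × Euc d => p) 2 (P m) ≤ eLpNorm Y 2 μ + D := by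
    intro m
    rw [hP, eLpNorm_two_map (hYZ m) (by fun_prop)]
    have hZD : eLpNorm (Z m) 2 μ ≤ D := by
      have e : Z m = Y - fun x => Y x - Z m x := by ext1 x; simp
      rw [e]
      exact (eLpNorm_sub_le (by fun_prop) (by fun_prop) (by norm_num)).trans
        (add_le_add le_rfl (hZc m))
    calc eLpNorm ((fun p : Euc d × Euc d => p) ∘ fun x => (Y x, Z m x)) 2 μ
        ≤ eLpNorm ((fun x => ‖Y x‖) + fun x => ‖Z m x‖) 2 μ := by
          refine eLpNorm_mono_real fun x => ?_
          simp only [Function.comp_apply, Pi.add_apply, Prod.norm_mk]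
          exact max_le_add_of_nonneg (norm_nonneg _) (norm_nonneg _)
      _ ≤ eLpNorm (fun x => ‖Y x‖) 2 μ + eLpNorm (fun x => ‖Z m x‖) 2 μ :=
          eLpNorm_add_le (hY.norm.aestronglyMeasurable) ((hZ m).norm.aestronglyMeasurable)
            (by norm_num)
      _ ≤ _ := by
          rw [eLpNorm_norm, eLpNorm_norm]
          exact add_le_add le_rfl hZD
  set Q : ℝ≥0∞ := eLpNorm Y 2 μ + D with hQ
  have hQt : Q ≠ ⊤ := ENNReal.add_ne_top.2 ⟨hY2.2.ne, hDt⟩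
  -- Tightness of the joint laws follows from their uniform second moments by Chebyshev's
  -- inequality.
  have htight : IsTightMeasureSet
      {((μ : ProbabilityMeasure (Euc d × Euc d)) : Measure (Euc d × Euc d)) | μ ∈ range P} := by
    refine isTightMeasureSet_of_tendsto_measure_norm_gt ?_
    have hlim : Tendsto (fun r : ℝ => (ENNReal.ofReal r)⁻¹ ^ 2 * Q ^ 2) atTop (𝓝 0) := by
      have h0 : Tendsto (fun r : ℝ => (ENNReal.ofReal r)⁻¹) atTop (𝓝 ⊤⁻¹) :=
        tendsto_inv_iff.2 ENNReal.tendsto_ofReal_atTop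
      have h1 := ENNReal.Tendsto.pow h0 (n := 2)
      have h2 := ENNReal.Tendsto.mul_const h1 (b := Q ^ 2) (Or.inr (ENNReal.pow_ne_top hQt))
      simpa using h2
    refine tendsto_of_tendsto_of_tendsto_of_le_of_le' tendsto_const_nhds hlim
      (Eventually.of_forall fun _ => zero_le) ?_
    filter_upwards [eventually_gt_atTop 0] with r hr
    refine iSup₂_le ?_
    rintro _ ⟨_, ⟨m, rfl⟩, rfl⟩
    have hm : AEStronglyMeasurable (fun p : Euc d × Euc d => p) (P m : Measure _) := by fun_prop
    have h := meas_ge_le_mul_pow_eLpNorm_enorm (P m : Measure (Euc d × Euc d)) two_ne_zero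
      ENNReal.ofNat_ne_top hm (ε := ENNReal.ofReal r) (by simpa using hr) (by simp)
    simp only [ENNReal.toReal_ofNat, ENNReal.rpow_ofNat] at h
    refine (measure_mono fun p hp => ?_).trans (h.trans (by gcongr; exact hbound m))
    have hp' : r < ‖p‖ := hp
    simp only [mem_ofPred_eq, ← ofReal_norm]
    exact ENNReal.ofReal_le_ofReal hp'.le
  -- Prokhorov's theorem; a limit along an ultrafilter replaces a convergent subsequence.
  obtain ⟨π, -, hπ⟩ := (isCompact_closure_of_isTightMeasureSet htight).ultrafilter_le_nhds
    ((hyperfilter ℕ).map P) (le_principal_iff.2 (mem_map.2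
      (Eventually.of_forall fun m => subset_closure ⟨m, rfl⟩)))
  have hT : Tendsto P (hyperfilter ℕ : Filter ℕ) (𝓝 π) := hπ
  have hTi := ProbabilityMeasure.tendsto_iff_forall_integral_tendsto.1 hT
  have hTl := ProbabilityMeasure.tendsto_iff_forall_lintegral_tendsto.1 hT
  have hmY : IsProbabilityMeasure (μ.map Y) := Measure.isProbabilityMeasure_map hY.aemeasurable
  have hcoup : IsCoupling (μ.map Y) ν (π : Measure (Euc d × Euc d)) := by
    have key : ∀ (φ : Euc d → ℝ), ContDiff ℝ ∞ φ → HasCompactSupport φ →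
        ∃ f : Euc d →ᵇ ℝ, ∀ x, f x = φ x := fun φ h1 h2 => by
      obtain ⟨b, hb⟩ := h2.exists_bound_of_continuous h1.continuous
      exact ⟨BoundedContinuousFunction.ofNormedAddCommGroup φ h1.continuous b hb, fun x => rfl⟩
    have h1 : IsProbabilityMeasure ((π : Measure (Euc d × Euc d)).map Prod.fst) :=
      Measure.isProbabilityMeasure_map (by fun_prop)
    have h2 : IsProbabilityMeasure ((π : Measure (Euc d × Euc d)).map Prod.snd) :=
      Measure.isProbabilityMeasure_map (by fun_prop)
    constructor
    · refine measure_eq_of_forall_integral_eq fun φ hφ hφc => ?_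
      obtain ⟨f, hf⟩ := key φ hφ hφc
      rw [integral_map (by fun_prop) hφ.continuous.aestronglyMeasurable,
        integral_map (by fun_prop) hφ.continuous.aestronglyMeasurable]
      have h := hTi (f.compContinuous ⟨Prod.fst, continuous_fst⟩)
      simp only [BoundedContinuousFunction.compContinuous_apply, ContinuousMap.coe_mk, hf] at h
      refine tendsto_nhds_unique h (tendsto_const_nhds.congr fun m => ?_)
      rw [hP]
      exact (integral_map (hYZ m).aemeasurable
        (hφ.continuous.comp continuous_fst).aestronglyMeasurable).symm
    · refine measure_eq_of_forall_integral_eq fun φ hφ hφc => ?_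
      obtain ⟨f, hf⟩ := key φ hφ hφc
      rw [integral_map (by fun_prop) hφ.continuous.aestronglyMeasurable]
      have h := hTi (f.compContinuous ⟨Prod.snd, continuous_snd⟩)
      simp only [BoundedContinuousFunction.compContinuous_apply, ContinuousMap.coe_mk, hf] at h
      refine tendsto_nhds_unique h
        (((hν φ hφ hφc).mono_left Nat.hyperfilter_le_atTop).congr fun m => ?_)
      rw [hP]
      exact (integral_map (hYZ m).aemeasurable
        (hφ.continuous.comp continuous_snd).aestronglyMeasurable).symm
  refine (W2_le_of_isCoupling hcoup).trans ?_
  rw [← ENNReal.pow_le_pow_left_iff two_ne_zero, eLpNorm_two_sq]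
  -- The quadratic cost is unbounded, so it is truncated at `R` to pass to the weak limit, and
  -- recovered by monotone convergence.
  have hmono : ∫⁻ p : Euc d × Euc d, ‖p.1 - p.2‖ₑ ^ 2 ∂(π : Measure (Euc d × Euc d))
      = ⨆ R : ℕ, ∫⁻ p, ((min (‖p.1 - p.2‖₊ ^ 2) R : ℝ≥0) : ℝ≥0∞)
        ∂(π : Measure (Euc d × Euc d)) := by
    rw [← lintegral_iSup (fun R => by fun_prop) (fun R R' h p => by
      simp only; gcongr)]
    refine lintegral_congr fun p => ?_
    refine le_antisymm ?_ (iSup_le fun R => ?_)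
    · obtain ⟨R, hR⟩ := exists_nat_ge (‖p.1 - p.2‖₊ ^ 2)
      refine le_iSup_of_le R ?_
      rw [min_eq_left hR]; simp [enorm]
    · calc ((min (‖p.1 - p.2‖₊ ^ 2) R : ℝ≥0) : ℝ≥0∞) ≤ ((‖p.1 - p.2‖₊ ^ 2 : ℝ≥0) : ℝ≥0∞) := by
            gcongr; exact min_le_left _ _
        _ = _ := by simp [enorm]
  rw [hmono]
  refine iSup_le fun R => ?_
  let f : (Euc d × Euc d) →ᵇ ℝ≥0 := BoundedContinuousFunction.mkOfBound
    ⟨fun p => min (‖p.1 - p.2‖₊ ^ 2) R, by fun_prop⟩ (R : ℝ) fun p q => by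
      have h1 : ((min (‖p.1 - p.2‖₊ ^ 2) R : ℝ≥0) : ℝ) ≤ R := NNReal.coe_le_coe.2 (min_le_right _ _)
      have h2 : ((min (‖q.1 - q.2‖₊ ^ 2) R : ℝ≥0) : ℝ) ≤ R := NNReal.coe_le_coe.2 (min_le_right _ _)
      rw [NNReal.dist_eq, abs_le]
      constructor <;> simp only [ContinuousMap.coe_mk] <;>
        linarith [NNReal.coe_nonneg (min (‖p.1 - p.2‖₊ ^ 2) (R : ℝ≥0)),
          NNReal.coe_nonneg (min (‖q.1 - q.2‖₊ ^ 2) (R : ℝ≥0))]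
  refine le_of_tendsto (hTl f) (Eventually.of_forall fun m => ?_)
  rw [hP, lintegral_map (by fun_prop) (hYZ m)]
  calc _ ≤ ∫⁻ x, ‖Y x - Z m x‖ₑ ^ 2 ∂μ := by
        refine lintegral_mono fun x => ?_
        calc ((min (‖Y x - Z m x‖₊ ^ 2) R : ℝ≥0) : ℝ≥0∞)
            ≤ ((‖Y x - Z m x‖₊ ^ 2 : ℝ≥0) : ℝ≥0∞) := by
              gcongr; exact min_le_left _ _
          _ = _ := by simp [enorm]
    _ = eLpNorm (fun x => Y x - Z m x) 2 μ ^ 2 := (eLpNorm_two_sq _ _).symm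
    _ ≤ c ^ 2 := by gcongr; exact hZc m

end LowerSemicontinuity

/-! ### The weak solution follows its Euler step up to an error of smaller order. -/

section Crux

variable {d : ℕ} {g : Measure (Euc d) → Euc d → Euc d} {L : ℝ}

theorem eLpNorm_add_le_ofReal {Ω E : Type*} [MeasurableSpace Ω] [NormedAddCommGroup E]
    {γ : Measure Ω} {f h : Ω → E} (hf : AEStronglyMeasurable f γ) (hh : AEStronglyMeasurable h γ)
    {a b : ℝ} (ha : 0 ≤ a) (hb : 0 ≤ b) (hfa : eLpNorm f 2 γ ≤ ENNReal.ofReal a)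
    (hhb : eLpNorm h 2 γ ≤ ENNReal.ofReal b) :
    eLpNorm (fun x => f x + h x) 2 γ ≤ ENNReal.ofReal (a + b) := by
  rw [ENNReal.ofReal_add ha hb]
  exact (eLpNorm_add_le hf hh (by norm_num)).trans (add_le_add hfa hhb)

/-- A Lipschitz approximation of the field at one density approximates it at nearby densities. -/
theorem IsLipField.approx_transfer (hg : IsLipField g L) {μ ν : Measure (Euc d)}
    (hμ : IsDensity μ) (hν : IsDensity ν) {W : Euc d → Euc d} (hWm : Measurable W)
    (hWL : ∀ x y, ‖W x - W y‖ ≤ L * ‖x - y‖) :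
    eLpNorm (fun x => W x - g μ x) 2 μ
      ≤ eLpNorm (fun x => W x - g ν x) 2 ν + ENNReal.ofReal (2 * L) * W2 μ ν := by
  have := hμ.isProb
  have := hν.isProb
  have c1 := (hg.cont μ hμ).measurable
  have c2 := (hg.cont ν hν).measurable
  rw [← tsub_le_iff_left]
  refine le_mul_W2 ENNReal.ofReal_ne_top fun π hπ => ?_
  rw [tsub_le_iff_left]
  have h1 := hg.eLpNorm_le measurable_fst measurable_snd hπ.1 hπ.2 hμ hν
  rw [eLpNorm_two_sub_comm] at h1
  have h2 := eLpNorm_le_of_norm_sub_le (γ := π) hWL Prod.fst Prod.snd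
  have e1 : eLpNorm (fun x => W x - g μ x) 2 μ
      = eLpNorm (fun p : Euc d × Euc d => W p.1 - g μ p.1) 2 π := by
    have := eLpNorm_two_map (μ := π) measurable_fst (f := fun x => W x - g μ x) (by fun_prop)
    rw [hπ.1] at this
    exact this
  have e2 : eLpNorm (fun x => W x - g ν x) 2 ν
      = eLpNorm (fun p : Euc d × Euc d => W p.2 - g ν p.2) 2 π := by
    have := eLpNorm_two_map (μ := π) measurable_snd (f := fun x => W x - g ν x) (by fun_prop)
    rw [hπ.2] at this
    exact this
  have e3 : (fun p : Euc d × Euc d => W p.1 - g μ p.1)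
      = (fun p : Euc d × Euc d => W p.2 - g ν p.2)
        + ((fun p : Euc d × Euc d => W p.1 - W p.2) + fun p => g ν p.2 - g μ p.1) := by
    ext1 p; simp only [Pi.add_apply]; abel
  rw [e1, e2, e3, ENNReal.ofReal_mul (by norm_num), ENNReal.ofReal_ofNat, mul_assoc, two_mul]
  refine (eLpNorm_add_le (by fun_prop) (by fun_prop) (by norm_num)).trans (add_le_add le_rfl ?_)
  exact (eLpNorm_add_le (by fun_prop) (by fun_prop) (by norm_num)).trans (add_le_add h2 h1)

/-- The Euler iterates differ from the first order expansion `id - n k v` by a second order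
error. -/
theorem eulerMap_sub_le {μ : Measure (Euc d)} {v : Euc d → Euc d} (hv : Measurable v)
    (hL : 0 ≤ L) {k K η : ℝ} (hk : 0 ≤ k) (hK : 0 ≤ K) (hη : 0 ≤ η)
    (hvK : eLpNorm v 2 μ ≤ ENNReal.ofReal K) {W : ℕ → Euc d → Euc d} (hW : ∀ n, Measurable (W n))
    (hWL : ∀ n x y, ‖W n x - W n y‖ ≤ L * ‖x - y‖) {N : ℕ}
    (hWη : ∀ n < N, eLpNorm (fun x => W n x - v x) 2 μ ≤ ENNReal.ofReal η) :
    ∀ n ≤ N, eLpNorm (fun x => eulerMap k W n x - x) 2 μ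
        ≤ ENNReal.ofReal (n * k * (1 + k * L) ^ n * (η + K)) ∧
      eLpNorm (fun x => eulerMap k W n x - (x - (n * k) • v x)) 2 μ
        ≤ ENNReal.ofReal (n * k * (L * (n * k * (1 + k * L) ^ n * (η + K)) + η)) := by
  have hZ := measurable_eulerMap (k := k) hW
  intro n hn
  induction n with
  | zero => simp [eulerMap]
  | succ n ih =>
    obtain ⟨h1, h2⟩ := ih (by omega)
    set e := n * k * (1 + k * L) ^ n * (η + K) with he
    have he0 : 0 ≤ e := by positivity
    have hWn := hW n
    have hZn := hZ n
    have hkL : 0 ≤ k * L := by positivity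
    -- `W n` is evaluated at the displaced point: the displacement bound `e` from the first conjunct
    -- enters through the Lipschitz constant.
    have hsub : eLpNorm (fun x => W n (eulerMap k W n x) - v x) 2 μ
        ≤ ENNReal.ofReal (L * e + η) := by
      have hl := eLpNorm_le_of_norm_sub_le (γ := μ) (hWL n) (eulerMap k W n) (fun x => x)
      have hl' := hl.trans (mul_le_mul_right h1 _)
      rw [← ENNReal.ofReal_mul hL] at hl'
      refine le_trans (le_of_eq ?_) (eLpNorm_add_le_ofReal (by fun_prop) (by fun_prop)
        (by positivity) hη hl' (hWη n (by omega)))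
      congr 1; ext1 x; abel
    have hmul : ∀ {f : Euc d → Euc d} {a : ℝ}, eLpNorm f 2 μ ≤ ENNReal.ofReal a →
        eLpNorm (fun x => -(k • f x)) 2 μ ≤ ENNReal.ofReal (k * a) := by
      intro f a hf
      rw [ENNReal.ofReal_mul hk]
      have := eLpNorm_const_smul (-k) f 2 μ
      refine le_trans (le_of_eq ?_) (mul_le_mul_right hf _)
      rw [show (fun x => -(k • f x)) = (-k) • f by ext1 x; simp, this, enorm_neg,
        Real.enorm_of_nonneg hk]
    have hstm : AEStronglyMeasurable (fun x => -(k • W n (eulerMap k W n x))) μ :=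
      ((hWn.comp hZn).const_smul k).neg.aestronglyMeasurable
    have hst : eLpNorm (fun x => W n (eulerMap k W n x)) 2 μ
        ≤ ENNReal.ofReal ((L * e + η) + K) := by
      refine le_trans (le_of_eq ?_) (eLpNorm_add_le_ofReal (by fun_prop) (by fun_prop)
        (by positivity) hK hsub hvK)
      congr 1; ext1 x; abel
    have hpow : 1 ≤ (1 + k * L) ^ n := one_le_pow₀ (by linarith)
    have hpow' : 1 ≤ (1 + k * L) ^ (n + 1) := one_le_pow₀ (by linarith)
    have hstep : e + k * ((L * e + η) + K)
        ≤ ((n + 1 : ℕ) : ℝ) * k * (1 + k * L) ^ (n + 1) * (η + K) := by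
      have : k * (η + K) ≤ k * (1 + k * L) ^ (n + 1) * (η + K) := by
        rw [mul_assoc]; gcongr; exact le_mul_of_one_le_left (by positivity) hpow'
      push_cast
      calc e + k * ((L * e + η) + K) = (1 + k * L) * e + k * (η + K) := by ring
        _ ≤ (1 + k * L) * e + k * (1 + k * L) ^ (n + 1) * (η + K) := by gcongr
        _ = _ := by rw [he]; ring
    have hmono : e ≤ ((n + 1 : ℕ) : ℝ) * k * (1 + k * L) ^ (n + 1) * (η + K) :=
      le_trans (le_add_of_nonneg_right (by positivity)) hstep
    constructor
    · refine le_trans (le_of_eq ?_) ((eLpNorm_add_le_ofReal (by fun_prop)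
        hstm he0 (by positivity) h1
        (hmul hst)).trans (ENNReal.ofReal_le_ofReal hstep))
      congr 1; ext1 x; simp only [eulerMap]; abel
    · refine le_trans (le_of_eq ?_) ((eLpNorm_add_le_ofReal (by fun_prop) (by fun_prop)
        (by positivity) (by positivity) h2 (hmul hsub)).trans (ENNReal.ofReal_le_ofReal ?_))
      · congr 1; ext1 x; simp only [eulerMap]; push_cast; module
      · calc n * k * (L * e + η) + k * (L * e + η)
            = ((n + 1 : ℕ) : ℝ) * k * (L * e + η) := by push_cast; ring
          _ ≤ _ := by gcongr

variable {δF : Measure (Euc d) → Euc d → ℝ} {τ : ℝ} {ρ : ℝ → Measure (Euc d)}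

/-- Uniform continuity in time of solutions. -/
theorem IsWGFSolution.uniformContinuous (hρ : IsWGFSolution δF τ ρ) {w : ℝ} (hw : 0 < w) :
    ∃ δ > 0, ∀ p ∈ Icc 0 τ, ∀ q ∈ Icc 0 τ, |p - q| < δ →
      W2 (ρ p) (ρ q) ≤ ENNReal.ofReal w := by
  have hloc : ∀ x : Icc 0 τ, ∃ r > 0, ∀ y ∈ Icc 0 τ, y ∈ Metric.ball (x : ℝ) r →
      W2 (ρ y) (ρ x) ≤ ENNReal.ofReal (w / 2) := by
    intro x
    have h := (hρ.continuous x x.2).eventually_le_const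
      (ENNReal.ofReal_pos.2 (half_pos hw))
    obtain ⟨r, hr, hr'⟩ := Metric.mem_nhdsWithin_iff.1 h
    exact ⟨r, hr, fun y hy hyr => hr' ⟨hyr, hy⟩⟩
  choose r hr hr' using hloc
  obtain ⟨δ, hδ, h⟩ := lebesgue_number_lemma_of_metric (isCompact_Icc (a := (0 : ℝ)) (b := τ))
    (c := fun x : Icc 0 τ => Metric.ball (x : ℝ) (r x)) (fun _ => Metric.isOpen_ball)
    (fun x hx => mem_iUnion.2 ⟨⟨x, hx⟩, Metric.mem_ball_self (hr _)⟩)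
  refine ⟨δ, hδ, fun p hp q hq hpq => ?_⟩
  obtain ⟨x, hx⟩ := h p hp
  have := (hρ.isDensity p hp).isProb
  have h1 := hr' x p hp (hx (Metric.mem_ball_self hδ))
  have h2 := hr' x q hq (hx (by rwa [Metric.mem_ball, Real.dist_eq, abs_sub_comm]))
  rw [W2_comm] at h2
  refine (W2_triangle _ (ρ x) _).trans ((add_le_add h1 h2).trans_eq ?_)
  rw [← ENNReal.ofReal_add (by positivity) (by positivity), add_halves]

theorem one_add_pow_le_exp {L k h : ℝ} (hk : 0 ≤ k) (hL : 0 ≤ L) {N : ℕ} (hN : N * k = h) :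
    (1 + k * L) ^ N ≤ Real.exp (L * h) := by
  calc (1 + k * L) ^ N ≤ (Real.exp (k * L)) ^ N := by
        refine pow_le_pow_left₀ (by positivity) ?_ N
        linarith [Real.add_one_le_exp (k * L)]
    _ = Real.exp (L * h) := by rw [← Real.exp_nat_mul, ← hN]; congr 1; ring

set_option maxHeartbeats 800000 in
/-- Over a short time interval the solution is, up to an arbitrarily small weak error, the image of
the initial density under a map that is close to the explicit Euler step in `L²`. -/
theorem IsWGFSolution.exists_approx_map (hg : IsLipField (fun μ => gradient (δF μ)) L)
    (hρ : IsWGFSolution δF τ ρ) {s h K w₀ ε₀ : ℝ} (hs : 0 ≤ s) (hh : 0 < h) (hh1 : h ≤ 1)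
    (hsh : s + h ≤ τ) (hK : 0 ≤ K) (hw₀ : 0 ≤ w₀) (hε₀ : 0 < ε₀)
    (hgK : ∀ p ∈ Icc s (s + h), eLpNorm (gradient (δF (ρ p))) 2 (ρ p) ≤ ENNReal.ofReal K)
    (hWw : ∀ p ∈ Icc s (s + h), W2 (ρ s) (ρ p) ≤ ENNReal.ofReal w₀) {ε₁ : ℝ} (hε₁ : 0 < ε₁) :
    ∃ Z : Euc d → Euc d, Measurable Z ∧
      eLpNorm (fun x => x - h • gradient (δF (ρ s)) x - Z x) 2 (ρ s)
        ≤ ENNReal.ofReal (h * (L * (h * Real.exp L * (ε₀ + 2 * L * w₀ + K)) + ε₀ + 2 * L * w₀)) ∧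
      ∀ (φ : Euc d → ℝ) (A M : ℝ), 0 ≤ A → 0 ≤ M → IsTest φ A M →
        |∫ x, φ x ∂(ρ (s + h)) - ∫ x, φ (Z x) ∂(ρ s)| ≤ ε₁ * (A + M) := by
  have hL := hg.nonneg
  -- `R` bounds `((1 + k * L) ^ 2) ^ N`, because `N * k = h ≤ 1`.
  set R := Real.exp (2 * L) with hR
  have hR0 : 0 < R := Real.exp_pos _
  set ε := min ε₀ (ε₁ / (4 * R)) with hε
  have hε0 : 0 < ε := lt_min hε₀ (by positivity)
  -- `B` serves all densities at once, so `w` and the substep can be chosen after it. The choices of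
  -- `ε`, `w` and `k₀` make each of the four weak errors `b1` to `b4` at most `ε₁ / 4`.
  obtain ⟨B, hB, hsm⟩ := hg.exists_smooth_approx hε0
  set w := ε₁ / (4 * R * (L + K * (1 + B) + 1)) with hw
  have hw0 : 0 < w := by positivity
  set k₀ := ε₁ / (4 * R * ((K + ε) ^ 2 * (1 + B) + 1)) with hk₀
  have hk₀0 : 0 < k₀ := by positivity
  obtain ⟨δ, hδ, hunif⟩ := hρ.uniformContinuous hw0
  -- The three caps bound the quadratic error, keep consecutive times within the modulus `δ`, and
  -- ensure `k * L < 1`.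
  set κ := min k₀ (min (δ / 2) (1 / (2 * (L + 1)))) with hκ
  have hκ0 : 0 < κ := lt_min hk₀0 (lt_min (half_pos hδ) (by positivity))
  obtain ⟨N, hN⟩ := exists_nat_gt (h / κ)
  have hNpos : (0 : ℝ) < N := lt_trans (by positivity) hN
  set k := h / N with hk
  have hk0 : 0 < k := by positivity
  have hNk : N * k = h := by rw [hk]; field_simp
  have hkκ : k ≤ κ := by
    rw [hk, div_le_iff₀ hNpos]
    rw [div_lt_iff₀ hκ0] at hN
    linarith
  have hkk₀ : k ≤ k₀ := hkκ.trans (min_le_left _ _)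
  have hkδ : k ≤ δ / 2 := hkκ.trans ((min_le_right _ _).trans (min_le_left _ _))
  have hkL' : k ≤ 1 / (2 * (L + 1)) := hkκ.trans ((min_le_right _ _).trans (min_le_right _ _))
  have hkL : k * L < 1 := by
    rw [le_div_iff₀ (by positivity)] at hkL'
    nlinarith
  have hmemI : ∀ n : ℕ, n ≤ N → s + n * k ∈ Icc s (s + h) := fun n hn => by
    have : (n : ℝ) * k ≤ N * k := by gcongr
    exact ⟨by have := hk0.le; linarith [show (0 : ℝ) ≤ n * k by positivity], by linarith⟩
  have hsub : ∀ p ∈ Icc s (s + h), p ∈ Icc 0 τ := fun p hp =>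
    ⟨by linarith [hp.1], by linarith [hp.2]⟩
  have hsI : s ∈ Icc 0 τ := hsub s ⟨le_rfl, by linarith⟩
  have hds := hρ.isDensity s hsI
  have hex : ∀ n : ℕ, ∃ W : Euc d → Euc d, ContDiff ℝ ∞ W ∧
      (∀ x y, ‖W x - W y‖ ≤ L * ‖x - y‖) ∧
      (∀ x y, ‖fderiv ℝ W x - fderiv ℝ W y‖ ≤ B * ‖x - y‖) ∧
      (n < N → eLpNorm (fun x => W x - gradient (δF (ρ (s + n * k))) x) 2 (ρ (s + n * k))
        ≤ ENNReal.ofReal ε) := by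
    intro n
    by_cases hn : n < N
    · obtain ⟨W, h1, h2, h3, h4⟩ := hsm _ (hρ.isDensity _ (hsub _ (hmemI n hn.le)))
      exact ⟨W, h1, h2, h3, fun _ => h4⟩
    · refine ⟨fun _ => 0, contDiff_const, fun x y => ?_, fun x y => ?_, fun h => absurd h hn⟩
      · simp; positivity
      · simp; positivity
  choose W hWs hWL hWB hWε using hex
  have hWm : ∀ n, Measurable (W n) := fun n => (hWs n).continuous.measurable
  refine ⟨eulerMap k W N, measurable_eulerMap hWm N, ?_, fun φ A M hA hM hφ => ?_⟩
  · have hgK' := hgK s ⟨le_rfl, by linarith⟩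
    have hη : ∀ n < N, eLpNorm (fun x => W n x - gradient (δF (ρ s)) x) 2 (ρ s)
        ≤ ENNReal.ofReal (ε₀ + 2 * L * w₀) := by
      intro n hn
      -- `W n` approximates the field at the later time `s + n * k`; moving this back to `ρ s` costs
      -- `2 * L * w₀`.
      have h1 := hg.approx_transfer hds (hρ.isDensity _ (hsub _ (hmemI n hn.le))) (hWm n) (hWL n)
      refine h1.trans ?_
      rw [ENNReal.ofReal_add hε₀.le (by positivity), ENNReal.ofReal_mul (p := 2 * L) (by positivity)]
      refine add_le_add ((hWε n hn).trans (ENNReal.ofReal_le_ofReal (min_le_left _ _))) ?_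
      gcongr
      exact hWw _ (hmemI n hn.le)
    have h2 := (eulerMap_sub_le (hg.cont _ hds).measurable hL hk0.le hK (by positivity) hgK' hWm hWL
      hη N le_rfl).2
    rw [eLpNorm_two_sub_comm] at h2
    rw [hNk] at h2
    refine h2.trans (ENNReal.ofReal_le_ofReal ?_)
    have hp := one_add_pow_le_exp hk0.le hL hNk
    have hp' : (1 + k * L) ^ N ≤ Real.exp L := hp.trans (Real.exp_le_exp.2 (by nlinarith))
    rw [← add_assoc]
    gcongr
  · have h1 := hρ.euler_weak hg hk0.le hs hkL (N := N) (by rw [hNk]; exact hsh) hK hw0.le hε0.le hB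
      (by rwa [hNk]) (fun p hp q hq hpq => hunif p (hsub p (by rwa [hNk] at hp)) q
        (hsub q (by rwa [hNk] at hq)) (by linarith)) hWs hWL hWB hWε le_rfl φ A M hA hM hφ
    rw [hNk] at h1
    refine h1.trans ?_
    have hp : ((1 + k * L) ^ 2) ^ N ≤ R := by
      rw [← pow_mul, mul_comm 2 N, pow_mul]
      refine (pow_le_pow_left₀ (by positivity) (one_add_pow_le_exp hk0.le hL hNk) 2).trans ?_
      rw [hR, ← Real.exp_nat_mul]
      refine Real.exp_le_exp.2 ?_
      push_cast
      nlinarith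
    have aux : ∀ x y : ℝ, x ≤ y → 0 < y → R * (x * (ε₁ / (4 * R * y))) ≤ ε₁ / 4 := by
      intro x y hxy hy
      calc R * (x * (ε₁ / (4 * R * y))) ≤ R * (y * (ε₁ / (4 * R * y))) := by gcongr
        _ = ε₁ / 4 := by field_simp
    have hKB : 0 ≤ K * (1 + B) := by positivity
    have b1 : R * (L * w) ≤ ε₁ / 4 := aux _ _ (by linarith) (by positivity)
    have b2 : R * (K * w) * (1 + B) ≤ ε₁ / 4 := by
      rw [show R * (K * w) * (1 + B) = R * (K * (1 + B) * w) by ring]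
      exact aux _ _ (by linarith) (by positivity)
    have b3 : R * ε ≤ ε₁ / 4 := by
      calc R * ε ≤ R * (ε₁ / (4 * R)) := by gcongr; exact min_le_right _ _
        _ = ε₁ / 4 := by field_simp
    have b4 : R * (k * (K + ε) ^ 2) * (1 + B) ≤ ε₁ / 4 := by
      calc R * (k * (K + ε) ^ 2) * (1 + B) ≤ R * (k₀ * (K + ε) ^ 2) * (1 + B) := by gcongr
        _ ≤ ε₁ / 4 := by
          rw [show R * (k₀ * (K + ε) ^ 2) * (1 + B) = R * ((K + ε) ^ 2 * (1 + B) * k₀) by ring]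
          exact aux _ _ (by linarith) (by positivity)
    have hhBA : h * B * A ≤ B * A := by
      rw [mul_assoc]; exact mul_le_of_le_one_left (by positivity) hh1
    calc h * ((1 + k * L) ^ 2) ^ N * ((L * w + ε) * A
          + (K * w + k * (K + ε) ^ 2) * (M + h * B * A))
        ≤ 1 * R * ((L * w + ε) * A + (K * w + k * (K + ε) ^ 2) * ((1 + B) * (A + M))) := by
          gcongr
          nlinarith [mul_nonneg hB hM]
      _ = (R * (L * w) + R * ε) * A
          + (R * (K * w) * (1 + B) + R * (k * (K + ε) ^ 2) * (1 + B)) * (A + M) := by ring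
      _ ≤ (ε₁ / 4 + ε₁ / 4) * A + (ε₁ / 4 + ε₁ / 4) * (A + M) := by gcongr
      _ ≤ ε₁ * (A + M) := by nlinarith [mul_nonneg hε₁.le hM]

/-- Solutions are differentiable in time along their velocity: the explicit Euler step has an error
of smaller order than the step size in the Wasserstein distance. -/
theorem IsWGFSolution.W2_euler_step_le (hg : IsLipField (fun μ => gradient (δF μ)) L)
    (hρ : IsWGFSolution δF τ ρ) {s : ℝ} (hs : s ∈ Ico 0 τ) {ε : ℝ} (hε : 0 < ε) :
    ∃ δ > 0, s + δ ≤ τ ∧ ∀ h, 0 < h → h < δ →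
      W2 ((ρ s).map fun x => x - h • gradient (δF (ρ s)) x) (ρ (s + h))
        ≤ ENNReal.ofReal (ε * h) := by
  have hL := hg.nonneg
  have hsI : s ∈ Icc 0 τ := ⟨hs.1, hs.2.le⟩
  have hds := hρ.isDensity s hsI
  have := hds.isProb
  have hgs := hg.memLp hds
  have hgm := (hg.cont _ hds).measurable
  set w₀ := ε / (8 * (L + 1)) with hw₀
  have hw₀0 : 0 < w₀ := by positivity
  have hLw : 2 * L * w₀ ≤ ε / 4 := by
    rw [hw₀, mul_div_assoc', div_le_div_iff₀ (by positivity) (by positivity)]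
    nlinarith
  obtain ⟨δ₁, hδ₁, hunif⟩ := hρ.uniformContinuous hw₀0
  set K₀ := (eLpNorm (gradient (δF (ρ s))) 2 (ρ s)).toReal with hK₀
  have hK₀0 : 0 ≤ K₀ := ENNReal.toReal_nonneg
  have hK₀e : eLpNorm (gradient (δF (ρ s))) 2 (ρ s) = ENNReal.ofReal K₀ :=
    (ENNReal.ofReal_toReal hgs.2.ne).symm
  -- The norm of the field at a nearby time exceeds that at `s` by at most `L` times the distance of
  -- the densities.
  set K := K₀ + L * w₀ with hK
  have hK0 : 0 ≤ K := by positivity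
  set c := L * Real.exp L * (ε + K) with hc
  have hc0 : 0 ≤ c := by positivity
  refine ⟨min (min δ₁ (τ - s)) (min 1 (ε / (4 * (c + 1)))), ?_, ?_, fun h hh hhδ => ?_⟩
  · have : 0 < τ - s := by linarith [hs.2]
    positivity
  · have : min (min δ₁ (τ - s)) (min 1 (ε / (4 * (c + 1)))) ≤ τ - s :=
      (min_le_left _ _).trans (min_le_right _ _)
    linarith
  have hh1 : h < δ₁ := hhδ.trans_le ((min_le_left _ _).trans (min_le_left _ _))
  have hh2 : h < τ - s := hhδ.trans_le ((min_le_left _ _).trans (min_le_right _ _))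
  have hh3 : h < 1 := hhδ.trans_le ((min_le_right _ _).trans (min_le_left _ _))
  have hh4 : h < ε / (4 * (c + 1)) := hhδ.trans_le ((min_le_right _ _).trans (min_le_right _ _))
  have hWw : ∀ p ∈ Icc s (s + h), W2 (ρ s) (ρ p) ≤ ENNReal.ofReal w₀ := fun p hp =>
    hunif s hsI p ⟨by linarith [hp.1, hs.1], by linarith [hp.2]⟩
      (by rw [abs_sub_comm, abs_of_nonneg (by linarith [hp.1])]; linarith [hp.2])
  have hgK : ∀ p ∈ Icc s (s + h), eLpNorm (gradient (δF (ρ p))) 2 (ρ p)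
      ≤ ENNReal.ofReal K := by
    intro p hp
    have hdp := hρ.isDensity p ⟨by linarith [hp.1, hs.1], by linarith [hp.2]⟩
    have := hdp.isProb
    have hgp := (hg.cont _ hdp).measurable
    rw [hK, ENNReal.ofReal_add hK₀0 (by positivity), ENNReal.ofReal_mul hL]
    refine le_trans ?_ (add_le_add le_rfl (mul_le_mul_right (hWw p hp) _))
    rw [← tsub_le_iff_left]
    refine le_mul_W2 ENNReal.ofReal_ne_top fun π hπ => ?_
    rw [tsub_le_iff_left]
    have h1 := hg.eLpNorm_le measurable_fst measurable_snd hπ.1 hπ.2 hds hdp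
    rw [eLpNorm_two_sub_comm] at h1
    have e1 := eLpNorm_two_map (μ := π) measurable_snd (f := gradient (δF (ρ p))) (by fun_prop)
    have e2 := eLpNorm_two_map (μ := π) measurable_fst (f := gradient (δF (ρ s))) (by fun_prop)
    rw [hπ.2] at e1
    rw [hπ.1, hK₀e] at e2
    rw [e1, e2]
    have e3 : gradient (δF (ρ p)) ∘ Prod.snd = (gradient (δF (ρ s)) ∘ Prod.fst)
        + fun q : Euc d × Euc d => gradient (δF (ρ p)) q.2 - gradient (δF (ρ s)) q.1 := by
      ext1 q; simp
    rw [e3]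
    exact (eLpNorm_add_le (hgm.comp measurable_fst).aestronglyMeasurable (by fun_prop)
      (by norm_num)).trans (add_le_add le_rfl h1)
  -- The weak error is sent to zero at fixed `h`, while the $L^2$ bound `ε * h` is the same for all
  -- `m`; this is the input for lower semicontinuity.
  have hex : ∀ m : ℕ, ∃ Z : Euc d → Euc d, Measurable Z ∧
      eLpNorm (fun x => x - h • gradient (δF (ρ s)) x - Z x) 2 (ρ s) ≤ ENNReal.ofReal (ε * h) ∧
      ∀ (φ : Euc d → ℝ) (A M : ℝ), 0 ≤ A → 0 ≤ M → IsTest φ A M →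
        |∫ x, φ x ∂(ρ (s + h)) - ∫ x, φ (Z x) ∂(ρ s)| ≤ 1 / ((m : ℝ) + 1) * (A + M) := by
    intro m
    obtain ⟨Z, h1, h2, h3⟩ := hρ.exists_approx_map hg (ε₀ := ε / 4) (ε₁ := 1 / ((m : ℝ) + 1)) hs.1 hh
      hh3.le (by linarith) hK0 hw₀0.le (by positivity) hgK hWw (by positivity)
    refine ⟨Z, h1, h2.trans (ENNReal.ofReal_le_ofReal ?_), h3⟩
    rw [mul_comm ε h]
    refine mul_le_mul_of_nonneg_left ?_ hh.le
    have hhc : h * c ≤ ε / 4 := by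
      rw [lt_div_iff₀ (by positivity)] at hh4
      nlinarith
    calc L * (h * Real.exp L * (ε / 4 + 2 * L * w₀ + K)) + ε / 4 + 2 * L * w₀
        ≤ L * (h * Real.exp L * (ε / 4 + ε / 4 + K)) + ε / 4 + ε / 4 := by gcongr
      _ ≤ L * (h * Real.exp L * (ε + K)) + ε / 4 + ε / 4 := by gcongr; linarith
      _ = h * c + ε / 4 + ε / 4 := by rw [hc]; ring
      _ ≤ ε := by linarith
  choose Z hZm hZ2 hZφ using hex
  have hdh := hρ.isDensity (s + h) ⟨by linarith [hs.1], by linarith⟩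
  have := hdh.isProb
  refine W2_le_of_tendsto (by fun_prop) (hds.memLp_id.sub (hgs.const_smul h)) hZm
    ENNReal.ofReal_ne_top hZ2 fun φ hφ hφc => ?_
  obtain ⟨A, M, hA, hM, hφT⟩ := exists_isTest hφ hφc
  rw [tendsto_iff_dist_tendsto_zero]
  refine squeeze_zero (fun _ => dist_nonneg) (fun m => ?_)
    (by simpa using tendsto_one_div_add_atTop_nhds_zero_nat.mul_const (A + M))
  rw [dist_comm, Real.dist_eq, ← one_div]
  exact hZφ m φ A M hA hM hφT

end Crux

/-! ### The energy along segments of densities and along couplings. -/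

section Energy

variable {d : ℕ}

theorem mix_mix_right (a b : Measure (Euc d)) {u ε : ℝ} (hu0 : 0 ≤ u) (hε0 : 0 ≤ ε)
    (hε1 : ε ≤ 1) : mix (mix a b u) b ε = mix a b (u + ε * (1 - u)) := by
  have h1 : 1 - (u + ε * (1 - u)) = (1 - ε) * (1 - u) := by ring
  have h2 : u + ε * (1 - u) = (1 - ε) * u + ε := by ring
  rw [mix, mix, mix, h1, h2, ENNReal.ofReal_mul (by linarith),
    ENNReal.ofReal_add (mul_nonneg (by linarith) hu0) hε0, ENNReal.ofReal_mul (by linarith),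
    smul_add, smul_smul, smul_smul, add_assoc, add_smul]

theorem mix_symm (a b : Measure (Euc d)) (u : ℝ) : mix a b u = mix b a (1 - u) := by
  rw [mix, mix, add_comm, sub_sub_cancel]

theorem mix_mix_left (a b : Measure (Euc d)) {u ε : ℝ} (hu1 : u ≤ 1) (hε0 : 0 ≤ ε)
    (hε1 : ε ≤ 1) : mix (mix a b u) a ε = mix a b (u * (1 - ε)) := by
  rw [mix_symm a b, mix_mix_right b a (by linarith) hε0 hε1, mix_symm b a]
  congr 1
  ring

/-- Regularizing both endpoints with `κ` regularizes the whole segment, so every density on it has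
full support when `κ` does and `ε` is positive. -/
theorem mix_mix_mix (μ ν κ : Measure (Euc d)) {u ε : ℝ} (hu0 : 0 ≤ u) (hu1 : u ≤ 1) :
    mix (mix μ κ ε) (mix ν κ ε) u = mix (mix μ ν u) κ ε := by
  have h : ENNReal.ofReal (1 - u) + ENNReal.ofReal u = 1 := by
    rw [← ENNReal.ofReal_add (by linarith) hu0]; simp
  ext s hs
  simp only [mix, Measure.add_apply, Measure.smul_apply, smul_eq_mul]
  calc _ = ENNReal.ofReal (1 - ε) * (ENNReal.ofReal (1 - u) * μ s + ENNReal.ofReal u * ν s)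
        + (ENNReal.ofReal (1 - u) + ENNReal.ofReal u) * (ENNReal.ofReal ε * κ s) := by ring
    _ = _ := by rw [h, one_mul]

theorem integral_mix {f : Euc d → ℝ} {μ ν : Measure (Euc d)} (hμ : Integrable f μ)
    (hν : Integrable f ν) {u : ℝ} (hu0 : 0 ≤ u) (hu1 : u ≤ 1) :
    ∫ x, f x ∂(mix μ ν u) = (1 - u) * ∫ x, f x ∂μ + u * ∫ x, f x ∂ν := by
  rw [mix, integral_add_measure (hμ.smul_measure ENNReal.ofReal_ne_top)
    (hν.smul_measure ENNReal.ofReal_ne_top), integral_smul_measure, integral_smul_measure,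
    ENNReal.toReal_ofReal (by linarith), ENNReal.toReal_ofReal hu0, smul_eq_mul, smul_eq_mul]

variable {F : Measure (Euc d) → ℝ} {δF : Measure (Euc d) → Euc d → ℝ}

theorem HasFirstVariation.integrable (h : HasFirstVariation F δF) {m μ : Measure (Euc d)}
    (hm : IsDensity m) (hμ : IsDensity μ) : Integrable (δF m) μ :=
  ((h m hm).1 μ hμ).1

/-- Along the segment between two densities the energy is differentiable. -/
theorem HasFirstVariation.hasDerivWithinAt_mix (h : HasFirstVariation F δF) {a b : Measure (Euc d)}
    (ha : IsDensity a) (hb : IsDensity b) {u : ℝ} (hu : u ∈ Icc (0 : ℝ) 1) :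
    HasDerivWithinAt (fun v => F (mix a b v))
      (∫ x, δF (mix a b u) x ∂b - ∫ x, δF (mix a b u) x ∂a) (Icc 0 1) u := by
  have hm := ha.mix hb hu.1 hu.2
  have ia := h.integrable hm ha
  have ib := h.integrable hm hb
  have e := integral_mix ia ib hu.1 hu.2
  -- The first variation only differentiates at the start of a segment. From the mixture at `u`, the
  -- left part is the segment towards `a` and the right part the one towards `b`, both rescaled; `e`
  -- shows that the two slopes agree.
  rw [← Icc_union_Icc_eq_Icc hu.1 hu.2]
  refine HasDerivWithinAt.union ?_ ?_
  · rcases hu.1.eq_or_lt with h0 | h0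
    · rw [← h0, Icc_self]; exact hasDerivWithinAt_iff_hasFDerivWithinAt.2 HasFDerivWithinAt.singleton
    have h1 := ((h _ hm).1 a ha).2.2
    have hA : HasDerivWithinAt (fun v : ℝ => (u - v) / u) (-1 / u) (Icc 0 u) u :=
      (((hasDerivAt_id u).const_sub u).div_const u).hasDerivWithinAt
    have hz : (u - u) / u = 0 := by simp
    have hcomp := HasDerivWithinAt.scomp (t' := Icc 0 1) u (by rw [hz]; exact h1) hA
      (fun v hv => ⟨div_nonneg (by linarith [hv.2]) h0.le, by
        rw [div_le_one h0]; linarith [hv.1]⟩)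
    refine (hcomp.congr_deriv ?_).congr (fun v hv => ?_) ?_
    · rw [e, smul_eq_mul]; field_simp; ring
    · simp only [Function.comp_apply]
      rw [mix_mix_left a b hu.2 (div_nonneg (by linarith [hv.2]) h0.le) (by
        rw [div_le_one h0]; linarith [hv.1])]
      congr 2; field_simp; ring
    · simp only [Function.comp_apply]
      rw [hz]; simp [mix]
  · rcases hu.2.eq_or_lt with h0 | h0
    · rw [h0, Icc_self]; exact hasDerivWithinAt_iff_hasFDerivWithinAt.2 HasFDerivWithinAt.singleton
    have h0' : 0 < 1 - u := by linarith
    have h1 := ((h _ hm).1 b hb).2.2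
    have hA : HasDerivWithinAt (fun v : ℝ => (v - u) / (1 - u)) (1 / (1 - u)) (Icc u 1) u :=
      (((hasDerivAt_id u).sub_const u).div_const (1 - u)).hasDerivWithinAt
    have hz : (u - u) / (1 - u) = 0 := by simp
    have hcomp := HasDerivWithinAt.scomp (t' := Icc 0 1) u (by rw [hz]; exact h1) hA
      (fun v hv => ⟨div_nonneg (by linarith [hv.1]) h0'.le, by
        rw [div_le_one h0']; linarith [hv.2]⟩)
    refine (hcomp.congr_deriv ?_).congr (fun v hv => ?_) ?_
    · rw [e, smul_eq_mul]; field_simp; ring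
    · simp only [Function.comp_apply]
      rw [mix_mix_right a b hu.1 (div_nonneg (by linarith [hv.1]) h0'.le) (by
        rw [div_le_one h0']; linarith [hv.2])]
      congr 2; field_simp; ring
    · simp only [Function.comp_apply]
      rw [hz]; simp [mix]

/-- Mean value theorem for the energy along a segment of densities. -/
theorem HasFirstVariation.exists_mean_value (h : HasFirstVariation F δF) {a b : Measure (Euc d)}
    (ha : IsDensity a) (hb : IsDensity b) : ∃ u ∈ Ioo (0 : ℝ) 1,
      F b - F a = ∫ x, δF (mix a b u) x ∂b - ∫ x, δF (mix a b u) x ∂a := by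
  have hd := fun u (hu : u ∈ Icc (0 : ℝ) 1) => h.hasDerivWithinAt_mix ha hb hu
  obtain ⟨u, hu, he⟩ := exists_hasDerivAt_eq_slope (fun v => F (mix a b v))
    (fun u => ∫ x, δF (mix a b u) x ∂b - ∫ x, δF (mix a b u) x ∂a) zero_lt_one
    (fun u hu => (hd u hu).continuousWithinAt)
    (fun u hu => (hd u ⟨hu.1.le, hu.2.le⟩).hasDerivAt (Icc_mem_nhds hu.1 hu.2))
  refine ⟨u, hu, ?_⟩
  rw [he]
  simp [mix]

theorem HasFirstVariation.tendsto_mix (h : HasFirstVariation F δF) {a b : Measure (Euc d)}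
    (ha : IsDensity a) (hb : IsDensity b) :
    Tendsto (fun ε => F (mix a b ε)) (𝓝[>] 0) (𝓝 (F a)) := by
  have h1 := (h.hasDerivWithinAt_mix ha hb (u := 0) ⟨le_rfl, zero_le_one⟩).continuousWithinAt
  have h2 : Tendsto (fun ε => F (mix a b ε)) (𝓝[Icc 0 1] 0) (𝓝 (F (mix a b 0))) := h1
  have h3 : mix a b 0 = a := by simp [mix]
  rw [h3] at h2
  exact h2.mono_left (by
    rw [← nhdsWithin_Ioo_eq_nhdsGT (zero_lt_one (α := ℝ))]
    exact nhdsWithin_mono _ Ioo_subset_Icc_self)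

variable {L : ℝ}

theorem integrable_inner_of_memLp {Ω : Type*} [MeasurableSpace Ω] {γ : Measure Ω}
    {X Y : Ω → Euc d} (hX : MemLp X 2 γ) (hY : MemLp Y 2 γ) :
    Integrable (fun x => inner ℝ (X x) (Y x)) γ :=
  (hX.norm.integrable_mul hY.norm).mono' (hX.1.inner hY.1)
    (Eventually.of_forall fun _ => norm_inner_le_norm _ _)

/-- Second order Taylor estimate for the energy along a coupling. -/
theorem HasFirstVariation.energy_taylor (h : HasFirstVariation F δF)
    (hg : IsLipField (fun μ => gradient (δF μ)) L) {Ω : Type*} [MeasurableSpace Ω]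
    {γ : Measure Ω} {X Y : Ω → Euc d} (hX : Measurable X) (hY : Measurable Y)
    {μ ν : Measure (Euc d)} (hXμ : γ.map X = μ) (hYν : γ.map Y = ν) (hμ : IsDensity μ)
    (hν : IsDensity ν) {e : ℝ} (he0 : 0 ≤ e)
    (he : eLpNorm (fun x => Y x - X x) 2 γ ≤ ENNReal.ofReal e) :
    |F ν - F μ - ∫ x, inner ℝ (gradient (δF μ) (X x)) (Y x - X x) ∂γ| ≤ 3 * L * e ^ 2 := by
  have hL := hg.nonneg
  obtain ⟨κ, hκ, hκo⟩ := exists_isDensity_isOpenPosMeasure d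
  have := hμ.isProb
  have := hν.isProb
  have := hκ.isProb
  set D := (W2 μ κ).toReal with hD
  have hDe : W2 μ κ = ENNReal.ofReal D := (ENNReal.ofReal_toReal (hμ.W2_lt_top hκ).ne).symm
  have hD0 : 0 ≤ D := ENNReal.toReal_nonneg
  have hXm : MemLp X 2 γ := memLp_comp_of_map_eq hX hXμ hμ.memLp_id
  have hYm : MemLp Y 2 γ := memLp_comp_of_map_eq hY hYν hν.memLp_id
  have hYX : MemLp (fun x => Y x - X x) 2 γ := hYm.sub hXm
  have hWe : W2 μ ν ≤ ENNReal.ofReal e := by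
    rw [← hXμ, ← hYν]
    refine (W2_map_le hX hY).trans ?_
    rwa [eLpNorm_two_sub_comm]
  set I := ∫ x, inner ℝ (gradient (δF μ) (X x)) (Y x - X x) ∂γ with hI
  have hgμX : MemLp (fun x => gradient (δF μ) (X x)) 2 γ :=
    memLp_comp_of_map_eq hX hXμ (hg.memLp hμ)
  -- The expansion is proved for the mixtures with `κ`, where the spatial gradient is Lipschitz, and
  -- `ε` tends to 0 at the end. The bound then becomes `L * e ^ 2 + 2 * L * e ^ 2`.
  have key : ∀ ε ∈ Ioo (0 : ℝ) 1, |F (mix ν κ ε) - F (mix μ κ ε) - (1 - ε) * I|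
      ≤ L * e ^ 2 + 2 * L * (e + √ε * (e + D)) * e := by
    intro ε hε
    have ha := hμ.mix hκ hε.1.le hε.2.le
    have hb := hν.mix hκ hε.1.le hε.2.le
    obtain ⟨u, hu, hmv⟩ := h.exists_mean_value ha hb
    rw [mix_mix_mix μ ν κ hu.1.le hu.2.le] at hmv
    have hmu := hμ.mix hν hu.1.le hu.2.le
    have := hmu.isProb
    set m := mix (mix μ ν u) κ ε with hm
    have hmd : IsDensity m := hmu.mix hκ hε.1.le hε.2.le
    have : m.IsOpenPosMeasure := isOpenPosMeasure_mix hε.1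
    -- The contributions of `κ` cancel in the difference, leaving the factor `1 - ε`.
    rw [integral_mix (h.integrable hmd hν) (h.integrable hmd hκ) hε.1.le hε.2.le,
      integral_mix (h.integrable hmd hμ) (h.integrable hmd hκ) hε.1.le hε.2.le] at hmv
    have hC1 : ContDiff ℝ 1 (δF m) := (h m hmd).2
    have hW1 : W2 μ (mix μ ν u) ≤ ENNReal.ofReal e := by
      refine (W2_mix_le hu.1.le hu.2.le).trans ?_
      refine (mul_le_mul_left (b := ENNReal.ofReal √u) (c := 1) ?_ (W2 μ ν)).trans
        (by rwa [one_mul])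
      rw [ENNReal.ofReal_le_one, Real.sqrt_le_one]
      exact hu.2.le
    have hW2 : W2 μ m ≤ ENNReal.ofReal (e + √ε * (e + D)) := by
      rw [ENNReal.ofReal_add he0 (by positivity), ENNReal.ofReal_mul (Real.sqrt_nonneg _),
        ENNReal.ofReal_add he0 hD0]
      refine (W2_triangle μ (mix μ ν u) m).trans (add_le_add hW1 ?_)
      refine (W2_mix_le hε.1.le hε.2.le).trans ?_
      gcongr
      refine (W2_triangle _ μ _).trans (add_le_add ?_ hDe.le)
      rwa [W2_comm]
    have hgm : MemLp (fun x => gradient (δF m) (X x) - gradient (δF μ) (X x)) 2 γ ∧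
        eLpNorm (fun x => gradient (δF m) (X x) - gradient (δF μ) (X x)) 2 γ
          ≤ ENNReal.ofReal (2 * L * (e + √ε * (e + D))) := by
      have c1 := (hg.cont m hmd).measurable
      have c2 := (hg.cont μ hμ).measurable
      have h1 := hg.eLpNorm_sub_le hμ hmd
      have h2 := eLpNorm_two_map (μ := γ) hX
        (f := fun x => gradient (δF m) x - gradient (δF μ) x) (by fun_prop)
      rw [hXμ] at h2
      have h3 : eLpNorm (fun x => gradient (δF m) (X x) - gradient (δF μ) (X x)) 2 γ
          ≤ ENNReal.ofReal (2 * L * (e + √ε * (e + D))) := by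
        rw [ENNReal.ofReal_mul (by positivity)]
        refine (h2.symm.le.trans h1).trans ?_
        gcongr
      exact ⟨⟨by fun_prop, h3.trans_lt ENNReal.ofReal_lt_top⟩, h3⟩
    have hgmX : MemLp (fun x => gradient (δF m) (X x)) 2 γ := by
      refine (hgm.1.add hgμX).congr_norm ((hg.cont m hmd).measurable.comp hX).aestronglyMeasurable
        (Eventually.of_forall fun x => by simp)
    have iX : Integrable (fun x => δF m (X x)) γ := by
      have := h.integrable hmd hμ
      rw [← hXμ] at this
      exact this.comp_measurable hX
    have iY : Integrable (fun x => δF m (Y x)) γ := by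
      have := h.integrable hmd hν
      rw [← hYν] at this
      exact this.comp_measurable hY
    have i1 : Integrable (fun x => inner ℝ (gradient (δF m) (X x)) (Y x - X x)) γ :=
      integrable_inner_of_memLp hgmX hYX
    have i2 : Integrable (fun x => inner ℝ (gradient (δF μ) (X x)) (Y x - X x)) γ :=
      integrable_inner_of_memLp hgμX hYX
    have eX : ∫ x, δF m x ∂μ = ∫ x, δF m (X x) ∂γ := by
      conv_lhs => rw [← hXμ]
      exact integral_map hX.aemeasurable hC1.continuous.aestronglyMeasurable
    have eY : ∫ x, δF m x ∂ν = ∫ x, δF m (Y x) ∂γ := by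
      conv_lhs => rw [← hYν]
      exact integral_map hY.aemeasurable hC1.continuous.aestronglyMeasurable
    have b1 : |(∫ x, δF m x ∂ν - ∫ x, δF m x ∂μ)
        - ∫ x, inner ℝ (gradient (δF m) (X x)) (Y x - X x) ∂γ| ≤ L * e ^ 2 := by
      rw [eX, eY, ← integral_sub iY iX, ← integral_sub (by exact iY.sub iX) i1, ← Real.norm_eq_abs]
      have i3 : Integrable (fun x => ‖Y x - X x‖ ^ 2) γ := hYX.integrable_norm_pow two_ne_zero
      calc _ ≤ ∫ x, L * ‖Y x - X x‖ ^ 2 ∂γ := by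
            refine norm_integral_le_of_norm_le (i3.const_mul L) (Eventually.of_forall fun x => ?_)
            rw [inner_gradient_eq]
            refine norm_taylor_le hL (hC1.differentiable one_ne_zero) (fun x y => ?_) _ _
            rw [norm_fderiv_sub_eq]
            exact hg.norm_sub_le hmd x y
        _ ≤ _ := by
            rw [integral_const_mul]
            gcongr
            exact integral_norm_sq_le hYX he0 he
    have b2 : |∫ x, inner ℝ (gradient (δF m) (X x)) (Y x - X x) ∂γ - I|
        ≤ 2 * L * (e + √ε * (e + D)) * e := by
      rw [hI, ← integral_sub i1 i2, ← Real.norm_eq_abs]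
      calc _ ≤ ∫ x, ‖gradient (δF m) (X x) - gradient (δF μ) (X x)‖ * ‖Y x - X x‖ ∂γ := by
            refine norm_integral_le_of_norm_le (hgm.1.norm.integrable_mul hYX.norm)
              (Eventually.of_forall fun x => ?_)
            rw [← inner_sub_left]
            exact norm_inner_le_norm _ _
        _ ≤ _ := integral_norm_mul_norm_le hgm.1 hYX (by positivity) he0 hgm.2 he
    set J := ∫ x, inner ℝ (gradient (δF m) (X x)) (Y x - X x) ∂γ
    set P := ∫ x, δF m x ∂ν - ∫ x, δF m x ∂μ
    have e1 : F (mix ν κ ε) - F (mix μ κ ε) - (1 - ε) * I = (1 - ε) * ((P - J) + (J - I)) := by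
      rw [hmv]; ring
    rw [e1, abs_mul, abs_of_nonneg (by linarith [hε.2])]
    calc (1 - ε) * |(P - J) + (J - I)| ≤ 1 * (|P - J| + |J - I|) := by
          gcongr
          · linarith [hε.1]
          · exact abs_add_le _ _
      _ ≤ _ := by rw [one_mul]; exact add_le_add b1 b2
  have hl1 : Tendsto (fun ε : ℝ => |F (mix ν κ ε) - F (mix μ κ ε) - (1 - ε) * I|) (𝓝[>] 0)
      (𝓝 |F ν - F μ - (1 - 0) * I|) := by
    refine (((h.tendsto_mix hν hκ).sub (h.tendsto_mix hμ hκ)).sub ?_).abs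
    have : Continuous fun ε : ℝ => (1 - ε) * I := by fun_prop
    exact (this.tendsto 0).mono_left nhdsWithin_le_nhds
  have hl2 : Tendsto (fun ε : ℝ => L * e ^ 2 + 2 * L * (e + √ε * (e + D)) * e) (𝓝[>] 0)
      (𝓝 (L * e ^ 2 + 2 * L * (e + √0 * (e + D)) * e)) := by
    have : Continuous fun ε : ℝ => L * e ^ 2 + 2 * L * (e + √ε * (e + D)) * e := by fun_prop
    exact (this.tendsto 0).mono_left nhdsWithin_le_nhds
  have := le_of_tendsto_of_tendsto hl1 hl2 (by
    filter_upwards [Ioo_mem_nhdsGT (zero_lt_one (α := ℝ))] with ε hε using key ε hε)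
  rw [sub_zero, one_mul, Real.sqrt_zero, zero_mul, add_zero] at this
  linarith

end Energy

/-! ### Differentiability of the parameterized maps in $L^2$ and the chain rule. -/

section Param

variable {n d : ℕ} {lam : Measure (Euc d)} {Θ : Set (Euc n)} {T : Euc n → Euc d → Euc d}

theorem IsParamFamily.hasFDerivAt (hT : IsParamFamily lam Θ T) {θ : Euc n} (hθ : θ ∈ Θ)
    (z : Euc d) : HasFDerivAt (fun θ' => T θ' z) (dParam T θ z) θ :=
  (((hT.contDiffOn z).contDiffAt (hT.isOpen.mem_nhds hθ)).differentiableAt one_ne_zero).hasFDerivAt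

theorem IsParamFamily.continuousOn_dParam (hT : IsParamFamily lam Θ T) (z : Euc d) :
    ContinuousOn (fun θ => dParam T θ z) Θ :=
  (hT.contDiffOn z).continuousOn_fderiv_of_isOpen hT.isOpen le_rfl

/-- A directional derivative is a pointwise limit of measurable difference quotients; the shift by
`m₀` keeps the parameters inside the open set `Θ`. -/
theorem IsParamFamily.measurable_dParam_apply (hT : IsParamFamily lam Θ T) {θ : Euc n}
    (hθ : θ ∈ Θ) (v : Euc n) : Measurable fun z => dParam T θ z v := by
  have hlim : Tendsto (fun m : ℕ => θ + (1 / ((m : ℝ) + 1)) • v) atTop (𝓝 θ) := by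
    have := (tendsto_one_div_add_atTop_nhds_zero_nat (𝕜 := ℝ)).smul_const v
    simpa using this.const_add θ
  obtain ⟨m₀, hm₀⟩ := eventually_atTop.1 (hlim.eventually (hT.isOpen.mem_nhds hθ))
  refine measurable_of_tendsto_metrizable (f := fun m : ℕ => fun z =>
    (1 / (((m + m₀ : ℕ) : ℝ) + 1))⁻¹ • (T (θ + (1 / (((m + m₀ : ℕ) : ℝ) + 1)) • v) z - T θ z))
    (fun m => by
      have h1 := hT.measurable _ (hm₀ (m + m₀) (Nat.le_add_left _ _))
      have h2 := hT.measurable _ hθ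
      fun_prop) ?_
  rw [tendsto_pi_nhds]
  intro z
  have h := HasDerivAt.tendsto_slope_zero ((hT.hasFDerivAt hθ z).hasLineDerivAt v)
  have h1 : Tendsto (fun m : ℕ => 1 / ((m : ℝ) + 1)) atTop (𝓝[≠] 0) :=
    tendsto_nhdsWithin_iff.2 ⟨tendsto_one_div_add_atTop_nhds_zero_nat,
      Eventually.of_forall fun m => (Nat.one_div_pos_of_nat (α := ℝ)).ne'⟩
  refine ((h.comp h1).comp (tendsto_add_atTop_nat m₀)).congr fun m => ?_
  simp only [Function.comp_apply, zero_add, zero_smul, add_zero]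

/-- The parameterized maps are differentiable in the parameter as maps into `L²`. -/
theorem IsParamFamily.eventually_taylor [SFinite lam] (hT : IsParamFamily lam Θ T) {θ : Euc n}
    (hθ : θ ∈ Θ) {ε : ℝ} (hε : 0 < ε) : ∀ᶠ θ' in 𝓝 θ, θ' ∈ Θ ∧
      eLpNorm (fun z => T θ' z - T θ z - dParam T θ z (θ' - θ)) 2 lam
        ≤ ENNReal.ofReal (ε * ‖θ' - θ‖) := by
  have hev := ((hT.continuousL2 θ hθ).eventually_le_const
    (ENNReal.ofReal_pos.2 (pow_pos hε 2))).and (hT.isOpen.mem_nhds hθ)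
  obtain ⟨r, hr, hball⟩ := Metric.eventually_nhds_iff_ball.1 hev
  filter_upwards [Metric.ball_mem_nhds θ hr] with θ' hθ'
  refine ⟨(hball θ' hθ').2, ?_⟩
  set Δ := θ' - θ with hΔ
  -- Clamping to the unit interval makes `H` continuous in `u` on the whole line, so it is jointly
  -- measurable as a Carathéodory function.
  let c : ℝ → ℝ := fun u => max 0 (min 1 u)
  have hc : Continuous c := by fun_prop
  have hc0 : ∀ u, 0 ≤ c u := fun u => le_max_left _ _
  have hc1 : ∀ u, c u ≤ 1 := fun u => max_le zero_le_one (min_le_left _ _)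
  have hcu : ∀ u ∈ Icc (0 : ℝ) 1, c u = u := fun u hu => by
    simp [c, hu.1, hu.2]
  have hseg : ∀ u : ℝ, 0 ≤ u → u ≤ 1 → θ + u • Δ ∈ Metric.ball θ r := fun u h0 h1 => by
    rw [mem_ball_iff_norm, add_sub_cancel_left, norm_smul, Real.norm_of_nonneg h0]
    rw [mem_ball_iff_norm] at hθ'
    exact (mul_le_of_le_one_left (norm_nonneg _) h1).trans_lt hθ'
  have hsegΘ : ∀ u : ℝ, 0 ≤ u → u ≤ 1 → θ + u • Δ ∈ Θ := fun u h0 h1 => (hball _ (hseg u h0 h1)).2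
  set H : ℝ → Euc d → Euc d := fun u z => dParam T (θ + c u • Δ) z Δ - dParam T θ z Δ with hH
  have hHcont : ∀ z, Continuous fun u => H u z := fun z => by
    have h1 : Continuous fun u => dParam T (θ + c u • Δ) z :=
      (hT.continuousOn_dParam z).comp_continuous (by fun_prop)
        (fun u => hsegΘ _ (hc0 u) (hc1 u))
    fun_prop
  have hHmeas : ∀ u, Measurable (H u) := fun u =>
    (hT.measurable_dParam_apply (hsegΘ _ (hc0 u) (hc1 u)) Δ).sub
      (hT.measurable_dParam_apply hθ Δ)
  have hHj : Measurable (Function.uncurry H) :=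
    measurable_uncurry_of_continuous_of_measurable hHcont hHmeas
  have hftc : ∀ z, T θ' z - T θ z - dParam T θ z Δ = ∫ u in (0 : ℝ)..1, H u z := by
    intro z
    have hd : ∀ u ∈ uIcc (0 : ℝ) 1, HasDerivAt
        (fun u : ℝ => T (θ + u • Δ) z - u • dParam T θ z Δ) (H u z) u := by
      intro u hu
      rw [uIcc_of_le zero_le_one] at hu
      have h1 : HasDerivAt (fun u : ℝ => θ + u • Δ) Δ u := by
        simpa using ((hasDerivAt_id u).smul_const Δ).const_add θ
      have h2 := (hT.hasFDerivAt (hsegΘ u hu.1 hu.2) z).comp_hasDerivAt u h1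
      have h3 : HasDerivAt (fun u : ℝ => u • dParam T θ z Δ) (dParam T θ z Δ) u := by
        simpa using (hasDerivAt_id u).smul_const (dParam T θ z Δ)
      have h4 := h2.sub h3
      simp only [hH, hcu u hu]
      exact h4
    rw [intervalIntegral.integral_eq_sub_of_hasDerivAt hd ((hHcont z).intervalIntegrable _ _)]
    simp [hΔ]
    abel
  -- Cauchy–Schwarz on the unit interval; Tonelli then reduces the claim to $L^2$ continuity of the
  -- parameter derivative along the segment.
  have hpt : ∀ z, ‖T θ' z - T θ z - dParam T θ z Δ‖ₑ ^ 2
      ≤ ∫⁻ u in Ioc (0 : ℝ) 1, ‖H u z‖ₑ ^ 2 := by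
    intro z
    have : IsProbabilityMeasure ((volume : Measure ℝ).restrict (Ioc 0 1)) := ⟨by simp⟩
    rw [hftc z, intervalIntegral.integral_of_le zero_le_one, ← eLpNorm_two_sq]
    gcongr
    refine (enorm_integral_le_lintegral_enorm _).trans ?_
    rw [← eLpNorm_one_eq_lintegral_enorm]
    exact eLpNorm_le_eLpNorm_of_exponent_le (by norm_num) (hHcont z).aestronglyMeasurable
  rw [← ENNReal.pow_le_pow_left_iff two_ne_zero, eLpNorm_two_sq]
  calc ∫⁻ z, ‖T θ' z - T θ z - dParam T θ z Δ‖ₑ ^ 2 ∂lam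
      ≤ ∫⁻ z, (∫⁻ u in Ioc (0 : ℝ) 1, ‖H u z‖ₑ ^ 2) ∂lam := lintegral_mono hpt
    _ = ∫⁻ u in Ioc (0 : ℝ) 1, ∫⁻ z, ‖H u z‖ₑ ^ 2 ∂lam := by
        refine lintegral_lintegral_swap (f := fun z u => ‖H u z‖ₑ ^ 2) ?_
        exact ((hHj.comp measurable_swap).enorm.pow_const 2).aemeasurable
    _ ≤ ∫⁻ u in Ioc (0 : ℝ) 1, ENNReal.ofReal (ε * ‖Δ‖) ^ 2 := by
        refine lintegral_mono fun u => ?_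
        calc ∫⁻ z, ‖H u z‖ₑ ^ 2 ∂lam
            ≤ ∫⁻ z, ‖dParam T (θ + c u • Δ) z - dParam T θ z‖ₑ ^ 2 * ‖Δ‖ₑ ^ 2 ∂lam := by
              refine lintegral_mono fun z => ?_
              rw [← mul_pow]
              gcongr
              exact (dParam T (θ + c u • Δ) z - dParam T θ z).le_opENorm Δ
          _ = (∫⁻ z, ‖dParam T (θ + c u • Δ) z - dParam T θ z‖ₑ ^ 2 ∂lam) * ‖Δ‖ₑ ^ 2 :=
              lintegral_mul_const' _ _ (ENNReal.pow_ne_top enorm_ne_top)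
          _ ≤ ENNReal.ofReal (ε ^ 2) * ‖Δ‖ₑ ^ 2 := by
              gcongr
              exact (hball _ (hseg _ (hc0 u) (hc1 u))).1
          _ = ENNReal.ofReal (ε * ‖Δ‖) ^ 2 := by
              rw [ENNReal.ofReal_mul hε.le, mul_pow, ofReal_norm, ENNReal.ofReal_pow hε.le]
    _ = ENNReal.ofReal (ε * ‖Δ‖) ^ 2 := by simp

theorem IsParamFamily.memLp_apply (hT : IsParamFamily lam Θ T) {θ : Euc n} (hθ : θ ∈ Θ)
    (v : Euc n) : MemLp (fun z => dParam T θ z v) 2 lam := by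
  refine MemLp.of_le_mul (hT.memLp θ hθ) (hT.measurable_dParam_apply hθ v).aestronglyMeasurable
    (c := ‖v‖) (Eventually.of_forall fun z => ?_)
  rw [mul_comm]
  exact (dParam T θ z).le_opNorm v

theorem IsParamFamily.eLpNorm_apply_le (hT : IsParamFamily lam Θ T) {θ : Euc n} (hθ : θ ∈ Θ)
    (v : Euc n) : eLpNorm (fun z => dParam T θ z v) 2 lam
      ≤ ENNReal.ofReal ((eLpNorm (dParam T θ) 2 lam).toReal * ‖v‖) := by
  rw [ENNReal.ofReal_mul ENNReal.toReal_nonneg, ENNReal.ofReal_toReal (hT.memLp θ hθ).2.ne,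
    mul_comm]
  exact eLpNorm_le_mul_eLpNorm_of_ae_le_mul (Eventually.of_forall fun z => by
    rw [mul_comm]; exact (dParam T θ z).le_opNorm _) 2

/-- Local Lipschitz continuity of the parameterized maps in `L²`. -/
theorem IsParamFamily.eventually_lipschitz [SFinite lam] (hT : IsParamFamily lam Θ T) {θ : Euc n}
    (hθ : θ ∈ Θ) : ∃ c : ℝ, 0 ≤ c ∧ ∀ᶠ θ' in 𝓝 θ, θ' ∈ Θ ∧
      eLpNorm (fun z => T θ' z - T θ z) 2 lam ≤ ENNReal.ofReal (c * ‖θ' - θ‖) := by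
  refine ⟨1 + (eLpNorm (dParam T θ) 2 lam).toReal, by positivity, ?_⟩
  filter_upwards [hT.eventually_taylor hθ one_pos] with θ' hθ'
  refine ⟨hθ'.1, ?_⟩
  have h1 := hT.measurable θ hθ
  have h2 := hT.measurable θ' hθ'.1
  have h3 := hT.measurable_dParam_apply hθ (θ' - θ)
  refine le_trans (le_of_eq ?_) ((eLpNorm_add_le_ofReal (by fun_prop) (by fun_prop)
    (by positivity) (by positivity) hθ'.2 (hT.eLpNorm_apply_le hθ _)).trans_eq (by rw [add_mul]))
  congr 1; ext1 z; abel

variable {F : Measure (Euc d) → ℝ} {δF : Measure (Euc d) → Euc d → ℝ} {L : ℝ}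

/-- Chain rule for the energy along the parameterized family. -/
theorem IsParamFamily.inner_gradient_paramEnergy [SFinite lam] (hT : IsParamFamily lam Θ T)
    (h : HasFirstVariation F δF) (hg : IsLipField (fun μ => gradient (δF μ)) L) {θ : Euc n}
    (hθ : θ ∈ Θ) (hd : DifferentiableAt ℝ (paramEnergy F lam T) θ) (v : Euc n) :
    inner ℝ (gradient (paramEnergy F lam T) θ) v
      = ∫ z, inner ℝ (gradient (δF (lam.map (T θ))) (T θ z)) (dParam T θ z v) ∂lam := by
  have hL := hg.nonneg
  set G : Euc d → Euc d := fun z => gradient (δF (lam.map (T θ))) (T θ z) with hG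
  have hdθ := hT.isDensity θ hθ
  have hGm : MemLp G 2 lam := memLp_comp_of_map_eq (hT.measurable θ hθ) rfl (hg.memLp hdθ)
  set K := (eLpNorm G 2 lam).toReal with hK
  have hK0 : 0 ≤ K := ENNReal.toReal_nonneg
  have hKe : eLpNorm G 2 lam ≤ ENNReal.ofReal K := (ENNReal.ofReal_toReal hGm.2.ne).symm.le
  set I := ∫ z, inner ℝ (G z) (dParam T θ z v) ∂lam with hI
  obtain ⟨c, hc, hlip⟩ := hT.eventually_lipschitz hθ
  have hline : HasDerivAt (fun s : ℝ => θ + s • v) v 0 := by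
    simpa using ((hasDerivAt_id (0 : ℝ)).smul_const v).const_add θ
  have h0 : θ + (0 : ℝ) • v = θ := by simp
  have hlc : Tendsto (fun s : ℝ => θ + s • v) (𝓝 0) (𝓝 θ) := by
    have := hline.continuousAt.tendsto
    rwa [h0] at this
  have d1 : HasDerivAt (fun s : ℝ => paramEnergy F lam T (θ + s • v))
      (fderiv ℝ (paramEnergy F lam T) θ v) 0 := hd.hasFDerivAt.hasLineDerivAt v
  rw [inner_gradient_eq]
  -- The gradient is identified by a second computation of the derivative along the line: the energy
  -- expansion has a quadratic remainder, and the $L^2$ expansion of the maps handles the linear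
  -- term.
  refine d1.unique ?_
  rw [hasDerivAt_iff_isLittleO_nhds_zero, Asymptotics.isLittleO_iff]
  intro ε hε
  obtain ⟨ε₁, hε₁, hε₁'⟩ : ∃ ε₁ > 0, K * (ε₁ * ‖v‖) ≤ ε / 2 := by
    refine ⟨ε / (2 * (K * ‖v‖ + 1)), by positivity, ?_⟩
    rw [div_mul_eq_mul_div, mul_div_assoc', div_le_div_iff₀ (by positivity) two_pos]
    nlinarith [mul_nonneg hK0 (norm_nonneg v)]
  have hsmall : ∀ᶠ s : ℝ in 𝓝 0, 3 * L * (c * ‖v‖) ^ 2 * |s| ≤ ε / 2 := by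
    have : Continuous fun s : ℝ => 3 * L * (c * ‖v‖) ^ 2 * |s| := by fun_prop
    have := this.tendsto 0
    simp only [abs_zero, mul_zero] at this
    exact this.eventually_le_const (half_pos hε)
  filter_upwards [hlc.eventually (hT.eventually_taylor hθ hε₁), hlc.eventually hlip, hsmall]
    with s hs1 hs2 hs3
  obtain ⟨hsΘ, hs1⟩ := hs1
  obtain ⟨-, hs2⟩ := hs2
  have hmT := hT.measurable θ hθ
  have hmT' := hT.measurable _ hsΘ
  have hmD := hT.measurable_dParam_apply hθ v
  have hn : ‖θ + s • v - θ‖ = |s| * ‖v‖ := by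
    rw [add_sub_cancel_left, norm_smul, Real.norm_eq_abs]
  rw [hn] at hs1 hs2
  rw [add_sub_cancel_left] at hs1
  have hen := h.energy_taylor hg hmT hmT' rfl rfl hdθ (hT.isDensity _ hsΘ) (by positivity) hs2
  have hTT : MemLp (fun z => T (θ + s • v) z - T θ z) 2 lam :=
    ⟨by fun_prop, hs2.trans_lt ENNReal.ofReal_lt_top⟩
  have hTD : MemLp (fun z => T (θ + s • v) z - T θ z - dParam T θ z (s • v)) 2 lam :=
    hTT.sub (hT.memLp_apply hθ _)
  have i1 := integrable_inner_of_memLp hGm hTT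
  have i2 := integrable_inner_of_memLp hGm (hT.memLp_apply hθ v)
  have b2 : |∫ z, inner ℝ (G z) (T (θ + s • v) z - T θ z) ∂lam - s * I|
      ≤ K * (ε₁ * (|s| * ‖v‖)) := by
    rw [hI, ← integral_const_mul, ← integral_sub i1 (i2.const_mul s), ← Real.norm_eq_abs]
    calc _ ≤ ∫ z, ‖G z‖ * ‖T (θ + s • v) z - T θ z - dParam T θ z (s • v)‖ ∂lam := by
          refine norm_integral_le_of_norm_le (hGm.norm.integrable_mul hTD.norm)
            (Eventually.of_forall fun z => ?_)
          rw [← inner_smul_right, ← map_smul, ← inner_sub_right]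
          exact norm_inner_le_norm _ _
      _ ≤ _ := integral_norm_mul_norm_le hGm hTD hK0 (by positivity) hKe hs1
  have e0 : paramEnergy F lam T (θ + (0 + s) • v) - paramEnergy F lam T (θ + (0 : ℝ) • v) - s • I
      = (F (lam.map (T (θ + s • v))) - F (lam.map (T θ))
          - ∫ z, inner ℝ (G z) (T (θ + s • v) z - T θ z) ∂lam)
        + (∫ z, inner ℝ (G z) (T (θ + s • v) z - T θ z) ∂lam - s * I) := by
    simp only [paramEnergy, zero_add, h0, smul_eq_mul]; ring
  rw [e0]
  calc _ ≤ 3 * L * (c * (|s| * ‖v‖)) ^ 2 + K * (ε₁ * (|s| * ‖v‖)) :=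
        (norm_add_le _ _).trans (add_le_add hen b2)
    _ = (3 * L * (c * ‖v‖) ^ 2 * |s| + K * (ε₁ * ‖v‖)) * |s| := by ring
    _ ≤ (ε / 2 + ε / 2) * |s| := by gcongr
    _ = ε * ‖s‖ := by rw [add_halves, Real.norm_eq_abs]

end Param

/-! ### Normal equations and orthogonal projection. -/

section PseudoInverse

variable {n d : ℕ} {lam : Measure (Euc d)} {Θ : Set (Euc n)} {T : Euc n → Euc d → Euc d}

theorem metricTensor_transpose (lam : Measure (Euc d)) (T : Euc n → Euc d → Euc d) (θ : Euc n) :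
    (metricTensor lam T θ)ᵀ = metricTensor lam T θ := by
  ext i j
  simp only [metricTensor, Matrix.transpose_apply, Matrix.of_apply, real_inner_comm]

theorem IsParamFamily.inner_metricTensor (hT : IsParamFamily lam Θ T) {θ : Euc n} (hθ : θ ∈ Θ)
    (u v : Euc n) : inner ℝ (Matrix.toEuclideanLin (metricTensor lam T θ) u) v
      = ∫ z, inner ℝ (dParam T θ z u) (dParam T θ z v) ∂lam := by
  have hexp : ∀ (w : Euc n) (z : Euc d), dParam T θ z w
      = ∑ i, w i • dParam T θ z (EuclideanSpace.single i 1) := by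
    intro w z
    conv_lhs => rw [← (EuclideanSpace.basisFun (Fin n) ℝ).sum_repr w]
    simp
  have hint : ∀ i j, Integrable (fun z => inner ℝ (dParam T θ z (EuclideanSpace.single i 1))
      (dParam T θ z (EuclideanSpace.single j 1))) lam := fun i j =>
    integrable_inner_of_memLp (hT.memLp_apply hθ _) (hT.memLp_apply hθ _)
  simp_rw [hexp u, hexp v, sum_inner, inner_sum, real_inner_smul_left, real_inner_smul_right]
  rw [integral_finsetSum _ fun i _ => integrable_finsetSum _ fun j _ =>
    ((hint i j).const_mul _).const_mul _]
  simp_rw [integral_finsetSum _ fun j _ => ((hint _ j).const_mul (v j)).const_mul _,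
    integral_const_mul]
  rw [PiLp.inner_apply, Finset.sum_comm]
  refine Finset.sum_congr rfl fun i _ => ?_
  simp only [Matrix.toLpLin_apply, Matrix.mulVec, dotProduct, RCLike.inner_apply, conj_trivial,
    Finset.mul_sum]
  refine Finset.sum_congr rfl fun j _ => ?_
  rw [← congrFun₂ (metricTensor_transpose lam T θ) i j]
  simp only [metricTensor, Matrix.transpose_apply, Matrix.of_apply]
  ring

theorem inner_toEuclideanLin (M : Matrix (Fin n) (Fin n) ℝ) (x y : Euc n) :
    inner ℝ (Matrix.toEuclideanLin M x) y = inner ℝ x (Matrix.toEuclideanLin Mᵀ y) := by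
  rw [← Matrix.conjTranspose_eq_transpose_of_trivial, Matrix.toEuclideanLin_conjTranspose_eq_adjoint,
    LinearMap.adjoint_inner_right]

theorem toEuclideanLin_mul_apply (M N : Matrix (Fin n) (Fin n) ℝ) (x : Euc n) :
    Matrix.toEuclideanLin (M * N) x = Matrix.toEuclideanLin M (Matrix.toEuclideanLin N x) := by
  simp [Matrix.toLpLin_apply, Matrix.mulVec_mulVec]

/-- The pseudo-inverse of the metric tensor solves the normal equations. -/
theorem IsParamFamily.normal_equation (hT : IsParamFamily lam Θ T) {θ : Euc n} (hθ : θ ∈ Θ)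
    {P : Matrix (Fin n) (Fin n) ℝ} (hP : IsPseudoInverse (metricTensor lam T θ) P)
    {G : Euc d → Euc d} {b : Euc n}
    (hb : ∀ v, inner ℝ b v = ∫ z, inner ℝ (G z) (dParam T θ z v) ∂lam) :
    Matrix.toEuclideanLin (metricTensor lam T θ) (Matrix.toEuclideanLin P b) = b := by
  set A := metricTensor lam T θ with hA
  have hAt : Aᵀ = A := metricTensor_transpose lam T θ
  -- The Penrose equations put the residual `u` in the kernel of `A`. There `dParam T θ z u`
  -- vanishes almost everywhere, so `b` is orthogonal to `u`, and `u` is orthogonal to itself.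
  set u := b - Matrix.toEuclideanLin A (Matrix.toEuclideanLin P b) with hu
  have hAu : Matrix.toEuclideanLin A u = 0 := by
    refine ext_inner_right ℝ fun y => ?_
    rw [inner_toEuclideanLin, hAt, hu, inner_sub_left, ← toEuclideanLin_mul_apply,
      inner_toEuclideanLin (A * P), hP.symm_left, ← toEuclideanLin_mul_apply, hP.mul_mul_left,
      sub_self, inner_zero_left]
  have hDu : ∀ᵐ z ∂lam, dParam T θ z u = 0 := by
    have h1 := hT.inner_metricTensor hθ u u
    rw [← hA, hAu, inner_zero_left, eq_comm, integral_eq_zero_iff_of_nonneg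
      (fun z => real_inner_self_nonneg)
      (integrable_inner_of_memLp (hT.memLp_apply hθ u) (hT.memLp_apply hθ u))] at h1
    filter_upwards [h1] with z hz
    exact inner_self_eq_zero.1 hz
  have hbu : inner ℝ b u = 0 := by
    rw [hb, integral_eq_zero_of_ae]
    filter_upwards [hDu] with z hz
    simp [hz]
  have huu : inner ℝ u u = 0 := by
    nth_rewrite 1 [hu]
    rw [inner_sub_left, hbu, inner_toEuclideanLin, hAt, hAu, inner_zero_right, sub_zero]
  exact (sub_eq_zero.1 (inner_self_eq_zero.1 huu)).symm

variable {F : Measure (Euc d) → ℝ} {δF : Measure (Euc d) → Euc d → ℝ} {L : ℝ}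

/-- The velocity of the parameterized flow is the best approximation of the Wasserstein gradient
by the partial derivatives of the parameterized maps. -/
theorem IsParamFamily.eLpNorm_sq_le_projError [SFinite lam] (hT : IsParamFamily lam Θ T)
    (h : HasFirstVariation F δF) (hg : IsLipField (fun μ => gradient (δF μ)) L) {θ : Euc n}
    (hθ : θ ∈ Θ) (hd : DifferentiableAt ℝ (paramEnergy F lam T) θ)
    {P : Matrix (Fin n) (Fin n) ℝ} (hP : IsPseudoInverse (metricTensor lam T θ) P) :
    eLpNorm (fun z => gradient (δF (lam.map (T θ))) (T θ z) - dParam T θ z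
      (Matrix.toEuclideanLin P (gradient (paramEnergy F lam T) θ))) 2 lam ^ 2
      ≤ projError δF lam Θ T := by
  set b := gradient (paramEnergy F lam T) θ with hbdef
  set G : Euc d → Euc d := fun z => gradient (δF (lam.map (T θ))) (T θ z) with hG
  set ξ₀ := Matrix.toEuclideanLin P b with hξ₀
  have hb : ∀ v, inner ℝ b v = ∫ z, inner ℝ (G z) (dParam T θ z v) ∂lam :=
    hT.inner_gradient_paramEnergy h hg hθ hd
  have hGm : MemLp G 2 lam :=
    memLp_comp_of_map_eq (hT.measurable θ hθ) rfl (hg.memLp (hT.isDensity θ hθ))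
  have hne := hT.normal_equation hθ hP hb
  refine le_trans (le_iInf fun ξ => ?_) (le_iSup₂ (f := fun θ (_ : θ ∈ Θ) => ⨅ ξ : Euc n,
    ∫⁻ z, ‖gradient (δF (lam.map (T θ))) (T θ z) - dParam T θ z ξ‖ₑ ^ 2 ∂lam) θ hθ)
  rw [← eLpNorm_two_sq]
  have hm : ∀ ξ, MemLp (fun z => G z - dParam T θ z ξ) 2 lam :=
    fun ξ => hGm.sub (hT.memLp_apply hθ ξ)
  rw [← ofReal_integral_norm_sq (hm ξ₀), ← ofReal_integral_norm_sq (hm ξ)]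
  refine ENNReal.ofReal_le_ofReal ?_
  -- The normal equations say that the residual is orthogonal to all parameter derivatives;
  -- Pythagoras then gives minimality.
  have horth : ∫ z, inner ℝ (G z - dParam T θ z ξ₀) (dParam T θ z (ξ₀ - ξ)) ∂lam = 0 := by
    simp_rw [inner_sub_left]
    rw [integral_sub (integrable_inner_of_memLp hGm (hT.memLp_apply hθ _))
      (integrable_inner_of_memLp (hT.memLp_apply hθ _) (hT.memLp_apply hθ _)), ← hb,
      ← hT.inner_metricTensor hθ, hne, sub_self]
  have hi := integrable_inner_of_memLp (hm ξ₀) (hT.memLp_apply hθ (ξ₀ - ξ))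
  have hsq : ∀ {f : Euc d → Euc d}, MemLp f 2 lam → Integrable (fun z => ‖f z‖ ^ 2) lam :=
    fun hf => hf.integrable_norm_pow two_ne_zero
  have hpt : ∀ z, ‖G z - dParam T θ z ξ‖ ^ 2 = ‖G z - dParam T θ z ξ₀‖ ^ 2
      + 2 * inner ℝ (G z - dParam T θ z ξ₀) (dParam T θ z (ξ₀ - ξ))
      + ‖dParam T θ z (ξ₀ - ξ)‖ ^ 2 := by
    intro z
    rw [← norm_add_sq_real]
    congr 2
    rw [map_sub]; abel
  have hi' : Integrable (fun z => ‖G z - dParam T θ z ξ₀‖ ^ 2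
      + 2 * inner ℝ (G z - dParam T θ z ξ₀) (dParam T θ z (ξ₀ - ξ))) lam :=
    (hsq (hm ξ₀)).add (hi.const_mul 2)
  simp_rw [hpt]
  rw [integral_add hi' (hsq (hT.memLp_apply hθ _)),
    integral_add (hsq (hm ξ₀)) (hi.const_mul 2), integral_const_mul, horth]
  have : 0 ≤ ∫ z, ‖dParam T θ z (ξ₀ - ξ)‖ ^ 2 ∂lam := integral_nonneg fun z => by positivity
  linarith

end PseudoInverse

/-! ### One Euler step for both flows. -/

section Comparison

/-- Young's inequality on the cross term, then $|b-c|^2\le 2|b|^2+2|c|^2$. With `b` the projection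
error and `c` the field difference, this is the origin of $1+2C_{\mathcal F}$ and $2\delta_0$. -/
theorem norm_add_smul_sub_sq_le {E : Type*} [NormedAddCommGroup E] [InnerProductSpace ℝ E]
    (a b c : E) {h : ℝ} (hh : 0 ≤ h) : ‖a + h • (b - c)‖ ^ 2
      ≤ (1 + h) * ‖a‖ ^ 2 + (h + h ^ 2) * (2 * ‖b‖ ^ 2 + 2 * ‖c‖ ^ 2) := by
  have h1 : ‖a + h • (b - c)‖ ≤ ‖a‖ + h * ‖b - c‖ := (norm_add_le _ _).trans_eq (by
    rw [norm_smul, Real.norm_of_nonneg hh])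
  have h2 : ‖b - c‖ ≤ ‖b‖ + ‖c‖ := norm_sub_le _ _
  have h3 : ‖b - c‖ ^ 2 ≤ 2 * ‖b‖ ^ 2 + 2 * ‖c‖ ^ 2 := by
    nlinarith [sq_nonneg (‖b‖ - ‖c‖), norm_nonneg (b - c), norm_nonneg b, norm_nonneg c]
  calc ‖a + h • (b - c)‖ ^ 2 ≤ (‖a‖ + h * ‖b - c‖) ^ 2 := by gcongr
    _ ≤ (1 + h) * ‖a‖ ^ 2 + (h + h ^ 2) * ‖b - c‖ ^ 2 := by
      nlinarith [mul_nonneg hh (sq_nonneg (‖a‖ - ‖b - c‖))]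
    _ ≤ _ := by gcongr

variable {d : ℕ} {g : Measure (Euc d) → Euc d → Euc d} {L : ℝ}

/-- One explicit Euler step with the velocity `η` from the law of `S` and with the velocity
`-g ν` from `ν`. -/
theorem IsLipField.W2_sq_step_le (hg : IsLipField g L) {lam : Measure (Euc d)}
    [IsProbabilityMeasure lam] {S η : Euc d → Euc d} (hS : Measurable S) (hη : Measurable η)
    (hη2 : MemLp η 2 lam) {ν : Measure (Euc d)} (hμ : IsDensity (lam.map S)) (hν : IsDensity ν)
    {δ : ℝ} (hδ0 : 0 ≤ δ)
    (hδ : eLpNorm (fun z => g (lam.map S) (S z) + η z) 2 lam ^ 2 ≤ ENNReal.ofReal δ)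
    {h : ℝ} (hh : 0 ≤ h) :
    W2 (lam.map fun z => S z + h • η z) (ν.map fun x => x - h • g ν x) ^ 2
      ≤ ENNReal.ofReal ((1 + h) * (W2 (lam.map S) ν).toReal ^ 2
        + (h + h ^ 2) * (2 * δ + 2 * (L * (W2 (lam.map S) ν).toReal) ^ 2)) := by
  have hL := hg.nonneg
  set w := (W2 (lam.map S) ν).toReal with hw
  have hw0 : 0 ≤ w := ENNReal.toReal_nonneg
  have hgμ : Measurable (g (lam.map S)) := (hg.cont _ hμ).measurable
  have hgν : Measurable (g ν) := (hg.cont _ hν).measurable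
  have hcont : ContinuousAt (fun q : ℝ => ENNReal.ofReal ((1 + h) * q ^ 2
      + (h + h ^ 2) * (2 * δ + 2 * (L * q) ^ 2))) w :=
    (ENNReal.continuous_ofReal.comp (by fun_prop)).continuousAt
  -- The bound is shown for every `q > w`, where a coupling of cost below `q` exists, and `q`
  -- decreases to `w`.
  refine ge_of_tendsto (hcont.tendsto.mono_left nhdsWithin_le_nhds)
    (eventually_nhdsWithin_of_forall (s := Ioi w) fun q (hq : w < q) => ?_)
  have hq0 : 0 ≤ q := hw0.trans hq.le
  have hWq : W2 (lam.map S) ν < ENNReal.ofReal q := by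
    rw [← ENNReal.ofReal_toReal (hμ.W2_lt_top hν).ne]
    exact (ENNReal.ofReal_lt_ofReal_iff (hw0.trans_lt hq)).2 hq
  obtain ⟨π, hπ, hlt⟩ := exists_coupling_lt hWq
  -- The velocity `η` depends on `z` and not only on `S z`, so the coupling of laws is lifted to the
  -- reference space.
  obtain ⟨γ, hγ1, hγ2⟩ := exists_gluing lam hS π hπ.1
  have hSX : Measurable fun p : Euc d × Euc d => (S p.1, p.2) := by fun_prop
  have hlawS : γ.map (fun p => S p.1) = lam.map S := by
    rw [← hγ1, Measure.map_map hS measurable_fst]; rfl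
  have hlawX : γ.map Prod.snd = ν := by
    rw [← hπ.2, ← hγ2, Measure.map_map measurable_snd hSX]; rfl
  have ha : eLpNorm (fun p : Euc d × Euc d => S p.1 - p.2) 2 γ ≤ ENNReal.ofReal q := by
    rw [← hγ2, eLpNorm_two_map hSX (by fun_prop)] at hlt
    exact hlt.le
  have ham : MemLp (fun p : Euc d × Euc d => S p.1 - p.2) 2 γ :=
    ⟨by fun_prop, ha.trans_lt ENNReal.ofReal_lt_top⟩
  have hc : eLpNorm (fun p : Euc d × Euc d => g (lam.map S) (S p.1) - g ν p.2) 2 γ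
      ≤ ENNReal.ofReal (L * q) := by
    rw [ENNReal.ofReal_mul hL]
    refine (hg.eLpNorm_le (by fun_prop) measurable_snd hlawS hlawX hμ hν).trans ?_
    gcongr
  have hcm : MemLp (fun p : Euc d × Euc d => g (lam.map S) (S p.1) - g ν p.2) 2 γ :=
    ⟨by fun_prop, hc.trans_lt ENNReal.ofReal_lt_top⟩
  have hbm0 : MemLp (fun z => g (lam.map S) (S z) + η z) 2 lam :=
    (memLp_comp_of_map_eq hS rfl (hg.memLp hμ)).add hη2
  have hbm : MemLp (fun p : Euc d × Euc d => g (lam.map S) (S p.1) + η p.1) 2 γ :=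
    memLp_comp_of_map_eq measurable_fst hγ1 hbm0
  have hb : ∫ p, ‖g (lam.map S) (S p.1) + η p.1‖ ^ 2 ∂γ ≤ δ := by
    rw [← ENNReal.ofReal_le_ofReal_iff hδ0, ofReal_integral_norm_sq hbm]
    refine le_trans (le_of_eq ?_) hδ
    have := eLpNorm_two_map (μ := γ) (f := fun z => g (lam.map S) (S z) + η z) measurable_fst
      (by fun_prop)
    rw [hγ1] at this
    rw [this]
    rfl
  have hsum : MemLp (fun p : Euc d × Euc d => (S p.1 + h • η p.1) - (p.2 - h • g ν p.2)) 2 γ := by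
    refine (ham.add ((hbm.sub hcm).const_smul h)).ae_eq (Eventually.of_forall fun p => ?_)
    simp only [Pi.add_apply, Pi.smul_apply, Pi.sub_apply]
    module
  have hlaw1 : γ.map (fun p => S p.1 + h • η p.1) = lam.map fun z => S z + h • η z := by
    rw [← hγ1, Measure.map_map (by fun_prop) measurable_fst]; rfl
  have hlaw2 : γ.map (fun p => p.2 - h • g ν p.2) = ν.map fun x => x - h • g ν x := by
    rw [← hlawX, Measure.map_map (by rw [hlawX]; fun_prop) measurable_snd]; rfl
  have hW := W2_map_le (γ := γ) (X := fun p => S p.1 + h • η p.1)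
    (Y := fun p => p.2 - h • g ν p.2) (by fun_prop) (by fun_prop)
  rw [hlaw1, hlaw2] at hW
  refine (pow_le_pow_left' hW 2).trans ?_
  rw [← ofReal_integral_norm_sq hsum]
  refine ENNReal.ofReal_le_ofReal ?_
  have hsq : ∀ {f : Euc d × Euc d → Euc d}, MemLp f 2 γ → Integrable (fun p => ‖f p‖ ^ 2) γ :=
    fun hf => hf.integrable_norm_pow two_ne_zero
  have i12 : Integrable (fun p : Euc d × Euc d => 2 * ‖g (lam.map S) (S p.1) + η p.1‖ ^ 2
      + 2 * ‖g (lam.map S) (S p.1) - g ν p.2‖ ^ 2) γ :=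
    ((hsq hbm).const_mul 2).add ((hsq hcm).const_mul 2)
  calc ∫ p, ‖(S p.1 + h • η p.1) - (p.2 - h • g ν p.2)‖ ^ 2 ∂γ
      ≤ ∫ p, ((1 + h) * ‖S p.1 - p.2‖ ^ 2 + (h + h ^ 2) *
          (2 * ‖g (lam.map S) (S p.1) + η p.1‖ ^ 2
            + 2 * ‖g (lam.map S) (S p.1) - g ν p.2‖ ^ 2)) ∂γ := by
        refine integral_mono (hsq hsum) (((hsq ham).const_mul _).add (i12.const_mul _)) fun p => ?_
        refine le_trans (le_of_eq ?_) (norm_add_smul_sub_sq_le _ _ _ hh)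
        congr 2
        module
    _ = (1 + h) * (∫ p, ‖S p.1 - p.2‖ ^ 2 ∂γ) + (h + h ^ 2) *
          (2 * (∫ p, ‖g (lam.map S) (S p.1) + η p.1‖ ^ 2 ∂γ)
            + 2 * (∫ p, ‖g (lam.map S) (S p.1) - g ν p.2‖ ^ 2 ∂γ)) := by
        rw [integral_add ((hsq ham).const_mul _) (i12.const_mul _), integral_const_mul,
          integral_const_mul, integral_add ((hsq hbm).const_mul 2) ((hsq hcm).const_mul 2),
          integral_const_mul, integral_const_mul]
    _ ≤ _ := by
        gcongr
        · exact integral_norm_sq_le ham hq0 ha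
        · exact integral_norm_sq_le hcm (by positivity) hc

end Comparison

/-! ### Growth of the distance along the flows and Grönwall's inequality. -/

section Flow

variable {n d : ℕ} {lam : Measure (Euc d)} {Θ : Set (Euc n)} {T : Euc n → Euc d → Euc d}

/-- First order expansion in `L²` of the parameterized maps along a differentiable curve. -/
theorem IsParamFamily.eventually_taylor_curve [SFinite lam] (hT : IsParamFamily lam Θ T)
    {θ : ℝ → Euc n} {v : Euc n} {l : Set ℝ} {s : ℝ} (hs : θ s ∈ Θ)
    (hd : HasDerivWithinAt θ v l s) {ε : ℝ} (hε : 0 < ε) : ∀ᶠ t in 𝓝[l] s, θ t ∈ Θ ∧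
      eLpNorm (fun z => T (θ t) z - (T (θ s) z + (t - s) • dParam T (θ s) z v)) 2 lam
        ≤ ENNReal.ofReal (ε * |t - s|) := by
  set K := (eLpNorm (dParam T (θ s)) 2 lam).toReal with hK
  have hK0 : 0 ≤ K := ENNReal.toReal_nonneg
  set ε₁ := ε / (2 * (‖v‖ + 1)) with hε₁
  set ε₂ := min 1 (ε / (2 * (K + 1))) with hε₂
  have p1 : 0 < ε₁ := by positivity
  have p2 : 0 < ε₂ := by positivity
  have p3 : ε₁ * (‖v‖ + ε₂) ≤ ε / 2 := by
    calc ε₁ * (‖v‖ + ε₂) ≤ ε₁ * (‖v‖ + 1) := by gcongr; exact min_le_left _ _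
      _ = ε / 2 := by rw [hε₁]; field_simp
  have p4 : K * ε₂ ≤ ε / 2 := by
    calc K * ε₂ ≤ (K + 1) * (ε / (2 * (K + 1))) := by
          gcongr
          · exact le_add_of_nonneg_right zero_le_one
          · exact min_le_right _ _
      _ = ε / 2 := by field_simp
  have hlo := Asymptotics.isLittleO_iff.1 (hasDerivWithinAt_iff_isLittleO.1 hd) p2
  filter_upwards [hlo, hd.continuousWithinAt.eventually (hT.eventually_taylor hs p1)]
    with t h1 ⟨htΘ, h2⟩
  refine ⟨htΘ, ?_⟩
  rw [Real.norm_eq_abs] at h1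
  have h3 : ‖θ t - θ s‖ ≤ (‖v‖ + ε₂) * |t - s| := by
    calc ‖θ t - θ s‖ = ‖(t - s) • v + (θ t - θ s - (t - s) • v)‖ := by congr 1; abel
      _ ≤ |t - s| * ‖v‖ + ε₂ * |t - s| :=
        (norm_add_le _ _).trans (add_le_add (by rw [norm_smul, Real.norm_eq_abs]) h1)
      _ = _ := by ring
  have h4 := hT.eLpNorm_apply_le hs (θ t - θ s - (t - s) • v)
  have m1 := hT.measurable _ hs
  have m2 := hT.measurable _ htΘ
  have m3 := hT.measurable_dParam_apply hs (θ t - θ s)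
  have m4 := hT.measurable_dParam_apply hs (θ t - θ s - (t - s) • v)
  have h5 := eLpNorm_add_le_ofReal (γ := lam) (by fun_prop) (by fun_prop) (by positivity)
    (by positivity) h2 h4
  refine le_trans (le_of_eq ?_) (h5.trans (ENNReal.ofReal_le_ofReal ?_))
  · congr 1; ext1 z
    rw [map_sub _ (θ t - θ s), map_smul]
    abel
  · calc ε₁ * ‖θ t - θ s‖ + K * ‖θ t - θ s - (t - s) • v‖
        ≤ ε₁ * ((‖v‖ + ε₂) * |t - s|) + K * (ε₂ * |t - s|) := by gcongr
      _ = (ε₁ * (‖v‖ + ε₂) + K * ε₂) * |t - s| := by ring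
      _ ≤ (ε / 2 + ε / 2) * |t - s| := by gcongr
      _ = ε * |t - s| := by rw [add_halves]

variable {F : Measure (Euc d) → ℝ} {δF : Measure (Euc d) → Euc d → ℝ} {L τ : ℝ}
  {θ : ℝ → Euc n} {ρ : ℝ → Measure (Euc d)}

/-- Growth of the distance between the two flows over a short time. -/
theorem IsPWGFSolution.eventually_W2_le [IsProbabilityMeasure lam] (hT : IsParamFamily lam Θ T)
    (h : HasFirstVariation F δF) (hg : IsLipField (fun μ => gradient (δF μ)) L)
    (hθ : IsPWGFSolution F lam Θ T τ θ) (hρ : IsWGFSolution δF τ ρ)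
    (hδ : projError δF lam Θ T ≠ ⊤) {s : ℝ} (hs : s ∈ Ico 0 τ) {ε : ℝ} (hε : 0 < ε) :
    ∀ᶠ t in 𝓝[>] s, (W2 (lam.map (T (θ t))) (ρ t)).toReal
      ≤ √((1 + (t - s)) * (W2 (lam.map (T (θ s))) (ρ s)).toReal ^ 2
          + ((t - s) + (t - s) ^ 2) * (2 * (projError δF lam Θ T).toReal
            + 2 * (L * (W2 (lam.map (T (θ s))) (ρ s)).toReal) ^ 2)) + ε * (t - s) := by
  have hsI : s ∈ Icc 0 τ := ⟨hs.1, hs.2.le⟩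
  have hsΘ := hθ.mem s hsI
  obtain ⟨P, hP, hd⟩ := hθ.hasDeriv s hsI
  set ξ := Matrix.toEuclideanLin P (gradient (paramEnergy F lam T) (θ s)) with hξ
  have hproj := hT.eLpNorm_sq_le_projError h hg hsΘ (hθ.differentiable s hsI) hP
  have hsub : 𝓝[>] s ≤ 𝓝[Icc 0 τ] s := nhdsWithin_le_of_mem (Icc_mem_nhdsGT_of_mem hs)
  obtain ⟨r, hr, hrτ, hstep⟩ := hρ.W2_euler_step_le hg hs (half_pos hε)
  filter_upwards [hsub (hT.eventually_taylor_curve hsΘ hd (half_pos hε)),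
    Ioo_mem_nhdsGT (show s < s + r by linarith)] with t ⟨htΘ, h1⟩ htr
  have hh : 0 < t - s := sub_pos.2 htr.1
  have h2 := hstep (t - s) hh (by linarith [htr.2])
  rw [add_sub_cancel] at h2
  rw [abs_of_pos hh] at h1
  have htI : t ∈ Icc 0 τ := ⟨hs.1.trans htr.1.le, by linarith [htr.2]⟩
  have m1 := hT.measurable _ hsΘ
  have m2 := hT.measurable _ htΘ
  have m3 := hT.measurable_dParam_apply hsΘ (-ξ)
  have h3 := hg.W2_sq_step_le (S := T (θ s)) (η := fun z => dParam T (θ s) z (-ξ))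
    (δ := (projError δF lam Θ T).toReal) (h := t - s) m1 m3
    (hT.memLp_apply hsΘ (-ξ)) (hT.isDensity _ hsΘ) (hρ.isDensity s hsI) ENNReal.toReal_nonneg
    (by
      rw [ENNReal.ofReal_toReal hδ]
      simpa only [map_neg, ← sub_eq_add_neg] using hproj) hh.le
  set p := (1 + (t - s)) * (W2 (lam.map (T (θ s))) (ρ s)).toReal ^ 2
          + ((t - s) + (t - s) ^ 2) * (2 * (projError δF lam Θ T).toReal
            + 2 * (L * (W2 (lam.map (T (θ s))) (ρ s)).toReal) ^ 2) with hp
  have hp0 : 0 ≤ p := by positivity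
  rw [← Real.sq_sqrt hp0, ENNReal.ofReal_pow (Real.sqrt_nonneg _),
    ENNReal.pow_le_pow_left_iff two_ne_zero] at h3
  have i1 := (hT.isDensity _ htΘ).isProb
  have i2 : IsProbabilityMeasure
      (lam.map fun z => T (θ s) z + (t - s) • dParam T (θ s) z (-ξ)) :=
    Measure.isProbabilityMeasure_map (by fun_prop)
  refine ENNReal.toReal_le_of_le_ofReal (by positivity) ?_
  -- Three legs: the parameterized flow to its Euler step, one Euler step to the other, and the
  -- second Euler step to `ρ t`.
  calc W2 (lam.map (T (θ t))) (ρ t)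
      ≤ ENNReal.ofReal (ε / 2 * (t - s)) + (ENNReal.ofReal √p
          + ENNReal.ofReal (ε / 2 * (t - s))) := by
        refine (W2_triangle _ (lam.map fun z => T (θ s) z + (t - s) • dParam T (θ s) z (-ξ)) _).trans
          (add_le_add ((W2_map_le m2 (by fun_prop)).trans h1) ?_)
        exact (W2_triangle _ _ _).trans (add_le_add h3 h2)
    _ = ENNReal.ofReal (√p + ε * (t - s)) := by
        rw [← ENNReal.ofReal_add (by positivity) (by positivity),
          ← ENNReal.ofReal_add (by positivity) (by positivity)]
        congr 1; ring

/-- The distance between the two flows is continuous in time. -/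
theorem IsPWGFSolution.continuousOn_W2 [IsProbabilityMeasure lam] (hT : IsParamFamily lam Θ T)
    (hθ : IsPWGFSolution F lam Θ T τ θ) (hρ : IsWGFSolution δF τ ρ) :
    ContinuousOn (fun t => (W2 (lam.map (T (θ t))) (ρ t)).toReal) (Icc 0 τ) := by
  intro s hs
  have hsΘ := hθ.mem s hs
  obtain ⟨P, -, hd⟩ := hθ.hasDeriv s hs
  obtain ⟨c, -, hlip⟩ := hT.eventually_lipschitz hsΘ
  have l1 : Tendsto (fun t => W2 (lam.map (T (θ t))) (lam.map (T (θ s)))) (𝓝[Icc 0 τ] s) (𝓝 0) := by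
    have hθs : Tendsto (fun t => ENNReal.ofReal (c * ‖θ t - θ s‖)) (𝓝[Icc 0 τ] s) (𝓝 0) := by
      have := (((hd.continuousWithinAt.tendsto.sub_const (θ s)).norm).const_mul c)
      rw [sub_self, norm_zero, mul_zero] at this
      simpa using ENNReal.tendsto_ofReal this
    refine tendsto_of_tendsto_of_tendsto_of_le_of_le' tendsto_const_nhds hθs
      (Eventually.of_forall fun _ => zero_le) ?_
    filter_upwards [hd.continuousWithinAt.eventually hlip] with t ht
    exact (W2_map_le (hT.measurable _ ht.1) (hT.measurable _ hsΘ)).trans ht.2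
  have l2 := l1.add (hρ.continuous s hs)
  rw [add_zero] at l2
  have l3 := (ENNReal.tendsto_toReal ENNReal.zero_ne_top).comp l2
  refine tendsto_iff_dist_tendsto_zero.2 (squeeze_zero' (Eventually.of_forall fun _ => dist_nonneg)
    ?_ l3)
  filter_upwards [self_mem_nhdsWithin] with t ht
  have dμt := hT.isDensity _ (hθ.mem t ht)
  have dμs := hT.isDensity _ hsΘ
  have dρt := hρ.isDensity t ht
  have dρs := hρ.isDensity s hs
  have := dμt.isProb
  have := dμs.isProb
  have := dρt.isProb
  have := dρs.isProb
  have f1 := (dμt.W2_lt_top dμs).ne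
  have f2 := (dρt.W2_lt_top dρs).ne
  have f3 := (dμt.W2_lt_top dρt).ne
  have f4 := (dμs.W2_lt_top dρs).ne
  have t1 : W2 (lam.map (T (θ t))) (ρ t) ≤ W2 (lam.map (T (θ t))) (lam.map (T (θ s)))
      + W2 (ρ t) (ρ s) + W2 (lam.map (T (θ s))) (ρ s) := by
    refine (W2_triangle _ (lam.map (T (θ s))) _).trans ?_
    rw [add_assoc, add_comm (W2 (ρ t) (ρ s)), W2_comm (ρ t) (ρ s)]
    gcongr
    exact W2_triangle _ _ _
  have t2 : W2 (lam.map (T (θ s))) (ρ s) ≤ W2 (lam.map (T (θ t))) (lam.map (T (θ s)))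
      + W2 (ρ t) (ρ s) + W2 (lam.map (T (θ t))) (ρ t) := by
    refine (W2_triangle _ (lam.map (T (θ t))) _).trans ?_
    rw [add_assoc, add_comm (W2 (ρ t) (ρ s)), W2_comm (lam.map (T (θ s)))]
    gcongr
    exact W2_triangle _ _ _
  have t1' := ENNReal.toReal_mono (by finiteness) t1
  have t2' := ENNReal.toReal_mono (by finiteness) t2
  rw [ENNReal.toReal_add (by finiteness) (by finiteness)] at t1' t2'
  rw [Real.dist_eq, abs_sub_le_iff]
  simp only [Function.comp_apply]
  constructor <;> linarith

/-- Squaring the step bound turns the error `ε * (t - s)` into a cross term that is small relative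
to `t - s`. Working with the square avoids division by `w`, which may vanish. -/
theorem eventually_sq_slope_lt {f : ℝ → ℝ} {s w δ C r : ℝ} (hf : ∀ t, 0 ≤ f t) (hw : f s = w)
    (hδ : 0 ≤ δ) (hC : 0 ≤ C)
    (hstep : ∀ ε > 0, ∀ᶠ t in 𝓝[>] s, f t ≤ √((1 + (t - s)) * w ^ 2
      + ((t - s) + (t - s) ^ 2) * (2 * δ + 2 * (√C * w) ^ 2)) + ε * (t - s))
    (hr : (1 + 2 * C) * w ^ 2 + 2 * δ < r) :
    ∀ᶠ t in 𝓝[>] s, (t - s)⁻¹ * (f t ^ 2 - f s ^ 2) < r := by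
  have hw0 : 0 ≤ w := hw ▸ hf s
  set K := (1 + 2 * C) * w ^ 2 + 2 * δ with hK
  set M := 2 * δ + 2 * C * w ^ 2 with hM
  have hM0 : 0 ≤ M := by positivity
  have hK0 : 0 ≤ K := by positivity
  set R := √(w ^ 2 + K + M) with hR
  have hR0 : 0 ≤ R := Real.sqrt_nonneg _
  have hrK : 0 < r - K := sub_pos.2 hr
  -- `ε` is chosen so that the cross term uses at most half of the slack `r - K`; the cap on `k`
  -- below makes the quadratic terms use less than the other half.
  set ε := min 1 ((r - K) / (4 * (R + 1))) with hεd
  have hε : 0 < ε := by positivity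
  have hε1 : ε ≤ 1 := min_le_left _ _
  have hεR : 2 * ε * R ≤ (r - K) / 2 := by
    calc 2 * ε * R ≤ 2 * ((r - K) / (4 * (R + 1))) * (R + 1) := by
          gcongr
          · exact min_le_right _ _
          · exact le_add_of_nonneg_right zero_le_one
      _ = (r - K) / 2 := by field_simp; norm_num
  have hlt : s < s + min 1 ((r - K) / (2 * (M + 1))) := lt_add_of_pos_right _ (by positivity)
  filter_upwards [hstep ε hε, Ioo_mem_nhdsGT hlt] with t ht htI
  have hh : 0 < t - s := sub_pos.2 htI.1
  set k := t - s with hk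
  have hkm : k < min 1 ((r - K) / (2 * (M + 1))) := by linarith [htI.2]
  have hk1 : k ≤ 1 := (hkm.trans_le (min_le_left _ _)).le
  have hk2 : k * (M + 1) < (r - K) / 2 := by
    calc k * (M + 1) < (r - K) / (2 * (M + 1)) * (M + 1) := by
          have := hkm.trans_le (min_le_right _ _)
          gcongr
      _ = (r - K) / 2 := by field_simp
  have ep : (1 + k) * w ^ 2 + (k + k ^ 2) * (2 * δ + 2 * (√C * w) ^ 2)
      = w ^ 2 + k * K + k ^ 2 * M := by
    rw [mul_pow, Real.sq_sqrt hC]; ring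
  rw [ep] at ht
  have hp0 : 0 ≤ w ^ 2 + k * K + k ^ 2 * M := by positivity
  have hpR : √(w ^ 2 + k * K + k ^ 2 * M) ≤ R := by
    refine Real.sqrt_le_sqrt ?_
    gcongr
    · exact mul_le_of_le_one_left hK0 hk1
    · exact mul_le_of_le_one_left hM0 (pow_le_one₀ hh.le hk1)
  have hsq : f t ^ 2 ≤ (w ^ 2 + k * K + k ^ 2 * M) + 2 * ε * k * R + k ^ 2 := by
    calc f t ^ 2 ≤ (√(w ^ 2 + k * K + k ^ 2 * M) + ε * k) ^ 2 := by
          gcongr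
          exact hf t
      _ = √(w ^ 2 + k * K + k ^ 2 * M) ^ 2
          + 2 * ε * k * √(w ^ 2 + k * K + k ^ 2 * M) + (ε * k) ^ 2 := by ring
      _ ≤ (w ^ 2 + k * K + k ^ 2 * M) + 2 * ε * k * R + k ^ 2 := by
          rw [Real.sq_sqrt hp0]
          gcongr
          exact mul_le_of_le_one_left hh.le hε1
  rw [hw, inv_mul_lt_iff₀ hh]
  calc f t ^ 2 - w ^ 2 ≤ k * (K + k * (M + 1) + 2 * ε * R) := by linarith
    _ < k * r := by gcongr; linarith

/-- Grönwall estimate for the distance between the two flows. -/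
theorem IsPWGFSolution.W2_sq_le [IsProbabilityMeasure lam] (hT : IsParamFamily lam Θ T)
    (h : HasFirstVariation F δF) {C : ℝ} (hC : 0 < C)
    (hg : IsLipField (fun μ => gradient (δF μ)) √C)
    (hθ : IsPWGFSolution F lam Θ T τ θ) (hρ : IsWGFSolution δF τ ρ)
    (hδ : projError δF lam Θ T ≠ ⊤) {t : ℝ} (ht : t ∈ Icc 0 τ) :
    W2 (lam.map (T (θ t))) (ρ t) ^ 2
      ≤ ENNReal.ofReal (Real.exp ((1 + 2 * C) * t)) * W2 (lam.map (T (θ 0))) (ρ 0) ^ 2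
        + 2 * projError δF lam Θ T / ENNReal.ofReal (1 + 2 * C)
          * ENNReal.ofReal (Real.exp ((1 + 2 * C) * t) - 1) := by
  set f : ℝ → ℝ := fun t => (W2 (lam.map (T (θ t))) (ρ t)).toReal with hf
  set δ := (projError δF lam Θ T).toReal with hδd
  have hf0 : ∀ t, 0 ≤ f t := fun t => ENNReal.toReal_nonneg
  have hfin : ∀ t ∈ Icc 0 τ, W2 (lam.map (T (θ t))) (ρ t) = ENNReal.ofReal (f t) := fun t ht =>
    (ENNReal.ofReal_toReal ((hT.isDensity _ (hθ.mem t ht)).W2_lt_top (hρ.isDensity t ht)).ne).symm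
  -- Continuity and a bound on the right lower slope suffice, so the distance need not be
  -- differentiable.
  have hgr := le_gronwallBound_of_liminf_deriv_right_le (f := fun t => f t ^ 2)
    (f' := fun s => (1 + 2 * C) * f s ^ 2 + 2 * δ) (δ := f 0 ^ 2) (K := 1 + 2 * C) (ε := 2 * δ)
    ((hθ.continuousOn_W2 hT hρ).pow 2)
    (fun s hs r hr => (eventually_sq_slope_lt hf0 rfl ENNReal.toReal_nonneg hC.le
      (fun ε hε => hθ.eventually_W2_le hT h hg hρ hδ hs hε) hr).frequently)
    le_rfl (fun _ _ => le_rfl) t ht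
  rw [gronwallBound_of_K_ne_0 (by positivity), sub_zero] at hgr
  have h0 : (0 : ℝ) ∈ Icc 0 τ := ⟨le_rfl, ht.1.trans ht.2⟩
  have hexp : 0 ≤ Real.exp ((1 + 2 * C) * t) - 1 :=
    sub_nonneg.2 (Real.one_le_exp (mul_nonneg (by positivity) ht.1))
  have hδ0 : 0 ≤ δ := ENNReal.toReal_nonneg
  rw [hfin t ht, hfin 0 h0, ← ENNReal.ofReal_toReal hδ, ← hδd, ← ENNReal.ofReal_pow (hf0 t),
    ← ENNReal.ofReal_pow (hf0 0), ← ENNReal.ofReal_mul (Real.exp_pos _).le,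
    ← ENNReal.ofReal_ofNat 2, ← ENNReal.ofReal_mul zero_le_two,
    ← ENNReal.ofReal_div_of_pos (by positivity), ← ENNReal.ofReal_mul (by positivity),
    ← ENNReal.ofReal_add (by positivity) (by positivity)]
  refine ENNReal.ofReal_le_ofReal (hgr.trans_eq ?_)
  simp only [mul_comm (f 0 ^ 2)]

end Flow

end PWGF

end

/-! ### The main theorem: degenerate cases and conclusion. -/

theorem mainTheorem1 {n d : ℕ}
    (lam : Measure (PWGF.Euc d)) (hprob : IsProbabilityMeasure lam)
    (hac : lam ≪ (volume : Measure (PWGF.Euc d)))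
    (F : Measure (PWGF.Euc d) → ℝ) (δF : Measure (PWGF.Euc d) → PWGF.Euc d → ℝ)
    (hδF : PWGF.HasFirstVariation F δF)
    (C : ℝ) (hC : 0 < C) (hLip : PWGF.LipCondition lam δF C)
    (Θ : Set (PWGF.Euc n)) (T : PWGF.Euc n → PWGF.Euc d → PWGF.Euc d)
    (hT : PWGF.IsParamFamily lam Θ T)
    (τ : ℝ) (θ : ℝ → PWGF.Euc n) (hθ : PWGF.IsPWGFSolution F lam Θ T τ θ)
    (ρ : ℝ → Measure (PWGF.Euc d)) (hρ : PWGF.IsWGFSolution δF τ ρ)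
    (t : ℝ) (ht : t ∈ Icc 0 τ) :
    PWGF.W2 (lam.map (T (θ t))) (ρ t) ^ 2
      ≤ ENNReal.ofReal (Real.exp ((1 + 2 * C) * t)) * PWGF.W2 (lam.map (T (θ 0))) (ρ 0) ^ 2
        + 2 * PWGF.projError δF lam Θ T / ENNReal.ofReal (1 + 2 * C)
          * ENNReal.ofReal (Real.exp ((1 + 2 * C) * t) - 1) := by
  -- In dimension 0 there is no coordinate with which to represent couplings, but the space is a
  -- point and the distance is zero.
  rcases Nat.eq_zero_or_pos d with rfl | hd
  · have h1 := (hT.isDensity _ (hθ.mem t ht)).isProb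
    have h2 := (hρ.isDensity t ht).isProb
    have hc : PWGF.IsCoupling (lam.map (T (θ t))) (ρ t) ((lam.map (T (θ t))).prod (ρ t)) :=
      ⟨by simp, by simp⟩
    have h3 := PWGF.W2_le_of_isCoupling hc
    have h4 : (fun p : PWGF.Euc 0 × PWGF.Euc 0 => p.1 - p.2) = 0 := Subsingleton.elim _ _
    rw [h4, eLpNorm_zero, nonpos_iff_eq_zero] at h3
    rw [h3]
    simp
  have : NeZero d := ⟨hd.ne'⟩
  have hg := hLip.isLipField hac hδF
  by_cases hδ : PWGF.projError δF lam Θ T = ⊤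
  -- At `t = 0` the infinite error is multiplied by 0, which gives 0 in `ℝ≥0∞`; for `t > 0` the
  -- right-hand side is infinite.
  · rcases ht.1.eq_or_lt with rfl | ht0
    · simp
    · have hexp : 0 < Real.exp ((1 + 2 * C) * t) - 1 :=
        sub_pos.2 (Real.one_lt_exp_iff.2 (by positivity))
      rw [hδ, ENNReal.mul_top two_ne_zero, ENNReal.top_div_of_ne_top ENNReal.ofReal_ne_top,
        ENNReal.top_mul (ENNReal.ofReal_pos.2 hexp).ne', add_top]
      exact le_top
  · exact hθ.W2_sq_le hT hδF hC hg hρ hδ ht
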